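/- **Setting.** Let $\mathcal G=(V,E)$ be a connected, locally finite planar graph embedded in $\mathbb R^2$ (finitely many vertices in every bounded region, finite degrees), whose edges are straight segments that intersect only at common end-points. Assume that $\mathcal G$ is invariant under the translations by $(1,0)$ and $(0,1)$, the rotation by $\pi/2$ around the origin, and the orthogonal reflection with respect to the vertical axis, and that some vertex lies on the horizontal axis (for instance $0\in V$). Fix a real $q\ge 1$. For a finite set of edges $F\subset E$ let $V_F$ be the set of end-points of the edges of $F$, and let $\partial F$ be the set of $x\in V_F$ that are incident to an edge of $E\setminus F$. For a partition $\xi$ of $\partial F$ and $p\in[0,1]$, the random-cluster measure on $\{0,1\}^F$ with boundary condition $\xi$ is $$\phi^{\xi}_{p,q,F}(\eta)=\frac{p^{o(\eta)}(1-p)^{c(\eta)}q^{k(\eta^\xi)}}{Z^\xi(p,q,F)},$$ where $o(\eta)$ and $c(\eta)$ are the numbers of open ($\eta(e)=1$) and closed ($\eta(e)=0$) edges, and $k(\eta^\xi)$ is the number of connected components of the graph on $V_F$ formed by the open edges after the vertices in each class of $\xi$ are identified. A configuration $\omega\in\{0,1\}^E$ induces the boundary condition $\chi_F(\omega)$ on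 $F$, in which two vertices of $\partial F$ are in the same class if and only if they are connected by a path of open edges of $E\setminus F$. An infinite-volume random-cluster measure with parameters $p,q$ is a probability measure $\phi$ on $\{0,1\}^{E}$ such that, for every finite $F\subset E$ and every partition $\xi$ of $\partial F$ with $\phi(\chi_F(\omega)=\xi)>0$, $$\phi\big(\omega_{|F}=\cdot \,\big|\, \chi_F(\omega)=\xi\big)=\phi^\xi_{p,q,F}(\cdot).$$ Let $\mathcal C_v(2n,n)$ be the event that there is a path of open edges, all of whose vertices lie in $[0,2n]\times[0,n]$, from a vertex in $[0,2n]\times\{0\}$ to a vertex in $[0,2n]\times\{n\}$. Let $x\longleftrightarrow y$ be the event that $x$ and $y$ are connected by a path of open edges. **Proposition.** Let $p_0\in(0,1)$ be such that there exists an infinite-volume random-cluster measure $\phi_{p_0}$ with parameters $p_0,q$ and $$\liminf_{n\to\infty}\phi_{p_0}\big(\mathcal C_v(2n,n)\big)=0 .$$ Then for every $p\in[0,p_0)$ there exists $c=c(p)>0$ such that, for every infinite-volume random-cluster measure $\phi_p$ with parameters $p,q$ and all $x,y\in V$, $$\phi_p(x\longleftrightarrow y)\le \exp(-c|x-y|),$$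 where $|\cdot|$ is the Euclidean norm. -/

import Mathlib

open MeasureTheory ProbabilityTheory

/-- The plane `ℝ²` is identified with `ℂ`. A graph `G` with vertices placed by `pos` is a
planar lattice with square symmetry: connected, locally finite, drawn with straight edges that meet
only at common end-points, and invariant under the translations by `(1,0)` and `(0,1)`, the rotation
by `π/2` around the origin, and the reflection with respect to the vertical axis. -/
structure IsPlanarLattice {V : Type*} (G : SimpleGraph V) (pos : V → ℂ) : Prop where
  connected : G.Connected
  finite_neighbors : ∀ x, (G.neighborSet x).Finite
  pos_injective : Function.Injective pos
  finite_in_ball : ∀ r : ℝ, {x | ‖pos x‖ ≤ r}.Finite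
  planar : ∀ a b c d, G.Adj a b → G.Adj c d → s(a, b) ≠ s(c, d) →
    segment ℝ (pos a) (pos b) ∩ segment ℝ (pos c) (pos d) ⊆
      {pos a, pos b} ∩ {pos c, pos d}
  translate_one : ∃ φ : G ≃g G, ∀ x, pos (φ x) = pos x + 1
  translate_I : ∃ φ : G ≃g G, ∀ x, pos (φ x) = pos x + Complex.I
  rotate : ∃ φ : G ≃g G, ∀ x, pos (φ x) = Complex.I * pos x
  reflect : ∃ φ : G ≃g G, ∀ x, pos (φ x) = -(starRingEnd ℂ) (pos x)

namespace FK

variable {V : Type*}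

/-- Edge configurations; `true` means open. -/
abbrev Config (G : SimpleGraph V) : Type _ := G.edgeSet → Bool

/-- The graph of open edges of a configuration. -/
def openGraph (G : SimpleGraph V) (ω : Config G) : SimpleGraph V where
  Adj x y := ∃ h : G.Adj x y, ω ⟨s(x, y), h⟩ = true
  symm := ⟨by
    rintro x y ⟨h, hω⟩
    refine ⟨h.symm, ?_⟩
    have e : (⟨s(y, x), h.symm⟩ : G.edgeSet) = ⟨s(x, y), h⟩ := Subtype.ext Sym2.eq_swap
    rw [e]
    exact hω⟩
  loopless := ⟨fun x ⟨h, _⟩ => G.loopless.irrefl x h⟩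

/-- The event that `x` and `y` are connected by an open path. -/
def connected (G : SimpleGraph V) (x y : V) : Set (Config G) :=
  {ω | (openGraph G ω).Reachable x y}

/-- The event that the rectangle `[0,a] × [0,b]` is crossed vertically: some open path, all of
whose vertices lie in the rectangle, joins a vertex on the bottom side to one on the top side. -/
def crossV (G : SimpleGraph V) (pos : V → ℂ) (a b : ℝ) : Set (Config G) :=
  {ω | ∃ x y : V, (pos x).im = 0 ∧ (pos y).im = b ∧
    ∃ w : (openGraph G ω).Walk x y,
      ∀ z ∈ w.support, (pos z).re ∈ Set.Icc 0 a ∧ (pos z).im ∈ Set.Icc 0 b}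

/-- The vertex set of the finite subgraph with edge set `E`: the end-points of the edges in `E`. -/
def verts (G : SimpleGraph V) (E : Finset G.edgeSet) : Set V :=
  {x | ∃ e ∈ E, x ∈ (e : Sym2 V)}

/-- The boundary of the finite subgraph with edge set `E`: its vertices that are incident to
an edge of `G` outside `E`. (For an induced subgraph these are the vertices with a neighbour
outside it.) -/
def boundary (G : SimpleGraph V) (E : Finset G.edgeSet) : Set V :=
  {x | x ∈ verts G E ∧ ∃ e : G.edgeSet, e ∉ E ∧ x ∈ (e : Sym2 V)}

/-- A boundary condition is a partition of the boundary. -/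
abbrev BoundaryCondition (G : SimpleGraph V) (E : Finset G.edgeSet) : Type _ :=
  Setoid (boundary G E)

open Classical in
/-- A configuration on `E`, extended by closed edges. -/
noncomputable def extend (G : SimpleGraph V) (E : Finset G.edgeSet) (η : E → Bool) : Config G :=
  fun e => if h : e ∈ E then η ⟨e, h⟩ else false

open Classical in
/-- The configuration `ω` with all the edges of `E` closed. -/
noncomputable def closeOn (G : SimpleGraph V) (E : Finset G.edgeSet) (ω : Config G) : Config G :=
  fun e => if e ∈ E then false else ω e

/-- The boundary condition on `E` induced by a configuration: two boundary vertices are wired if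
they are connected by open edges outside `E`. -/
noncomputable def inducedBC (G : SimpleGraph V) (E : Finset G.edgeSet) (ω : Config G) :
    BoundaryCondition G E where
  r x y := (openGraph G (closeOn G E ω)).Reachable x y
  iseqv := ⟨fun _ => SimpleGraph.Reachable.refl _, fun h => h.symm, fun h h' => h.trans h'⟩

/-- The graph `η^ξ` on the vertices of `E`: open edges of `η`, plus a link between any two boundary
vertices wired by `ξ`. -/
noncomputable def wiredGraph (G : SimpleGraph V) (E : Finset G.edgeSet)
    (ξ : BoundaryCondition G E) (η : E → Bool) : SimpleGraph (verts G E) :=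
  (openGraph G (extend G E η) ⊔
    SimpleGraph.fromRel (fun x y => ∃ (hx : x ∈ boundary G E) (hy : y ∈ boundary G E),
      ξ ⟨x, hx⟩ ⟨y, hy⟩)).induce (verts G E)

/-- `p ^ (#open edges) * (1 - p) ^ (#closed edges) * q ^ (#clusters of η^ξ)`. -/
noncomputable def weight (G : SimpleGraph V) (p q : ℝ) (E : Finset G.edgeSet)
    (ξ : BoundaryCondition G E) (η : E → Bool) : ℝ :=
  p ^ Nat.card {e : E // η e = true} * (1 - p) ^ Nat.card {e : E // η e = false} *
    q ^ Nat.card (wiredGraph G E ξ η).ConnectedComponent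

open Classical in
/-- The random-cluster probability of `η` on the finite subgraph with edge set `E`, with boundary
condition `ξ`. -/
noncomputable def prob (G : SimpleGraph V) (p q : ℝ) (E : Finset G.edgeSet)
    (ξ : BoundaryCondition G E) (η : E → Bool) : ℝ :=
  weight G p q E ξ η / ∑ η' : E → Bool, weight G p q E ξ η'

/-- Infinite-volume random-cluster measures: on every finite subgraph, conditionally on the
induced boundary condition, the configuration has the finite-volume random-cluster law. -/
structure IsInfiniteVolume (G : SimpleGraph V) (p q : ℝ) (μ : Measure (Config G)) : Prop where
  isProbabilityMeasure : IsProbabilityMeasure μ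
  cond_eq : ∀ (E : Finset G.edgeSet) (ξ : BoundaryCondition G E),
    μ {ω | inducedBC G E ω = ξ} ≠ 0 → ∀ η : E → Bool,
      μ[{ω | E.restrict ω = η} | {ω | inducedBC G E ω = ξ}] = ENNReal.ofReal (prob G p q E ξ η)

end FK

/-! The proof rests on one inequality, `ev_exp_le`. Let `f` be an increasing function that changes
by at most `C` when one edge is changed, and let `p < p'`. Tilt the finite-volume measure at `p` by
`exp (δ f)`. If `δ` is small in terms of `C`, `p`, `p'`, the tilt is weaker than the gain from `p`
to `p'`, so by Holley's inequality the tilted measure is still dominated by the measure at `p'`.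
Jensen's inequality under the tilted measure then bounds the exponential moment of `f` at `p` by
`exp (δ m)`, where `m` is the mean of `f` at `p'`.

It is used twice, with `p < p' < p₀`.

Between `p'` and `p₀`, for decay. Finite energy and folding turn the hypothesis into smallness of
crossings up to a bounded margin (`exists_weakCross_le`). Every free finite-volume measure at `p₀`
is dominated by `φ₀`, so at a suitable scale `L` every annulus of width `4L` is crossed with
probability at most 1/2, in every volume. Cover the plane by cells of side `R = 4KL`, with `K`
concentric annuli around each. An open path between distant points visits a chain of `k` distinct
cells and crosses all `kK` annuli, whereas the mean number of crossings is at most half of that.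
Since an edge lies in at most 9 annuli, whatever `K` is, the exponential moment makes this event
cost `exp (-δKk/2)` (`ev_chainCross_le`). For large `K` this beats the at most `9^k` chains. The
order of choices matters: `δ`, then `K`, then `L`.

Between `p` and `p'`, for the boundary condition (`IsInfiniteVolume.measureReal_le_of_ev_bot_le`).
Apply the inequality to the number of translates of an increasing local event that occur in a large
box. Passing from wired to free costs `q` to the power of the boundary, a surface-order factor,
while the exponents are of volume order. Hence every infinite-volume measure at `p` is bounded on
such events by the supremum over free measures at `p'`.

Pairs at bounded distance are treated by closing all the edges at one vertex. -/

namespace FK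

/-! ### Component counts as dimensions. -/

section Components

variable {W : Type*}

/-- The functions that are constant along the edges of a graph. -/
def locallyConstant (H : SimpleGraph W) : Submodule ℚ (W → ℚ) where
  carrier := {g | ∀ x y, H.Adj x y → g x = g y}
  add_mem' := fun ha hb x y h => by simp [ha x y h, hb x y h]
  zero_mem' := fun _ _ _ => rfl
  smul_mem' := fun c g hg x y h => by simp [hg x y h]

lemma eq_of_mem_locallyConstant {H : SimpleGraph W} {g : W → ℚ} (hg : g ∈ locallyConstant H)
    {x y : W} (h : H.Reachable x y) : g x = g y := by
  obtain ⟨w⟩ := h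
  induction w with
  | nil => rfl
  | cons h _ ih => exact (hg _ _ h).trans ih

/-- Pulling back along the quotient map identifies functions on components with locally constant
functions. Inequalities between component counts then follow from the dimension formula for
subspaces. -/
lemma card_connectedComponent_eq_finrank [Finite W] (H : SimpleGraph W) :
    Nat.card H.ConnectedComponent = Module.finrank ℚ (locallyConstant H) := by
  have hinj : Function.Injective (LinearMap.funLeft ℚ ℚ H.connectedComponentMk) :=
    LinearMap.funLeft_injective_of_surjective _ _ _ Quot.mk_surjective
  have hrange : LinearMap.range (LinearMap.funLeft ℚ ℚ H.connectedComponentMk) =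
      locallyConstant H := by
    ext g
    constructor
    · rintro ⟨f, rfl⟩ x y h
      simp only [LinearMap.funLeft_apply]
      rw [SimpleGraph.ConnectedComponent.sound h.reachable]
    · intro hg
      refine ⟨Quot.lift g fun x y h => eq_of_mem_locallyConstant hg h, ?_⟩
      ext x
      rfl
  have : Finite H.ConnectedComponent := Quot.finite _
  have := Fintype.ofFinite H.ConnectedComponent
  rw [← hrange, LinearMap.finrank_range_of_inj hinj, Module.finrank_fintype_fun_eq_card,
    Nat.card_eq_fintype_card]

lemma locallyConstant_anti {A B : SimpleGraph W} (h : A ≤ B) :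
    locallyConstant B ≤ locallyConstant A :=
  fun _ hg x y hxy => hg x y (h hxy)

lemma card_connectedComponent_anti [Finite W] {A B : SimpleGraph W} (h : A ≤ B) :
    Nat.card B.ConnectedComponent ≤ Nat.card A.ConnectedComponent := by
  rw [card_connectedComponent_eq_finrank, card_connectedComponent_eq_finrank]
  exact Submodule.finrank_mono (locallyConstant_anti h)

/-- The number of components is supermodular. -/
lemma card_connectedComponent_supermodular [Finite W] {A B I S : SimpleGraph W}
    (hA : I ≤ A) (hB : I ≤ B) (hS : S ≤ A ⊔ B) :
    Nat.card A.ConnectedComponent + Nat.card B.ConnectedComponent ≤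
      Nat.card I.ConnectedComponent + Nat.card S.ConnectedComponent := by
  simp only [card_connectedComponent_eq_finrank]
  -- Functions locally constant for both `A` and `B` are locally constant for `S`, and sums of the
  -- two kinds are locally constant for `I`.
  rw [← Submodule.finrank_sup_add_finrank_inf_eq]
  refine add_le_add (Submodule.finrank_mono (sup_le (locallyConstant_anti hA)
    (locallyConstant_anti hB))) (Submodule.finrank_mono ?_)
  rintro g ⟨h1, h2⟩ x y hxy
  rcases hS hxy with h | h
  · exact h1 x y h
  · exact h2 x y h

/-- Vertices outside `T` are isolated in `B`, hence lie in different components. -/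
lemma card_le_card_connectedComponent_add [Finite W] (B : SimpleGraph W) (T : Set W)
    (hT : ∀ x y, B.Adj x y → x ∈ T) :
    Nat.card W ≤ Nat.card B.ConnectedComponent + T.ncard := by
  have hfin : Finite B.ConnectedComponent := Quot.finite _
  have hinj : Function.Injective (fun x : (Tᶜ : Set W) => B.connectedComponentMk x) := by
    rintro ⟨x, hx⟩ ⟨y, hy⟩ h
    obtain ⟨w⟩ := SimpleGraph.ConnectedComponent.exact h
    cases w with
    | nil => rfl
    | cons h _ => exact absurd (hT _ _ h) hx
  have h1 := Nat.card_le_card_of_injective _ hinj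
  have h2 := Set.ncard_add_ncard_compl T
  rw [Nat.card_coe_set_eq] at h1
  omega

/-- Adding edges that only touch `T` merges away at most `|T|` components: supermodularity with `I =
⊥` bounds the loss by `|W|` minus the number of components of `B`. -/
lemma card_connectedComponent_le_add [Finite W] {A B S : SimpleGraph W} (hS : S ≤ A ⊔ B)
    (T : Set W) (hT : ∀ x y, B.Adj x y → x ∈ T) :
    Nat.card A.ConnectedComponent ≤ Nat.card S.ConnectedComponent + T.ncard := by
  have h1 := card_connectedComponent_supermodular (I := ⊥) bot_le bot_le hS
  have h2 := card_le_card_connectedComponent_add B T hT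
  have h3 : Nat.card (⊥ : SimpleGraph W).ConnectedComponent ≤ Nat.card W :=
    Nat.card_le_card_of_surjective _ (Quot.mk_surjective (r := (⊥ : SimpleGraph W).Reachable))
  omega

end Components

variable {V : Type*} {G : SimpleGraph V}

/-! ### Cluster counts in finite volume. -/

section OpenGraph

lemma openGraph_mono {ω ω' : Config G} (h : ω ≤ ω') : openGraph G ω ≤ openGraph G ω' := by
  rintro x y ⟨hxy, ho⟩
  exact ⟨hxy, Bool.le_iff_imp.1 (h ⟨s(x, y), hxy⟩) ho⟩

lemma openGraph_sup (ω ω' : Config G) :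
    openGraph G (ω ⊔ ω') ≤ openGraph G ω ⊔ openGraph G ω' := by
  rintro x y ⟨hxy, ho⟩
  simp only [Pi.sup_apply, Bool.max_eq_or, Bool.or_eq_true] at ho
  exact ho.imp (fun h => ⟨hxy, h⟩) fun h => ⟨hxy, h⟩

lemma openGraph_le (ω : Config G) : openGraph G ω ≤ G := fun _ _ h => h.1

lemma extend_mono (E : Finset G.edgeSet) : Monotone (extend G E) := by
  intro η η' h e
  unfold extend
  split_ifs with he
  · exact h _
  · exact le_rfl

lemma extend_sup (E : Finset G.edgeSet) (η η' : E → Bool) :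
    extend G E (η ⊔ η') = extend G E η ⊔ extend G E η' := by
  ext e
  simp only [extend, Pi.sup_apply]
  split_ifs <;> simp

lemma extend_of_mem {E : Finset G.edgeSet} (η : E → Bool) {e : G.edgeSet} (h : e ∈ E) :
    extend G E η e = η ⟨e, h⟩ := by
  simp [extend, h]

lemma extend_of_notMem {E : Finset G.edgeSet} (η : E → Bool) {e : G.edgeSet} (h : e ∉ E) :
    extend G E η e = false := by
  simp [extend, h]

lemma finite_verts (E : Finset G.edgeSet) : (verts G E).Finite := by
  have : verts G E = ⋃ e ∈ E, {x | x ∈ (e : Sym2 V)} := by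
    ext; simp [verts]
  rw [this]
  refine Set.Finite.biUnion E.finite_toSet fun e _ => ?_
  induction e.1 with
  | _ a b =>
    refine (Set.toFinite {a, b}).subset fun x hx => ?_
    simpa using hx

instance (E : Finset G.edgeSet) : Finite (verts G E) := finite_verts E

lemma boundary_subset_verts (E : Finset G.edgeSet) : boundary G E ⊆ verts G E := fun _ h => h.1

instance (E : Finset G.edgeSet) : Finite (boundary G E) :=
  (finite_verts E).subset (boundary_subset_verts E)

lemma wiredGraph_mono {E : Finset G.edgeSet} {ξ ξ' : BoundaryCondition G E} (hξ : ξ ≤ ξ')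
    {η η' : E → Bool} (h : η ≤ η') : wiredGraph G E ξ η ≤ wiredGraph G E ξ' η' := by
  rintro ⟨x, hx⟩ ⟨y, hy⟩ hxy
  simp only [wiredGraph, SimpleGraph.comap_adj, Function.Embedding.subtype_apply,
    SimpleGraph.sup_adj, SimpleGraph.fromRel_adj] at hxy ⊢
  refine hxy.imp (fun h1 => openGraph_mono (extend_mono E h) h1) ?_
  rintro ⟨hne, h | h⟩
  · obtain ⟨h1, h2, h3⟩ := h
    exact ⟨hne, Or.inl ⟨h1, h2, hξ h3⟩⟩
  · obtain ⟨h1, h2, h3⟩ := h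
    exact ⟨hne, Or.inr ⟨h1, h2, hξ h3⟩⟩

lemma wiredGraph_sup_le {E : Finset G.edgeSet} {ξ ξ' : BoundaryCondition G E}
    (η η' : E → Bool) :
    wiredGraph G E ξ' (η ⊔ η') ≤ wiredGraph G E ξ η ⊔ wiredGraph G E ξ' η' := by
  rintro ⟨x, hx⟩ ⟨y, hy⟩ hxy
  simp only [wiredGraph, SimpleGraph.comap_adj, Function.Embedding.subtype_apply,
    SimpleGraph.sup_adj, extend_sup] at hxy ⊢
  rcases hxy with h | h
  · rcases openGraph_sup _ _ h with h | h
    · exact Or.inl (Or.inl h)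
    · exact Or.inr (Or.inl h)
  · exact Or.inr (Or.inr h)

/-- The number of clusters of `η^ξ`. -/
noncomputable def clusters (G : SimpleGraph V) (E : Finset G.edgeSet)
    (ξ : BoundaryCondition G E) (η : E → Bool) : ℕ :=
  Nat.card (wiredGraph G E ξ η).ConnectedComponent

lemma clusters_anti {E : Finset G.edgeSet} {ξ ξ' : BoundaryCondition G E} (hξ : ξ ≤ ξ')
    {η η' : E → Bool} (h : η ≤ η') : clusters G E ξ' η' ≤ clusters G E ξ η :=
  card_connectedComponent_anti (wiredGraph_mono hξ h)

/-- Two different boundary conditions are allowed, so that a single Holley argument gives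
monotonicity in the boundary condition as well as in `p`. -/
lemma clusters_supermodular {E : Finset G.edgeSet} {ξ ξ' : BoundaryCondition G E} (hξ : ξ ≤ ξ')
    (η η' : E → Bool) : clusters G E ξ η + clusters G E ξ' η' ≤
      clusters G E ξ (η ⊓ η') + clusters G E ξ' (η ⊔ η') :=
  card_connectedComponent_supermodular (wiredGraph_mono le_rfl inf_le_left)
    (wiredGraph_mono hξ inf_le_right) (wiredGraph_sup_le _ _)

/-- The links created by wiring only touch boundary vertices. This is the surface-order price of a
boundary condition. -/
lemma clusters_le_add_boundary (E : Finset G.edgeSet) (η : E → Bool) :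
    clusters G E ⊥ η ≤ clusters G E ⊤ η + (boundary G E).ncard := by
  have hT : ((↑) ⁻¹' boundary G E : Set (verts G E)).ncard ≤ (boundary G E).ncard := by
    rw [← Set.ncard_image_of_injective _ Subtype.val_injective]
    exact Set.ncard_le_ncard (Set.image_preimage_subset _ _) (Set.toFinite _)
  refine (card_connectedComponent_le_add
    (B := (wiredGraph G E ⊤ fun _ => false)) ?_ ((↑) ⁻¹' boundary G E) ?_).trans
    (Nat.add_le_add_left hT _)
  · have h := wiredGraph_sup_le (ξ := ⊥) (ξ' := ⊤) η (⊥ : E → Bool)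
    rwa [sup_bot_eq] at h
  · rintro ⟨x, hx⟩ ⟨y, hy⟩ hxy
    simp only [wiredGraph, SimpleGraph.comap_adj, Function.Embedding.subtype_apply,
      SimpleGraph.sup_adj, SimpleGraph.fromRel_adj] at hxy
    rcases hxy with ⟨h, ho⟩ | ⟨-, h⟩
    · simp [extend] at ho
    · rcases h with ⟨h1, h2, -⟩ | ⟨h1, h2, -⟩
      · exact h1
      · exact h2

/-- The edges of `F` have at most `2 |F|` end-points, and only these can be affected by opening `F`.
The bound is crude but uniform in the volume. -/
lemma clusters_le_add_two_mul {E : Finset G.edgeSet} (ξ : BoundaryCondition G E)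
    (F : Finset E) {η η' : E → Bool} (h : ∀ e ∉ F, η' e ≤ η e) :
    clusters G E ξ η ≤ clusters G E ξ η' + 2 * F.card := by
  classical
  set T : Set (verts G E) := {x | ∃ e ∈ F, (x : V) ∈ (e : Sym2 V)} with hT
  have hTc : T.ncard ≤ 2 * F.card := by
    have h1 : (((↑) : verts G E → V) '' T) ⊆
        ↑(F.biUnion fun e => (e : Sym2 V).toFinset) := by
      rintro _ ⟨x, ⟨e, he, hx⟩, rfl⟩
      simp only [Finset.coe_biUnion, Set.mem_iUnion]
      exact ⟨e, he, by simpa using hx⟩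
    rw [← Set.ncard_image_of_injective _ Subtype.val_injective]
    refine (Set.ncard_le_ncard h1 (Finset.finite_toSet _)).trans ?_
    rw [Set.ncard_coe_finset]
    refine Finset.card_biUnion_le.trans ((Finset.sum_le_card_nsmul _ _ 2 fun e _ => ?_).trans ?_)
    · by_cases hd : (e : Sym2 V).IsDiag
      · rw [Sym2.card_toFinset_of_isDiag _ hd]; norm_num
      · rw [Sym2.card_toFinset_of_not_isDiag _ hd]
    · simp [mul_comm]
  refine (card_connectedComponent_le_add
    (B := (openGraph G (extend G E fun e => decide (e ∈ F))).induce (verts G E)) ?_ T ?_).trans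
    (Nat.add_le_add_left hTc _)
  · rintro ⟨x, hx⟩ ⟨y, hy⟩ hxy
    simp only [wiredGraph, SimpleGraph.comap_adj, Function.Embedding.subtype_apply,
      SimpleGraph.sup_adj] at hxy ⊢
    rcases hxy with ⟨hG, ho⟩ | h'
    · by_cases he : (⟨s(x, y), hG⟩ : G.edgeSet) ∈ E
      · by_cases hF : (⟨_, he⟩ : E) ∈ F
        · exact Or.inr ⟨hG, by simp [extend_of_mem _ he, hF]⟩
        · refine Or.inl (Or.inl ⟨hG, ?_⟩)
          rw [extend_of_mem _ he] at ho ⊢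
          exact Bool.le_iff_imp.1 (h _ hF) ho
      · simp [extend_of_notMem _ he] at ho
    · exact Or.inl (Or.inr h')
  · rintro ⟨x, hx⟩ ⟨y, hy⟩ ⟨hG, ho⟩
    simp only [Function.Embedding.subtype_apply] at hG ho
    by_cases he : (⟨s(x, y), hG⟩ : G.edgeSet) ∈ E
    · rw [extend_of_mem _ he] at ho
      exact ⟨_, by simpa using ho, by simp⟩
    · simp [extend_of_notMem _ he] at ho

end OpenGraph

/-! ### Lattice condition for product weights, with slack. -/

section Bernoulli

variable {ι : Type*} [Fintype ι]

/-- The Bernoulli weight of a configuration. -/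
def bernoulli (p : ℝ) (η : ι → Bool) : ℝ := ∏ e, if η e = true then p else 1 - p

lemma bernoulli_eq_pow (p : ℝ) (η : ι → Bool) :
    bernoulli p η = p ^ Nat.card {e // η e = true} * (1 - p) ^ Nat.card {e // η e = false} := by
  classical
  unfold bernoulli
  rw [Finset.prod_ite, Finset.prod_const, Finset.prod_const, Nat.card_eq_fintype_card,
    Nat.card_eq_fintype_card, Fintype.card_subtype, Fintype.card_subtype]
  simp

lemma bernoulli_nonneg {p : ℝ} (h0 : 0 ≤ p) (h1 : p ≤ 1) (η : ι → Bool) : 0 ≤ bernoulli p η :=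
  Finset.prod_nonneg fun e _ => by split_ifs <;> linarith

lemma bernoulli_false (p : ℝ) : bernoulli p (fun _ : ι => false) = (1 - p) ^ Fintype.card ι := by
  simp [bernoulli]

lemma sum_bernoulli [DecidableEq ι] (p : ℝ) : ∑ η : ι → Bool, bernoulli p η = 1 := by
  have := (Finset.prod_univ_sum (fun _ : ι => (Finset.univ : Finset Bool))
    (fun _ b => if b = true then p else 1 - p))
  simp only [Fintype.piFinset_univ] at this
  unfold bernoulli
  rw [← this]
  simp

open Classical in
/-- The number of edges that are open in `η` and closed in `η'`. -/
noncomputable def openDiff (η η' : ι → Bool) : ℕ :=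
  (Finset.univ.filter fun e => η e = true ∧ η' e = false).card

/-- The inequality is checked edge by edge and is an equality unless the edge is open in `a` and
closed in `b`. There the hypothesis leaves room for a factor `s`, which will absorb an exponential
tilt. -/
lemma bernoulli_mul_bernoulli_le {p p' s : ℝ} (hp0 : 0 ≤ p) (hp1 : p ≤ 1) (hp'0 : 0 ≤ p')
    (hp'1 : p' ≤ 1) (hs : 0 ≤ s) (h : p * s * (1 - p') ≤ (1 - p) * p') (a b : ι → Bool) :
    bernoulli p a * bernoulli p' b * s ^ openDiff a b ≤
      bernoulli p (a ⊓ b) * bernoulli p' (a ⊔ b) := by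
  classical
  have hpow : s ^ openDiff a b = ∏ e, if a e = true ∧ b e = false then s else 1 := by
    rw [openDiff, Finset.prod_ite, Finset.prod_const, Finset.prod_const_one, mul_one]
  rw [hpow]
  unfold bernoulli
  rw [← Finset.prod_mul_distrib, ← Finset.prod_mul_distrib, ← Finset.prod_mul_distrib]
  refine Finset.prod_le_prod (fun e _ => ?_) fun e _ => ?_
  · have h1 : 0 ≤ 1 - p := by linarith
    have h2 : 0 ≤ 1 - p' := by linarith
    split_ifs <;> positivity
  · cases ha : a e <;> cases hb : b e <;> simp [ha, hb]
    all_goals nlinarith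

end Bernoulli

/-! ### Holley and Jensen inequalities for finite averages. -/

section Average

/-- Holley's inequality, applied after dividing the weights by their total masses. -/
lemma average_le_average {α : Type*} [DistribLattice α] [Fintype α] {w w' g : α → ℝ}
    (hw : 0 ≤ w) (hw' : 0 ≤ w') (hwpos : 0 < ∑ a, w a) (hwpos' : 0 < ∑ a, w' a) (hg0 : 0 ≤ g)
    (hg : Monotone g) (h : ∀ a b, w a * w' b ≤ w (a ⊓ b) * w' (a ⊔ b)) :
    (∑ a, w a * g a) / ∑ a, w a ≤ (∑ a, w' a * g a) / ∑ a, w' a := by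
  have key := holley (μ := g) (f := fun a => w a / ∑ a, w a) (g := fun a => w' a / ∑ a, w' a)
    hg0 (fun a => div_nonneg (hw a) hwpos.le) (fun a => div_nonneg (hw' a) hwpos'.le) hg
    (by rw [← Finset.sum_div, ← Finset.sum_div, div_self hwpos.ne', div_self hwpos'.ne'])
    (fun a b => by
      rw [div_mul_div_comm, div_mul_div_comm]
      exact div_le_div_of_nonneg_right (h a b) (mul_pos hwpos hwpos').le)
  calc _ = ∑ a, g a * (w a / ∑ a, w a) := by
        rw [Finset.sum_div]; exact Finset.sum_congr rfl fun a _ => by ring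
    _ ≤ _ := key
    _ = _ := by rw [Finset.sum_div]; exact Finset.sum_congr rfl fun a _ => by ring

/-- Jensen's inequality, by averaging the tangent line of the exponential at the mean. -/
lemma exp_average_le {α : Type*} [Fintype α] {w g : α → ℝ} (hw : 0 ≤ w) (hwpos : 0 < ∑ a, w a) :
    Real.exp ((∑ a, w a * g a) / ∑ a, w a) ≤ (∑ a, w a * Real.exp (g a)) / ∑ a, w a := by
  set m := (∑ a, w a * g a) / ∑ a, w a with hm
  rw [le_div_iff₀ hwpos]
  have h1 : ∀ a, w a * (Real.exp m * (1 + (g a - m))) ≤ w a * Real.exp (g a) := fun a => by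
    refine mul_le_mul_of_nonneg_left ?_ (hw a)
    calc Real.exp m * (1 + (g a - m)) ≤ Real.exp m * Real.exp (g a - m) :=
          mul_le_mul_of_nonneg_left (by linarith [Real.add_one_le_exp (g a - m)])
            (Real.exp_pos _).le
      _ = Real.exp (g a) := by rw [← Real.exp_add]; congr 1; ring
  refine le_trans (le_of_eq ?_) (Finset.sum_le_sum fun a _ => h1 a)
  have h2 : ∑ a, w a * g a = m * ∑ a, w a := by rw [hm, div_mul_cancel₀ _ hwpos.ne']
  calc Real.exp m * ∑ a, w a
      = Real.exp m * ((∑ a, w a) + ((∑ a, w a * g a) - m * ∑ a, w a)) := by rw [h2]; ring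
    _ = _ := by
        rw [Finset.mul_sum (Finset.univ) w m, ← Finset.sum_sub_distrib, ← Finset.sum_add_distrib,
          Finset.mul_sum]
        exact Finset.sum_congr rfl fun a _ => by ring

end Average

/-! ### Finite-volume random-cluster measures: domination and exponential moments. -/

section FiniteVolume

lemma weight_eq (p q : ℝ) (E : Finset G.edgeSet) (ξ : BoundaryCondition G E) (η : E → Bool) :
    weight G p q E ξ η = bernoulli p η * q ^ clusters G E ξ η := by
  rw [weight, bernoulli_eq_pow, clusters]

variable {p p' q : ℝ} {E : Finset G.edgeSet}

lemma weight_nonneg (hp0 : 0 ≤ p) (hp1 : p < 1) (hq : 1 ≤ q) (ξ : BoundaryCondition G E)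
    (η : E → Bool) : 0 ≤ weight G p q E ξ η := by
  rw [weight_eq]
  exact mul_nonneg (bernoulli_nonneg hp0 hp1.le _) (by positivity)

open Classical in
lemma sum_weight_pos (hp0 : 0 ≤ p) (hp1 : p < 1) (hq : 1 ≤ q) (ξ : BoundaryCondition G E) :
    0 < ∑ η : E → Bool, weight G p q E ξ η := by
  refine Finset.sum_pos' (fun η _ => weight_nonneg hp0 hp1 hq ξ η)
    ⟨fun _ => false, Finset.mem_univ _, ?_⟩
  rw [weight_eq, bernoulli_false]
  have : 0 < 1 - p := by linarith
  positivity

open Classical in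
/-- The expectation of `f` under the random-cluster measure on `E` with boundary condition `ξ`,
the edges outside `E` being closed. -/
noncomputable def ev (G : SimpleGraph V) (p q : ℝ) (E : Finset G.edgeSet)
    (ξ : BoundaryCondition G E) (f : Config G → ℝ) : ℝ :=
  (∑ η : E → Bool, weight G p q E ξ η * f (extend G E η)) / ∑ η : E → Bool, weight G p q E ξ η

open Classical in
lemma ev_eq_sum_prob (ξ : BoundaryCondition G E) (f : Config G → ℝ) :
    ev G p q E ξ f = ∑ η : E → Bool, prob G p q E ξ η * f (extend G E η) := by
  rw [ev, Finset.sum_div]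
  exact Finset.sum_congr rfl fun η _ => by rw [prob]; ring

lemma ev_mono (hp0 : 0 ≤ p) (hp1 : p < 1) (hq : 1 ≤ q) (ξ : BoundaryCondition G E)
    {f g : Config G → ℝ} (h : ∀ ω, f ω ≤ g ω) : ev G p q E ξ f ≤ ev G p q E ξ g := by
  classical
  exact div_le_div_of_nonneg_right (Finset.sum_le_sum fun η _ =>
    mul_le_mul_of_nonneg_left (h _) (weight_nonneg hp0 hp1 hq ξ η))
    (sum_weight_pos hp0 hp1 hq ξ).le

lemma ev_sum {κ : Type*} (s : Finset κ) (ξ : BoundaryCondition G E) (f : κ → Config G → ℝ) :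
    ev G p q E ξ (fun ω => ∑ i ∈ s, f i ω) = ∑ i ∈ s, ev G p q E ξ (f i) := by
  classical
  simp only [ev_eq_sum_prob, Finset.mul_sum]
  exact Finset.sum_comm

lemma ev_const_mul (c : ℝ) (ξ : BoundaryCondition G E) (f : Config G → ℝ) :
    ev G p q E ξ (fun ω => c * f ω) = c * ev G p q E ξ f := by
  classical
  simp only [ev_eq_sum_prob, Finset.mul_sum]
  exact Finset.sum_congr rfl fun η _ => by ring

/-- The slack comes from the Bernoulli part; the cluster part only contributes in the right
direction because `q ≥ 1` and the cluster count is supermodular. -/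
lemma weight_mul_weight_le (hp0 : 0 ≤ p) (hp1 : p < 1) (hp'0 : 0 ≤ p') (hp'1 : p' < 1)
    (hq : 1 ≤ q) {s : ℝ} (hs : 0 ≤ s) (h : p * s * (1 - p') ≤ (1 - p) * p')
    {ξ ξ' : BoundaryCondition G E} (hξ : ξ ≤ ξ') (a b : E → Bool) :
    weight G p q E ξ a * weight G p' q E ξ' b * s ^ openDiff a b ≤
      weight G p q E ξ (a ⊓ b) * weight G p' q E ξ' (a ⊔ b) := by
  simp only [weight_eq]
  have h1 := bernoulli_mul_bernoulli_le hp0 hp1.le hp'0 hp'1.le hs h a b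
  have h2 : q ^ (clusters G E ξ a + clusters G E ξ' b) ≤
      q ^ (clusters G E ξ (a ⊓ b) + clusters G E ξ' (a ⊔ b)) :=
    pow_le_pow_right₀ hq (clusters_supermodular hξ a b)
  have h3 := mul_le_mul h1 h2 (by positivity)
    (mul_nonneg (bernoulli_nonneg hp0 hp1.le _) (bernoulli_nonneg hp'0 hp'1.le _))
  rw [pow_add, pow_add] at h3
  linarith

/-- Monotonicity of the random-cluster expectation of an increasing function in `p` and in the
boundary condition. -/
theorem ev_le_ev (hp0 : 0 ≤ p) (hpp' : p ≤ p') (hp'1 : p' < 1) (hq : 1 ≤ q)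
    {ξ ξ' : BoundaryCondition G E} (hξ : ξ ≤ ξ') {f : Config G → ℝ} (hf0 : ∀ ω, 0 ≤ f ω)
    (hf : Monotone f) : ev G p q E ξ f ≤ ev G p' q E ξ' f := by
  classical
  have hp1 := hpp'.trans_lt hp'1
  refine average_le_average (fun η => weight_nonneg hp0 hp1 hq ξ η)
    (fun η => weight_nonneg (hp0.trans hpp') hp'1 hq ξ' η) (sum_weight_pos hp0 hp1 hq ξ)
    (sum_weight_pos (hp0.trans hpp') hp'1 hq ξ') (fun _ => hf0 _) (hf.comp (extend_mono E))
    fun a b => ?_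
  simpa using weight_mul_weight_le hp0 hp1 (hp0.trans hpp') hp'1 hq zero_le_one
    (by nlinarith) hξ a b

/-- The exponential moment of an increasing Lipschitz function at `p` is controlled by its mean
at a larger parameter `p'`. -/
theorem ev_exp_le (hp0 : 0 ≤ p) (hp1 : p < 1) (hp'0 : 0 ≤ p') (hp'1 : p' < 1) (hq : 1 ≤ q)
    (ξ : BoundaryCondition G E) {C δ : ℝ} (hδ0 : 0 ≤ δ)
    (hδ : p * Real.exp (δ * C) * (1 - p') ≤ (1 - p) * p') {f : Config G → ℝ}
    (hf0 : ∀ ω, 0 ≤ f ω) (hf : Monotone f)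
    (hLip : ∀ η η' : E → Bool, η' ≤ η →
      f (extend G E η) ≤ f (extend G E η') + C * openDiff η η') :
    ev G p q E ξ (fun ω => Real.exp (δ * f ω)) ≤ Real.exp (δ * ev G p' q E ξ f) := by
  classical
  set g : (E → Bool) → ℝ := fun η => f (extend G E η) with hg
  set w : (E → Bool) → ℝ := fun η => weight G p q E ξ η with hw
  -- The weight at `p`, tilted by `exp (δ f)`.
  set t : (E → Bool) → ℝ := fun η => w η * Real.exp (δ * g η) with ht
  have hw0 : 0 ≤ w := fun η => weight_nonneg hp0 hp1 hq ξ η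
  have hwpos : 0 < ∑ η, w η := sum_weight_pos hp0 hp1 hq ξ
  have ht0 : 0 ≤ t := fun η => mul_nonneg (hw0 η) (Real.exp_pos _).le
  have htpos : 0 < ∑ η, t η := hwpos.trans_le (Finset.sum_le_sum fun η _ =>
    le_mul_of_one_le_right (hw0 η) (Real.one_le_exp (mul_nonneg hδ0 (hf0 _))))
  -- The tilted measure is dominated by the one at `p'`: replacing `a` by `a ⊓ b` loses a factor of
  -- at most `exp (δ C)` per edge open in `a` and closed in `b`, which is exactly the available
  -- slack.
  have hcomp : (∑ η, t η * g η) / ∑ η, t η ≤ ev G p' q E ξ f := by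
    refine average_le_average ht0 (fun η => weight_nonneg hp'0 hp'1 hq ξ η) htpos
      (sum_weight_pos hp'0 hp'1 hq ξ) (fun _ => hf0 _) (hf.comp (extend_mono E)) fun a b => ?_
    have h1 := weight_mul_weight_le hp0 hp1 hp'0 hp'1 hq (Real.exp_pos (δ * C)).le hδ
      (le_refl ξ) a b
    have h2 : openDiff a (a ⊓ b) = openDiff a b := by
      unfold openDiff
      congr 1
      ext e
      cases ha : a e <;> cases hb : b e <;> simp [ha, hb]
    have h3 := hLip a (a ⊓ b) inf_le_left
    rw [h2] at h3
    have h4 : Real.exp (δ * g a) ≤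
        Real.exp (δ * g (a ⊓ b)) * Real.exp (δ * C) ^ openDiff a b := by
      rw [← Real.exp_nat_mul, ← Real.exp_add]
      refine Real.exp_le_exp.2 ?_
      have := mul_le_mul_of_nonneg_left h3 hδ0
      simp only [hg]
      linarith
    have h5 : 0 ≤ w a * weight G p' q E ξ b :=
      mul_nonneg (hw0 a) (weight_nonneg hp'0 hp'1 hq ξ b)
    calc t a * weight G p' q E ξ b = (w a * weight G p' q E ξ b) * Real.exp (δ * g a) := by
          simp only [ht]; ring
      _ ≤ (w a * weight G p' q E ξ b) *
          (Real.exp (δ * g (a ⊓ b)) * Real.exp (δ * C) ^ openDiff a b) :=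
          mul_le_mul_of_nonneg_left h4 h5
      _ = (w a * weight G p' q E ξ b * Real.exp (δ * C) ^ openDiff a b) *
          Real.exp (δ * g (a ⊓ b)) := by ring
      _ ≤ (w (a ⊓ b) * weight G p' q E ξ (a ⊔ b)) * Real.exp (δ * g (a ⊓ b)) :=
          mul_le_mul_of_nonneg_right h1 (Real.exp_pos _).le
      _ = _ := by simp only [ht]; ring
  -- Under the tilted measure the average of `exp (-δ g)` is the inverse of the exponential moment
  -- to be bounded, so a lower bound by Jensen is what is needed.
  have hJ := exp_average_le (g := fun η => -(δ * g η)) ht0 htpos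
  have hsum : ∑ η, t η * Real.exp (-(δ * g η)) = ∑ η, w η :=
    Finset.sum_congr rfl fun η _ => by
      simp only [ht]
      rw [mul_assoc, ← Real.exp_add, add_neg_cancel, Real.exp_zero, mul_one]
  rw [hsum] at hJ
  have hev : ev G p q E ξ (fun ω => Real.exp (δ * f ω)) = (∑ η, t η) / ∑ η, w η := rfl
  have hm : (∑ η, t η * -(δ * g η)) / ∑ η, t η = -(δ * ((∑ η, t η * g η) / ∑ η, t η)) := by
    rw [← mul_div_assoc, ← neg_div, Finset.mul_sum, ← Finset.sum_neg_distrib]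
    congr 1
    exact Finset.sum_congr rfl fun η _ => by ring
  rw [hm, Real.exp_neg, ← inv_div (∑ η, t η) (∑ η, w η), inv_le_inv₀ (Real.exp_pos _)
    (div_pos htpos hwpos)] at hJ
  rw [hev]
  exact hJ.trans (Real.exp_le_exp.2 (mul_le_mul_of_nonneg_left hcomp hδ0))

lemma exp_ev_le (hp0 : 0 ≤ p) (hp1 : p < 1) (hq : 1 ≤ q) (ξ : BoundaryCondition G E)
    (f : Config G → ℝ) :
    Real.exp (ev G p q E ξ f) ≤ ev G p q E ξ (fun ω => Real.exp (f ω)) := by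
  classical
  exact exp_average_le (fun η => weight_nonneg hp0 hp1 hq ξ η) (sum_weight_pos hp0 hp1 hq ξ)

/-- Wired weights are at most the free ones, and free ones are at most `q ^ |∂E|` times the wired
ones. The first comparison is used in the numerator, the second in the partition function. -/
lemma ev_top_le_mul_ev_bot (hp0 : 0 ≤ p) (hp1 : p < 1) (hq : 1 ≤ q) {f : Config G → ℝ}
    (hf : ∀ ω, 0 ≤ f ω) :
    ev G p q E ⊤ f ≤ q ^ (boundary G E).ncard * ev G p q E ⊥ f := by
  classical
  have h1 : ∀ η, weight G p q E ⊤ η ≤ weight G p q E ⊥ η := fun η => by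
    simp only [weight_eq]
    exact mul_le_mul_of_nonneg_left (pow_le_pow_right₀ hq (clusters_anti bot_le le_rfl))
      (bernoulli_nonneg hp0 hp1.le _)
  have h2 : ∀ η, weight G p q E ⊥ η ≤ q ^ (boundary G E).ncard * weight G p q E ⊤ η := fun η => by
    simp only [weight_eq]
    calc bernoulli p η * q ^ clusters G E ⊥ η
        ≤ bernoulli p η * q ^ (clusters G E ⊤ η + (boundary G E).ncard) :=
          mul_le_mul_of_nonneg_left (pow_le_pow_right₀ hq (clusters_le_add_boundary E η))
            (bernoulli_nonneg hp0 hp1.le _)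
      _ = _ := by rw [pow_add]; ring
  unfold ev
  rw [div_le_iff₀ (sum_weight_pos hp0 hp1 hq ⊤)]
  have hZ : ∑ η, weight G p q E ⊥ η ≤ q ^ (boundary G E).ncard * ∑ η, weight G p q E ⊤ η := by
    rw [Finset.mul_sum]
    exact Finset.sum_le_sum fun η _ => h2 η
  have hN : ∑ η, weight G p q E ⊤ η * f (extend G E η) ≤
      ∑ η, weight G p q E ⊥ η * f (extend G E η) :=
    Finset.sum_le_sum fun η _ => mul_le_mul_of_nonneg_right (h1 η) (hf _)
  have hpos := sum_weight_pos (E := E) hp0 hp1 hq ⊥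
  have hN0 : 0 ≤ ∑ η, weight G p q E ⊥ η * f (extend G E η) :=
    Finset.sum_nonneg fun η _ => mul_nonneg (weight_nonneg hp0 hp1 hq ⊥ η) (hf _)
  refine hN.trans ?_
  rw [mul_right_comm, ← mul_div_assoc, le_div_iff₀ hpos, mul_comm _ (∑ η, weight G p q E ⊥ η)]
  exact mul_le_mul_of_nonneg_right hZ hN0

/-- The closed configuration has the most clusters, so the partition function is at most its cluster
factor times the total Bernoulli mass, which is 1. -/
lemma le_prob_false (hp0 : 0 ≤ p) (hp1 : p < 1) (hq : 1 ≤ q) (ξ : BoundaryCondition G E) :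
    (1 - p) ^ E.card ≤ prob G p q E ξ (fun _ => false) := by
  classical
  rw [prob, le_div_iff₀ (sum_weight_pos hp0 hp1 hq ξ), weight_eq, bernoulli_false,
    Fintype.card_coe]
  refine mul_le_mul_of_nonneg_left ?_ (pow_nonneg (by linarith) _)
  calc ∑ η : E → Bool, weight G p q E ξ η
      ≤ ∑ η : E → Bool, bernoulli p η * q ^ clusters G E ξ (fun _ => false) :=
        Finset.sum_le_sum fun η _ => by
          rw [weight_eq]
          exact mul_le_mul_of_nonneg_left (pow_le_pow_right₀ hq
            (clusters_anti le_rfl fun e => Bool.false_le _)) (bernoulli_nonneg hp0 hp1.le _)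
    _ = q ^ clusters G E ξ (fun _ => false) := by
        rw [← Finset.sum_mul, sum_bernoulli, one_mul]

end FiniteVolume

/-! ### Finite energy. -/

section FiniteEnergy

variable {p q : ℝ} {E : Finset G.edgeSet}

/-- The indicator function of an event. -/
noncomputable abbrev ind (A : Set (Config G)) : Config G → ℝ := A.indicator fun _ => 1

lemma ind_nonneg (A : Set (Config G)) (ω : Config G) : 0 ≤ ind A ω :=
  Set.indicator_nonneg (fun _ _ => zero_le_one) ω

lemma ind_le_one (A : Set (Config G)) (ω : Config G) : ind A ω ≤ 1 :=
  Set.indicator_le_self' (fun _ _ => zero_le_one) ω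

lemma ind_mono {A : Set (Config G)} (hA : IsUpperSet A) : Monotone (ind A) := by
  intro ω ω' h
  by_cases h1 : ω ∈ A
  · rw [ind, Set.indicator_of_mem h1, Set.indicator_of_mem (hA h h1)]
  · rw [ind, Set.indicator_of_notMem h1]
    exact ind_nonneg A ω'

open Classical in
/-- The configuration obtained by opening the edges of `F`. -/
noncomputable def openOn (F : Finset E) (η : E → Bool) : E → Bool :=
  fun e => if e ∈ F then true else η e

/-- Each opened edge costs at most `1 / p` in the Bernoulli weight and `q ^ 2` in the cluster
weight. -/
lemma weight_le_weight_openOn (hp0 : 0 < p) (hp1 : p < 1) (hq : 1 ≤ q)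
    (ξ : BoundaryCondition G E) {F : Finset E} {D : ℕ} (hD : F.card ≤ D) (η : E → Bool) :
    weight G p q E ξ η ≤ (q ^ 2 / p) ^ D * weight G p q E ξ (openOn F η) := by
  classical
  have hb : bernoulli p η ≤ (1 / p) ^ F.card * bernoulli p (openOn F η) := by
    have : (1 / p) ^ F.card = ∏ e : E, if e ∈ F then 1 / p else 1 := by
      rw [Finset.prod_ite, Finset.prod_const, Finset.prod_const_one, mul_one,
        Finset.filter_mem_eq_inter, Finset.univ_inter]
    rw [this]
    unfold bernoulli
    rw [← Finset.prod_mul_distrib]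
    refine Finset.prod_le_prod (fun e _ => by split_ifs <;> linarith) fun e _ => ?_
    by_cases he : e ∈ F
    · simp only [openOn, he, if_true]
      rw [one_div_mul_cancel hp0.ne']
      split_ifs <;> linarith
    · simp [openOn, he]
  have hk := clusters_le_add_two_mul ξ F (η := η) (η' := openOn F η)
    (fun e he => by simp [openOn, he])
  rw [weight_eq, weight_eq]
  have hq0 : 0 < q := by linarith
  have h1 : 1 ≤ q ^ 2 / p := by
    rw [le_div_iff₀ hp0, one_mul]
    exact hp1.le.trans (one_le_pow₀ hq)
  have hbn := bernoulli_nonneg hp0.le hp1.le (openOn F η)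
  calc bernoulli p η * q ^ clusters G E ξ η
      ≤ ((1 / p) ^ F.card * bernoulli p (openOn F η)) *
        q ^ (clusters G E ξ (openOn F η) + 2 * F.card) :=
        mul_le_mul hb (pow_le_pow_right₀ hq hk) (by positivity) (by positivity)
    _ = (q ^ 2 / p) ^ F.card * (bernoulli p (openOn F η) * q ^ clusters G E ξ (openOn F η)) := by
        rw [pow_add, div_pow, div_pow, one_pow, pow_mul]; ring
    _ ≤ _ := mul_le_mul_of_nonneg_right (pow_le_pow_right₀ h1 hD) (by positivity)

/-- Finite energy: an event which can be turned into another by opening a bounded number of edges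
has comparable probability, provided that the set of edges can be read off the result. -/
theorem ev_ind_le_of_openOn (hp0 : 0 < p) (hp1 : p < 1) (hq : 1 ≤ q) (ξ : BoundaryCondition G E)
    {U A : Set (Config G)} (D : ℕ) (F : (E → Bool) → Finset E)
    (hD : ∀ η, extend G E η ∈ U → (F η).card ≤ D)
    (hA : ∀ η, extend G E η ∈ U → extend G E (openOn (F η) η) ∈ A)
    (hF : ∀ η, extend G E η ∈ U → F (openOn (F η) η) = F η) :
    ev G p q E ξ (ind U) ≤ (2 * (q ^ 2 / p)) ^ D * ev G p q E ξ (ind A) := by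
  classical
  have hq0 : 0 < q := by linarith
  unfold ev
  rw [← mul_div_assoc]
  refine div_le_div_of_nonneg_right ?_ (sum_weight_pos hp0.le hp1 hq ξ).le
  have hsum : ∀ B : Set (Config G), ∑ η : E → Bool, weight G p q E ξ η * ind B (extend G E η) =
      ∑ η ∈ Finset.univ.filter (fun η : E → Bool => extend G E η ∈ B), weight G p q E ξ η := by
    intro B
    rw [Finset.sum_filter]
    refine Finset.sum_congr rfl fun η _ => ?_
    by_cases h : extend G E η ∈ B <;> simp [ind, h]
  rw [hsum, hsum]
  set S := Finset.univ.filter (fun η : E → Bool => extend G E η ∈ U)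
  set T := Finset.univ.filter (fun η : E → Bool => extend G E η ∈ A)
  have hmaps : ∀ η ∈ S, openOn (F η) η ∈ T := fun η hη => by
    simp only [S, T, Finset.mem_filter, Finset.mem_univ, true_and] at hη ⊢
    exact hA η hη
  calc ∑ η ∈ S, weight G p q E ξ η
      ≤ ∑ η ∈ S, (q ^ 2 / p) ^ D * weight G p q E ξ (openOn (F η) η) :=
        Finset.sum_le_sum fun η hη =>
          weight_le_weight_openOn hp0 hp1 hq ξ (hD η (Finset.mem_filter.1 hη).2) η
    _ = ∑ ζ ∈ T, ∑ η ∈ S with openOn (F η) η = ζ,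
          (q ^ 2 / p) ^ D * weight G p q E ξ (openOn (F η) η) :=
        (Finset.sum_fiberwise_of_maps_to hmaps _).symm
    _ ≤ ∑ ζ ∈ T, (2 * (q ^ 2 / p)) ^ D * weight G p q E ξ ζ := by
        refine Finset.sum_le_sum fun ζ _ => ?_
        have h1 : ∑ η ∈ S with openOn (F η) η = ζ,
            (q ^ 2 / p) ^ D * weight G p q E ξ (openOn (F η) η) =
            (S.filter fun η => openOn (F η) η = ζ).card * ((q ^ 2 / p) ^ D * weight G p q E ξ ζ) := by
          rw [← nsmul_eq_mul, ← Finset.sum_const]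
          refine Finset.sum_congr rfl fun η hη => ?_
          rw [(Finset.mem_filter.1 hη).2]
        -- Multiplicity of the map: `F` takes the same value on the whole fibre of `ζ`, so a
        -- preimage is determined by its states on that set of at most `D` edges.
        have h2 : (S.filter fun η => openOn (F η) η = ζ).card ≤ 2 ^ D := by
          rcases (S.filter fun η => openOn (F η) η = ζ).eq_empty_or_nonempty with h0 | ⟨η₀, hη₀⟩
          · simp [h0]
          have hFζ : ∀ η ∈ S.filter fun η => openOn (F η) η = ζ, F η = F ζ := fun η hη => by
            obtain ⟨hS, hζ⟩ := Finset.mem_filter.1 hη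
            rw [← hF η (Finset.mem_filter.1 hS).2, hζ]
          have hcard : (F ζ).card ≤ D := by
            rw [← hFζ η₀ hη₀]
            exact hD _ (Finset.mem_filter.1 (Finset.mem_filter.1 hη₀).1).2
          refine le_trans ?_ (Nat.pow_le_pow_right two_pos hcard)
          rw [← Finset.card_powerset]
          refine Finset.card_le_card_of_injOn (fun η => (F ζ).filter fun e => η e = true)
            (fun η _ =>
              Finset.mem_coe.2 (Finset.mem_powerset.2 (Finset.filter_subset _ _))) ?_
          intro η hη η' hη' heq
          have hη := Finset.mem_coe.1 hη
          have hη' := Finset.mem_coe.1 hη'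
          have e1 : openOn (F ζ) η = ζ := hFζ η hη ▸ (Finset.mem_filter.1 hη).2
          have e2 : openOn (F ζ) η' = ζ := hFζ η' hη' ▸ (Finset.mem_filter.1 hη').2
          funext e
          by_cases he : e ∈ F ζ
          · have := congrArg (fun s => e ∈ s) heq
            simp only [Finset.mem_filter, he, true_and, eq_iff_iff] at this
            exact Bool.eq_iff_iff.2 this
          · have := congrFun (e1.trans e2.symm) e
            simpa [openOn, he] using this
        rw [h1, mul_pow, mul_assoc]
        refine mul_le_mul_of_nonneg_right (by exact_mod_cast h2) ?_
        have := weight_nonneg hp0.le hp1 hq ξ ζ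
        positivity
    _ = _ := by rw [Finset.mul_sum]

end FiniteEnergy

/-! ### Measurability of connection events. -/

section Measurability

/-- A connection uses finitely many edges, so the connection event is a countable union of
cylinders. -/
lemma reachable_iff_exists_finset (ω : Config G) (x y : V) :
    (openGraph G ω).Reachable x y ↔ ∃ S : Finset G.edgeSet, (∀ e ∈ S, ω e = true) ∧
      (openGraph G (extend G S fun _ => true)).Reachable x y := by
  classical
  constructor
  · rintro ⟨w⟩
    induction w with
    | nil => exact ⟨∅, by simp, SimpleGraph.Reachable.refl _⟩
    | @cons a b c h w ih =>
      obtain ⟨S, hS, hr⟩ := ih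
      obtain ⟨hG, ho⟩ := h
      refine ⟨insert ⟨s(a, b), hG⟩ S, by simpa [ho] using hS, ?_⟩
      have h1 : (openGraph G (extend G (insert ⟨s(a, b), hG⟩ S) fun _ => true)).Adj a b :=
        ⟨hG, by simp [extend]⟩
      refine h1.reachable.trans (hr.mono (openGraph_mono fun e => ?_))
      by_cases he : e ∈ S <;> simp [extend, he]
  · rintro ⟨S, hS, hr⟩
    refine hr.mono (openGraph_mono fun e => ?_)
    by_cases he : e ∈ S
    · simp [extend, he, hS e he]
    · simp [extend, he]

lemma measurableSet_reachable [Countable V] (x y : V) :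
    MeasurableSet {ω : Config G | (openGraph G ω).Reachable x y} := by
  have : Countable (Sym2 V) := Quot.mk_surjective.countable
  have hU : {ω : Config G | (openGraph G ω).Reachable x y} = ⋃ S : Finset G.edgeSet,
      {ω : Config G | ∀ e ∈ S, ω e = true} ∩
        {_ω | (openGraph G (extend G S fun _ => true)).Reachable x y} := by
    ext ω
    simp only [Set.mem_iUnion]
    exact reachable_iff_exists_finset ω x y
  rw [hU]
  refine MeasurableSet.iUnion fun S => MeasurableSet.inter ?_ (MeasurableSet.const _)
  have : {ω : Config G | ∀ e ∈ S, ω e = true} = ⋂ e ∈ S, (fun ω => ω e) ⁻¹' {true} := by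
    ext; simp
  rw [this]
  exact S.measurableSet_biInter fun e _ => measurable_pi_apply e (measurableSet_singleton _)

lemma measurable_closeOn (E : Finset G.edgeSet) : Measurable (closeOn G E) := by
  refine measurable_pi_lambda _ fun e => ?_
  unfold closeOn
  split_ifs
  · exact measurable_const
  · exact measurable_pi_apply e

lemma measurableSet_inducedBC [Countable V] (E : Finset G.edgeSet) (ξ : BoundaryCondition G E) :
    MeasurableSet {ω | inducedBC G E ω = ξ} := by
  have : {ω | inducedBC G E ω = ξ} = ⋂ (x : boundary G E) (y : boundary G E),
      {ω | (openGraph G (closeOn G E ω)).Reachable x y ↔ ξ x y} := by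
    ext ω
    simp only [Set.mem_ofPred_eq, Set.mem_iInter]
    constructor
    · rintro rfl x y
      rfl
    · intro h
      exact Setoid.ext fun x y => h x y
  rw [this]
  refine MeasurableSet.iInter fun x => MeasurableSet.iInter fun y => ?_
  have h1 : MeasurableSet {ω | (openGraph G (closeOn G E ω)).Reachable x y} :=
    measurable_closeOn E (measurableSet_reachable (x : V) y)
  by_cases h : ξ x y
  · convert h1 using 1
    ext ω
    simp [h]
  · convert h1.compl using 1
    ext ω
    simp [h]

end Measurability

/-! ### Infinite-volume measures as mixtures of finite-volume ones. -/

section DLR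

/-- The event `A` depends only on the edges in `S`. -/
def DeterminedBy (A : Set (Config G)) (S : Set G.edgeSet) : Prop :=
  ∀ ω ω' : Config G, (∀ e ∈ S, ω e = ω' e) → ω ∈ A → ω' ∈ A

lemma DeterminedBy.mem_iff {A : Set (Config G)} {S : Set G.edgeSet} (h : DeterminedBy A S)
    {ω ω' : Config G} (hω : ∀ e ∈ S, ω e = ω' e) : ω ∈ A ↔ ω' ∈ A :=
  ⟨h ω ω' hω, h ω' ω fun e he => (hω e he).symm⟩

lemma DeterminedBy.mono {A : Set (Config G)} {S T : Set G.edgeSet} (h : DeterminedBy A S)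
    (hST : S ⊆ T) : DeterminedBy A T :=
  fun ω ω' hω => h ω ω' fun e he => hω e (hST he)

lemma determinedBy_extend_preimage (E : Finset G.edgeSet) (A : Set (Config G)) :
    DeterminedBy {ω | extend G E (E.restrict ω) ∈ A} (E : Set G.edgeSet) := by
  intro ω ω' h
  have : E.restrict ω = E.restrict ω' := by
    funext e
    exact h e e.2
  simp [this]

lemma extend_restrict_le (E : Finset G.edgeSet) (ω : Config G) :
    extend G E (E.restrict ω) ≤ ω := by
  intro e
  by_cases he : e ∈ E <;> simp [extend, he]

instance (E : Finset G.edgeSet) : Finite (BoundaryCondition G E) :=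
  Finite.of_injective (fun ξ : BoundaryCondition G E => fun x y => ξ x y) fun _ _ h =>
    Setoid.ext fun x y => iff_of_eq (congrFun (congrFun h x) y)

variable {p q : ℝ} {φ : Measure (Config G)} {E : Finset G.edgeSet}

lemma measurableSet_restrict_eq (E : Finset G.edgeSet) (η : E → Bool) :
    MeasurableSet {ω : Config G | E.restrict ω = η} :=
  (Finset.measurable_restrict (X := fun _ : G.edgeSet => Bool) E) (measurableSet_singleton η)

/-- In product form the conditional identity also covers boundary conditions of probability zero, so
sums over all partitions need no exceptions. -/
lemma IsInfiniteVolume.measureReal_inter [Countable V] (hφ : IsInfiniteVolume G p q φ)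
    (hp0 : 0 ≤ p) (hp1 : p < 1) (hq : 1 ≤ q)
    (ξ : BoundaryCondition G E) (η : E → Bool) :
    φ.real ({ω | inducedBC G E ω = ξ} ∩ {ω | E.restrict ω = η}) =
      φ.real {ω | inducedBC G E ω = ξ} * prob G p q E ξ η := by
  have := hφ.isProbabilityMeasure
  by_cases h0 : φ {ω | inducedBC G E ω = ξ} = 0
  · have h1 : φ ({ω | inducedBC G E ω = ξ} ∩ {ω | E.restrict ω = η}) = 0 :=
      measure_mono_null Set.inter_subset_left h0
    simp [measureReal_def, h0, h1]
  have h := hφ.cond_eq E ξ h0 η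
  rw [cond_apply (measurableSet_inducedBC E ξ)] at h
  have hprob : 0 ≤ prob G p q E ξ η :=
    div_nonneg (weight_nonneg hp0 hp1 hq ξ η) (sum_weight_pos hp0 hp1 hq ξ).le
  have h2 : φ ({ω | inducedBC G E ω = ξ} ∩ {ω | E.restrict ω = η}) =
      φ {ω | inducedBC G E ω = ξ} * ENNReal.ofReal (prob G p q E ξ η) := by
    rw [← h, ← mul_assoc, ENNReal.mul_inv_cancel h0 (measure_ne_top _ _), one_mul]
  rw [measureReal_def, h2, ENNReal.toReal_mul, ENNReal.toReal_ofReal hprob, measureReal_def]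

open Classical in
/-- An infinite-volume measure is a mixture of finite-volume measures on `E`. -/
theorem IsInfiniteVolume.measureReal_eq_sum [Countable V] [Fintype (BoundaryCondition G E)]
    (hφ : IsInfiniteVolume G p q φ)
    (hp0 : 0 ≤ p) (hp1 : p < 1) (hq : 1 ≤ q) {A : Set (Config G)}
    (hA : DeterminedBy A (E : Set G.edgeSet)) :
    φ.real A = ∑ ξ : BoundaryCondition G E,
      φ.real {ω | inducedBC G E ω = ξ} * ev G p q E ξ (ind A) := by
  have := hφ.isProbabilityMeasure
  have hAe : ∀ ω, ω ∈ A ↔ extend G E (E.restrict ω) ∈ A := fun ω =>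
    hA.mem_iff fun e he => by simp [extend_of_mem _ (Finset.mem_coe.1 he)]
  set T := (Finset.univ ×ˢ Finset.univ.filter fun η : E → Bool => extend G E η ∈ A :
    Finset (BoundaryCondition G E × (E → Bool))) with hT
  have hAU : A = ⋃ t ∈ T, ({ω | inducedBC G E ω = t.1} ∩ {ω | E.restrict ω = t.2}) := by
    ext ω
    simp [hT, hAe ω]
  have hU : φ.real A = ∑ t ∈ T,
      φ.real ({ω | inducedBC G E ω = t.1} ∩ {ω | E.restrict ω = t.2}) := by
    conv_lhs => rw [hAU]
    refine measureReal_biUnion_finset ?_ fun t _ =>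
      (measurableSet_inducedBC E t.1).inter (measurableSet_restrict_eq E t.2)
    rintro ⟨ξ, η⟩ - ⟨ξ', η'⟩ - hne
    refine Set.disjoint_left.2 ?_
    rintro ω ⟨h1, h2⟩ ⟨h3, h4⟩
    exact hne (Prod.ext (h1.symm.trans h3) (h2.symm.trans h4))
  rw [hU, hT, Finset.sum_product]
  refine Finset.sum_congr rfl fun ξ _ => ?_
  rw [ev_eq_sum_prob, Finset.mul_sum, Finset.sum_filter]
  refine Finset.sum_congr rfl fun η _ => ?_
  rw [hφ.measureReal_inter hp0 hp1 hq]
  by_cases h : extend G E η ∈ A <;> simp [ind, h]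

lemma IsInfiniteVolume.sum_measureReal_inducedBC [Countable V] [Fintype (BoundaryCondition G E)]
    (hφ : IsInfiniteVolume G p q φ) :
    ∑ ξ : BoundaryCondition G E, φ.real {ω | inducedBC G E ω = ξ} = 1 := by
  have := hφ.isProbabilityMeasure
  rw [← measureReal_biUnion_finset (fun ξ _ ξ' _ h => Set.disjoint_left.2 fun ω h1 h2 =>
    h (h1.symm.trans h2)) fun ξ _ => measurableSet_inducedBC E ξ]
  have : (⋃ ξ ∈ (Finset.univ : Finset (BoundaryCondition G E)),
      {ω | inducedBC G E ω = ξ}) = Set.univ := by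
    ext; simp
  rw [this, probReal_univ]

lemma IsInfiniteVolume.measureReal_le [Countable V] (hφ : IsInfiniteVolume G p q φ)
    (hp0 : 0 ≤ p) (hp1 : p < 1) (hq : 1 ≤ q) {A : Set (Config G)}
    (hA : DeterminedBy A (E : Set G.edgeSet)) {b : ℝ}
    (hb : ∀ ξ, ev G p q E ξ (ind A) ≤ b) : φ.real A ≤ b := by
  have := Fintype.ofFinite (BoundaryCondition G E)
  rw [hφ.measureReal_eq_sum hp0 hp1 hq hA]
  calc _ ≤ ∑ ξ : BoundaryCondition G E, φ.real {ω | inducedBC G E ω = ξ} * b :=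
        Finset.sum_le_sum fun ξ _ => mul_le_mul_of_nonneg_left (hb ξ) measureReal_nonneg
    _ = b := by rw [← Finset.sum_mul, hφ.sum_measureReal_inducedBC, one_mul]

lemma IsInfiniteVolume.le_measureReal [Countable V] (hφ : IsInfiniteVolume G p q φ)
    (hp0 : 0 ≤ p) (hp1 : p < 1) (hq : 1 ≤ q) {A : Set (Config G)}
    (hA : DeterminedBy A (E : Set G.edgeSet)) {b : ℝ}
    (hb : ∀ ξ, b ≤ ev G p q E ξ (ind A)) : b ≤ φ.real A := by
  have := Fintype.ofFinite (BoundaryCondition G E)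
  rw [hφ.measureReal_eq_sum hp0 hp1 hq hA]
  calc b = ∑ ξ : BoundaryCondition G E, φ.real {ω | inducedBC G E ω = ξ} * b := by
        rw [← Finset.sum_mul, hφ.sum_measureReal_inducedBC, one_mul]
    _ ≤ _ := Finset.sum_le_sum fun ξ _ => mul_le_mul_of_nonneg_left (hb ξ) measureReal_nonneg

lemma IsInfiniteVolume.measureReal_le_mul [Countable V] (hφ : IsInfiniteVolume G p q φ)
    (hp0 : 0 ≤ p) (hp1 : p < 1) (hq : 1 ≤ q) {A : Set (Config G)}
    {U : Set (Config G)}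
    (hU : DeterminedBy U (E : Set G.edgeSet)) (hA : DeterminedBy A (E : Set G.edgeSet)) {C : ℝ}
    (hC : ∀ ξ, ev G p q E ξ (ind U) ≤ C * ev G p q E ξ (ind A)) : φ.real U ≤ C * φ.real A := by
  have := Fintype.ofFinite (BoundaryCondition G E)
  rw [hφ.measureReal_eq_sum hp0 hp1 hq hU, hφ.measureReal_eq_sum hp0 hp1 hq hA, Finset.mul_sum]
  refine Finset.sum_le_sum fun ξ _ => ?_
  have := mul_le_mul_of_nonneg_left (hC ξ)
    (measureReal_nonneg (μ := φ) (s := {ω | inducedBC G E ω = ξ}))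
  linarith

/-- Infinite-volume measures are dominated by wired measures. -/
theorem IsInfiniteVolume.measureReal_le_ev_top [Countable V] (hφ : IsInfiniteVolume G p q φ)
    (hp0 : 0 ≤ p) (hp1 : p < 1) (hq : 1 ≤ q) {A : Set (Config G)}
    (hAu : IsUpperSet A)
    (hA : DeterminedBy A (E : Set G.edgeSet)) : φ.real A ≤ ev G p q E ⊤ (ind A) :=
  hφ.measureReal_le hp0 hp1 hq hA fun _ =>
    ev_le_ev hp0 le_rfl hp1 hq le_top (ind_nonneg A) (ind_mono hAu)

/-- Infinite-volume measures dominate free measures. -/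
theorem IsInfiniteVolume.ev_bot_le_measureReal [Countable V] (hφ : IsInfiniteVolume G p q φ)
    (hp0 : 0 ≤ p) (hp1 : p < 1) (hq : 1 ≤ q) {A : Set (Config G)}
    (hAu : IsUpperSet A) :
    ev G p q E ⊥ (ind A) ≤ φ.real A := by
  have := hφ.isProbabilityMeasure
  -- Closing the edges outside `E` turns `A` into an event determined by `E`; it is contained in `A`
  -- because `A` is increasing, and has the same `ev`.
  set A' : Set (Config G) := {ω | extend G E (E.restrict ω) ∈ A} with hA'
  have h1 : ev G p q E ⊥ (ind A) = ev G p q E ⊥ (ind A') := by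
    classical
    unfold ev
    congr 1
    refine Finset.sum_congr rfl fun η _ => ?_
    have : E.restrict (extend G E η) = η := by
      funext e
      exact extend_of_mem η e.2
    by_cases h : extend G E η ∈ A <;> simp [ind, hA', Set.indicator, this, h]
  have hup : IsUpperSet A' := fun ω ω' h hω =>
    hAu (extend_mono E fun e => h e) hω
  rw [h1]
  refine (hφ.le_measureReal hp0 hp1 hq (determinedBy_extend_preimage E A) fun ξ =>
    ev_le_ev hp0 le_rfl hp1 hq bot_le (ind_nonneg A') (ind_mono hup)).trans ?_
  exact measureReal_mono fun ω hω => hAu (extend_restrict_le E ω) hω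

end DLR

/-! ### Covariance under graph automorphisms. -/

section Automorphism

/-- The action of an automorphism on configurations. -/
def pull (σ : G ≃g G) (ω : Config G) : Config G := fun e => ω (σ.mapEdgeSet e)

lemma pull_mono (σ : G ≃g G) : Monotone (pull σ) := fun _ _ h _ => h _

lemma openGraph_pull_adj (σ : G ≃g G) (ω : Config G) (x y : V) :
    (openGraph G (pull σ ω)).Adj x y ↔ (openGraph G ω).Adj (σ x) (σ y) := by
  constructor
  · rintro ⟨h, ho⟩
    exact ⟨σ.map_adj_iff.2 h, ho⟩
  · rintro ⟨h, ho⟩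
    exact ⟨σ.map_adj_iff.1 h, ho⟩

lemma mem_mapEdgeSet_iff (σ : G ≃g G) (x : V) (e : G.edgeSet) :
    σ x ∈ (σ.mapEdgeSet e : Sym2 V) ↔ x ∈ (e : Sym2 V) := by
  have : (σ.mapEdgeSet e : Sym2 V) = Sym2.map σ (e : Sym2 V) := rfl
  rw [this, Sym2.mem_map]
  constructor
  · rintro ⟨y, hy, h⟩
    rwa [← σ.injective h]
  · intro h
    exact ⟨x, h, rfl⟩

/-- The image of a finite set of edges under an automorphism. -/
def mapEdges (σ : G ≃g G) (E : Finset G.edgeSet) : Finset G.edgeSet :=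
  E.map σ.mapEdgeSet.toEmbedding

lemma mapEdgeSet_mem_mapEdges (σ : G ≃g G) (E : Finset G.edgeSet) (e : G.edgeSet) :
    σ.mapEdgeSet e ∈ mapEdges σ E ↔ e ∈ E :=
  Finset.mem_map_equiv.trans (by rw [Equiv.symm_apply_apply])

lemma mem_verts_mapEdges (σ : G ≃g G) (E : Finset G.edgeSet) (x : V) :
    σ x ∈ verts G (mapEdges σ E) ↔ x ∈ verts G E := by
  constructor
  · rintro ⟨e, he, hx⟩
    obtain ⟨e, rfl⟩ := σ.mapEdgeSet.surjective e
    exact ⟨e, (mapEdgeSet_mem_mapEdges σ E e).1 he, (mem_mapEdgeSet_iff σ x e).1 hx⟩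
  · rintro ⟨e, he, hx⟩
    exact ⟨_, (mapEdgeSet_mem_mapEdges σ E e).2 he, (mem_mapEdgeSet_iff σ x e).2 hx⟩

lemma mem_boundary_mapEdges (σ : G ≃g G) (E : Finset G.edgeSet) (x : V) :
    σ x ∈ boundary G (mapEdges σ E) ↔ x ∈ boundary G E := by
  unfold boundary
  refine and_congr (mem_verts_mapEdges σ E x) ?_
  constructor
  · rintro ⟨e, he, hx⟩
    obtain ⟨e, rfl⟩ := σ.mapEdgeSet.surjective e
    exact ⟨e, fun h => he ((mapEdgeSet_mem_mapEdges σ E e).2 h), (mem_mapEdgeSet_iff σ x e).1 hx⟩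
  · rintro ⟨e, he, hx⟩
    exact ⟨_, fun h => he ((mapEdgeSet_mem_mapEdges σ E e).1 h), (mem_mapEdgeSet_iff σ x e).2 hx⟩

/-- The bijection between `E` and its image under an automorphism. -/
def mapEdgesEquiv (σ : G ≃g G) (E : Finset G.edgeSet) : E ≃ mapEdges σ E :=
  σ.mapEdgeSet.subtypeEquiv fun e => (mapEdgeSet_mem_mapEdges σ E e).symm

lemma pull_extend (σ : G ≃g G) (E : Finset G.edgeSet) (η : mapEdges σ E → Bool) :
    pull σ (extend G (mapEdges σ E) η) = extend G E (η ∘ mapEdgesEquiv σ E) := by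
  funext e
  by_cases he : e ∈ E
  · rw [extend_of_mem _ he, pull, extend_of_mem _ ((mapEdgeSet_mem_mapEdges σ E e).2 he)]
    rfl
  · rw [extend_of_notMem _ he, pull,
      extend_of_notMem _ fun h => he ((mapEdgeSet_mem_mapEdges σ E e).1 h)]

/-- Boundary conditions that correspond to each other under an automorphism. -/
def BCCompatible (σ : G ≃g G) (E : Finset G.edgeSet) (ξ : BoundaryCondition G E)
    (ξ' : BoundaryCondition G (mapEdges σ E)) : Prop :=
  ∀ x y (hx : x ∈ boundary G E) (hy : y ∈ boundary G E)
    (hx' : σ x ∈ boundary G (mapEdges σ E)) (hy' : σ y ∈ boundary G (mapEdges σ E)),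
    ξ ⟨x, hx⟩ ⟨y, hy⟩ ↔ ξ' ⟨σ x, hx'⟩ ⟨σ y, hy'⟩

lemma bcCompatible_bot (σ : G ≃g G) (E : Finset G.edgeSet) : BCCompatible σ E ⊥ ⊥ := by
  intro x y hx hy hx' hy'
  simp

lemma bcCompatible_top (σ : G ≃g G) (E : Finset G.edgeSet) : BCCompatible σ E ⊤ ⊤ := by
  intro x y hx hy hx' hy'
  simp [Setoid.top_def]

lemma clusters_mapEdges (σ : G ≃g G) (E : Finset G.edgeSet) {ξ : BoundaryCondition G E}
    {ξ' : BoundaryCondition G (mapEdges σ E)} (hξ : BCCompatible σ E ξ ξ')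
    (η : mapEdges σ E → Bool) :
    clusters G (mapEdges σ E) ξ' η = clusters G E ξ (η ∘ mapEdgesEquiv σ E) := by
  have hrel : ∀ x y, (∃ (hx : x ∈ boundary G E) (hy : y ∈ boundary G E), ξ ⟨x, hx⟩ ⟨y, hy⟩) ↔
      ∃ (hx : σ x ∈ boundary G (mapEdges σ E)) (hy : σ y ∈ boundary G (mapEdges σ E)),
        ξ' ⟨σ x, hx⟩ ⟨σ y, hy⟩ := by
    intro x y
    constructor
    · rintro ⟨hx, hy, h⟩
      exact ⟨(mem_boundary_mapEdges σ E x).2 hx, (mem_boundary_mapEdges σ E y).2 hy,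
        (hξ x y hx hy _ _).1 h⟩
    · rintro ⟨hx, hy, h⟩
      exact ⟨(mem_boundary_mapEdges σ E x).1 hx, (mem_boundary_mapEdges σ E y).1 hy,
        (hξ x y _ _ hx hy).2 h⟩
  let iso : wiredGraph G E ξ (η ∘ mapEdgesEquiv σ E) ≃g wiredGraph G (mapEdges σ E) ξ' η :=
    { toEquiv := σ.toEquiv.subtypeEquiv fun x => (mem_verts_mapEdges σ E x).symm
      map_rel_iff' := by
        rintro ⟨x, hx⟩ ⟨y, hy⟩
        simp only [wiredGraph, SimpleGraph.comap_adj, Function.Embedding.subtype_apply,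
          SimpleGraph.sup_adj, SimpleGraph.fromRel_adj, Equiv.subtypeEquiv_apply]
        rw [← pull_extend, openGraph_pull_adj, hrel, hrel]
        refine or_congr Iff.rfl (and_congr ?_ Iff.rfl)
        exact σ.injective.ne_iff }
  exact Nat.card_congr iso.connectedComponentEquiv.symm

lemma weight_mapEdges (p q : ℝ) (σ : G ≃g G) (E : Finset G.edgeSet) {ξ : BoundaryCondition G E}
    {ξ' : BoundaryCondition G (mapEdges σ E)} (hξ : BCCompatible σ E ξ ξ')
    (η : mapEdges σ E → Bool) :
    weight G p q (mapEdges σ E) ξ' η = weight G p q E ξ (η ∘ mapEdgesEquiv σ E) := by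
  rw [weight_eq, weight_eq, clusters_mapEdges σ E hξ]
  congr 1
  unfold bernoulli
  exact (Equiv.prod_comp (mapEdgesEquiv σ E) fun e => if η e = true then p else 1 - p).symm

theorem ev_mapEdges (p q : ℝ) (σ : G ≃g G) (E : Finset G.edgeSet) {ξ : BoundaryCondition G E}
    {ξ' : BoundaryCondition G (mapEdges σ E)} (hξ : BCCompatible σ E ξ ξ') (f : Config G → ℝ) :
    ev G p q (mapEdges σ E) ξ' (fun ω => f (pull σ ω)) = ev G p q E ξ f := by
  classical
  unfold ev
  simp only [weight_mapEdges p q σ E hξ, pull_extend]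
  let e : (mapEdges σ E → Bool) ≃ (E → Bool) :=
    (mapEdgesEquiv σ E).symm.arrowCongr (Equiv.refl Bool)
  have he : ∀ η, e η = η ∘ mapEdgesEquiv σ E := fun η => rfl
  simp only [← he]
  rw [Equiv.sum_comp e fun η => weight G p q E ξ η * f (extend G E η),
    Equiv.sum_comp e fun η => weight G p q E ξ η]

lemma mapEdges_symm (σ : G ≃g G) (E : Finset G.edgeSet) :
    mapEdges σ (mapEdges σ.symm E) = E := by
  ext e
  obtain ⟨e, rfl⟩ := σ.mapEdgeSet.surjective e
  rw [mapEdgeSet_mem_mapEdges]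
  obtain ⟨e, rfl⟩ := σ.symm.mapEdgeSet.surjective e
  rw [mapEdgeSet_mem_mapEdges]
  have : σ.mapEdgeSet (σ.symm.mapEdgeSet e) = e := σ.mapEdgeSet.apply_symm_apply e
  rw [this]

/-- Moving the event amounts to moving the volume, and free boundary conditions remain free. A bound
valid for all finite volumes is therefore invariant under automorphisms. -/
lemma ev_bot_pull (p q : ℝ) (σ : G ≃g G) (E : Finset G.edgeSet) (f : Config G → ℝ) :
    ev G p q E ⊥ (fun ω => f (pull σ ω)) = ev G p q (mapEdges σ.symm E) ⊥ f := by
  have := ev_mapEdges p q σ _ (bcCompatible_bot σ (mapEdges σ.symm E)) f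
  rwa [mapEdges_symm] at this

lemma ev_top_pull (p q : ℝ) (σ : G ≃g G) (E : Finset G.edgeSet) (f : Config G → ℝ) :
    ev G p q E ⊤ (fun ω => f (pull σ ω)) = ev G p q (mapEdges σ.symm E) ⊤ f := by
  have := ev_mapEdges p q σ _ (bcCompatible_top σ (mapEdges σ.symm E)) f
  rwa [mapEdges_symm] at this

end Automorphism

end FK

/-! ### Finiteness and integer translations of the lattice. -/

namespace IsPlanarLattice

variable {V : Type*} {G : SimpleGraph V} {pos : V → ℂ}

lemma finite_of_bounded (hG : IsPlanarLattice G pos) {S : Set V} {r : ℝ}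
    (h : ∀ x ∈ S, |(pos x).re| ≤ r ∧ |(pos x).im| ≤ r) : S.Finite :=
  (hG.finite_in_ball (r + r)).subset fun x hx =>
    (Complex.norm_le_abs_re_add_abs_im (pos x)).trans (add_le_add (h x hx).1 (h x hx).2)

lemma finite_of_box (hG : IsPlanarLattice G pos) {S : Set V} (a b c d : ℝ)
    (h : ∀ x ∈ S, (a ≤ (pos x).re ∧ (pos x).re ≤ b) ∧ c ≤ (pos x).im ∧ (pos x).im ≤ d) :
    S.Finite := by
  refine hG.finite_of_bounded (r := |a| + |b| + |c| + |d|) fun x hx => ?_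
  obtain ⟨⟨h1, h2⟩, h3, h4⟩ := h x hx
  have := neg_abs_le a
  have := le_abs_self b
  have := neg_abs_le c
  have := le_abs_self d
  constructor <;> rw [abs_le] <;> constructor <;>
    linarith [abs_nonneg a, abs_nonneg b, abs_nonneg c, abs_nonneg d]

lemma countable (hG : IsPlanarLattice G pos) : Countable V := by
  have : (Set.univ : Set V) = ⋃ n : ℕ, {x | ‖pos x‖ ≤ n} := by
    ext x
    simpa using exists_nat_ge ‖pos x‖
  rw [← Set.countable_univ_iff, this]
  exact Set.countable_iUnion fun n => (hG.finite_in_ball n).countable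

lemma exists_translate_of_translate {t : ℂ} (h : ∃ φ : G ≃g G, ∀ x, pos (φ x) = pos x + t)
    (a : ℤ) : ∃ φ : G ≃g G, ∀ x, pos (φ x) = pos x + a * t := by
  obtain ⟨φ, hφ⟩ := h
  induction a with
  | zero => exact ⟨SimpleGraph.Iso.refl, fun x => by simp⟩
  | succ n ih =>
    obtain ⟨ψ, hψ⟩ := ih
    refine ⟨ψ.trans φ, fun x => ?_⟩
    rw [RelIso.trans_apply, hφ, hψ]
    push_cast
    ring
  | pred n ih =>
    obtain ⟨ψ, hψ⟩ := ih
    refine ⟨ψ.trans φ.symm, fun x => ?_⟩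
    rw [RelIso.trans_apply]
    have := hφ (φ.symm (ψ x))
    rw [RelIso.apply_symm_apply, hψ] at this
    push_cast at this ⊢
    linear_combination -this

lemma exists_translate (hG : IsPlanarLattice G pos) (a b : ℤ) :
    ∃ φ : G ≃g G, ∀ x, pos (φ x) = pos x + (a + b * Complex.I) := by
  obtain ⟨φ, hφ⟩ := exists_translate_of_translate hG.translate_one a
  obtain ⟨ψ, hψ⟩ := exists_translate_of_translate hG.translate_I b
  exact ⟨φ.trans ψ, fun x => by rw [RelIso.trans_apply, hψ, hφ]; ring⟩

/-- The translation by an integer vector. -/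
noncomputable def translate (hG : IsPlanarLattice G pos) (v : ℤ × ℤ) : G ≃g G :=
  (hG.exists_translate v.1 v.2).choose

lemma pos_translate (hG : IsPlanarLattice G pos) (v : ℤ × ℤ) (x : V) :
    pos (hG.translate v x) = pos x + (v.1 + v.2 * Complex.I) :=
  (hG.exists_translate v.1 v.2).choose_spec x

lemma re_translate (hG : IsPlanarLattice G pos) (v : ℤ × ℤ) (x : V) :
    (pos (hG.translate v x)).re = (pos x).re + v.1 := by
  simp [pos_translate]

lemma im_translate (hG : IsPlanarLattice G pos) (v : ℤ × ℤ) (x : V) :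
    (pos (hG.translate v x)).im = (pos x).im + v.2 := by
  simp [pos_translate]

end IsPlanarLattice

/-! ### Periodicity bounds, and domination by free measures at a larger parameter. -/

namespace FK

variable {V : Type*} {G : SimpleGraph V} {pos : V → ℂ}

/-- The unit cell that contains a vertex. -/
noncomputable def unitCell (pos : V → ℂ) (x : V) : ℤ × ℤ := (⌊(pos x).re⌋, ⌊(pos x).im⌋)

lemma unitCell_translate (hG : IsPlanarLattice G pos) (v : ℤ × ℤ) (x : V) :
    unitCell pos (hG.translate v x) = unitCell pos x + v := by
  simp [unitCell, hG.re_translate, hG.im_translate, Prod.ext_iff]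

lemma finite_unitCell (hG : IsPlanarLattice G pos) (v : ℤ × ℤ) :
    {x | unitCell pos x = v}.Finite := by
  refine hG.finite_of_box v.1 (v.1 + 1) v.2 (v.2 + 1) fun x hx => ?_
  obtain rfl := hx
  exact ⟨⟨Int.floor_le _, (Int.lt_floor_add_one _).le⟩, Int.floor_le _,
    (Int.lt_floor_add_one _).le⟩

/-- Up to translation every edge starts in the unit cell at the origin, which has finitely many
vertices of finite degree. -/
lemma exists_edge_bound (hG : IsPlanarLattice G pos) : ∃ ℓ : ℕ, 1 ≤ ℓ ∧ ∀ x y, G.Adj x y →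
    |(pos x).re - (pos y).re| ≤ ℓ ∧ |(pos x).im - (pos y).im| ≤ ℓ := by
  have hfin : ((fun t : V × V => ‖pos t.1 - pos t.2‖) ''
      ⋃ x ∈ {x | unitCell pos x = 0}, (fun y => (x, y)) '' G.neighborSet x).Finite :=
    ((finite_unitCell hG 0).biUnion fun x _ => (hG.finite_neighbors x).image _).image _
  obtain ⟨r, hr⟩ := hfin.bddAbove
  obtain ⟨ℓ, hℓ⟩ := exists_nat_ge (max r 1)
  refine ⟨ℓ, by exact_mod_cast (le_max_right r 1).trans hℓ, fun x y h => ?_⟩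
  have hn : ‖pos x - pos y‖ ≤ ℓ := by
    set σ := hG.translate (-unitCell pos x) with hσ
    have hx : unitCell pos (σ x) = 0 := by
      rw [hσ, unitCell_translate, add_neg_cancel]
    have := hr (Set.mem_image_of_mem (fun t : V × V => ‖pos t.1 - pos t.2‖)
      (Set.mem_biUnion (x := σ x) hx (Set.mem_image_of_mem (fun z => (σ x, z))
        (show σ y ∈ G.neighborSet (σ x) from σ.map_adj_iff.2 h))))
    simp only [hσ, hG.pos_translate, add_sub_add_right_eq_sub] at this
    exact this.trans ((le_max_left r 1).trans hℓ)
  exact ⟨(Complex.abs_re_le_norm (pos x - pos y)).trans hn,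
    (Complex.abs_im_le_norm (pos x - pos y)).trans hn⟩

lemma exists_degree_bound (hG : IsPlanarLattice G pos) :
    ∃ D : ℕ, ∀ x, (G.neighborSet x).ncard ≤ D := by
  obtain ⟨D, hD⟩ := ((finite_unitCell hG 0).image fun x => (G.neighborSet x).ncard).bddAbove
  refine ⟨D, fun x => ?_⟩
  set σ := hG.translate (-unitCell pos x) with hσ
  have hx : unitCell pos (σ x) = 0 := by rw [hσ, unitCell_translate, add_neg_cancel]
  have h1 := hD (Set.mem_image_of_mem (fun x => (G.neighborSet x).ncard) hx)
  have h2 : σ '' G.neighborSet x ⊆ G.neighborSet (σ x) := by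
    rintro _ ⟨y, hy, rfl⟩
    exact σ.map_adj_iff.2 hy
  rw [← Set.ncard_image_of_injective _ σ.injective]
  exact (Set.ncard_le_ncard h2 (hG.finite_neighbors _)).trans h1

/-- A vertex is determined by its cell and its translate in the base cell. -/
lemma ncard_unitCell_mem_le (hG : IsPlanarLattice G pos) (C : Finset (ℤ × ℤ)) :
    {x | unitCell pos x ∈ C}.ncard ≤ C.card * {x | unitCell pos x = 0}.ncard := by
  rw [← Set.ncard_coe_finset C, ← Set.ncard_prod]
  refine Set.ncard_le_ncard_of_injOn
    (fun x => (unitCell pos x, hG.translate (-unitCell pos x) x)) ?_ ?_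
    (C.finite_toSet.prod (finite_unitCell hG 0))
  · intro x hx
    refine ⟨hx, ?_⟩
    change unitCell pos _ = 0
    rw [unitCell_translate, add_neg_cancel]
  · intro x _ y _ h
    obtain ⟨h1, h2⟩ := Prod.ext_iff.1 h
    simp only at h1 h2
    rw [h1] at h2
    exact (hG.translate _).injective h2

/-- The edges with both end-points in `S`. -/
def edgesIn (G : SimpleGraph V) (S : Set V) : Set G.edgeSet := {e | ∀ x ∈ (e : Sym2 V), x ∈ S}

lemma finite_edgesIn {S : Set V} (hS : S.Finite) : (edgesIn G S).Finite := by
  refine Set.Finite.of_finite_image (f := Subtype.val) ?_ Subtype.val_injective.injOn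
  refine ((hS.prod hS).image fun t : V × V => s(t.1, t.2)).subset ?_
  rintro _ ⟨⟨e, he⟩, h, rfl⟩
  induction e with
  | _ a b => exact ⟨(a, b), ⟨h a (by simp), h b (by simp)⟩, rfl⟩

/-- Closing an edge affects only the events whose support contains it, at most `C` of them. This is
the Lipschitz hypothesis of `ev_exp_le`. -/
lemma sum_ind_extend_le {κ : Type*} (s : Finset κ) {X : κ → Set (Config G)}
    {S : κ → Set G.edgeSet} (hX : ∀ i ∈ s, DeterminedBy (X i) (S i)) {C : ℕ}
    (hC : ∀ e, {i | i ∈ s ∧ e ∈ S i}.ncard ≤ C) {E : Finset G.edgeSet} {η η' : E → Bool}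
    (h : η' ≤ η) :
    ∑ i ∈ s, ind (X i) (extend G E η) ≤
      ∑ i ∈ s, ind (X i) (extend G E η') + C * openDiff η η' := by
  classical
  set d := Finset.univ.filter fun e : E => η e = true ∧ η' e = false with hd
  have h1 : ∀ i ∈ s, ind (X i) (extend G E η) ≤
      ind (X i) (extend G E η') + ∑ e ∈ d, if (e : G.edgeSet) ∈ S i then 1 else 0 := by
    intro i hi
    by_cases hex : ∃ e ∈ d, (e : G.edgeSet) ∈ S i
    · obtain ⟨e, he, heS⟩ := hex
      have : (1 : ℝ) ≤ ∑ e ∈ d, if (e : G.edgeSet) ∈ S i then (1 : ℝ) else 0 := by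
        refine le_trans (by simp [heS]) (Finset.single_le_sum
          (f := fun e : E => if (e : G.edgeSet) ∈ S i then (1 : ℝ) else 0)
          (fun e _ => by positivity) he)
      linarith [ind_le_one (X i) (extend G E η), ind_nonneg (X i) (extend G E η')]
    · push Not at hex
      have hiff : extend G E η ∈ X i ↔ extend G E η' ∈ X i := by
        refine (hX i hi).mem_iff fun e he => ?_
        by_cases heE : e ∈ E
        · rw [extend_of_mem _ heE, extend_of_mem _ heE]
          have h2 := fun hh => hex ⟨e, heE⟩ hh he
          have h3 := h ⟨e, heE⟩
          simp only [hd, Finset.mem_filter, Finset.mem_univ, true_and] at h2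
          revert h2 h3
          cases η ⟨e, heE⟩ <;> cases η' ⟨e, heE⟩ <;> simp
        · rw [extend_of_notMem _ heE, extend_of_notMem _ heE]
      have : ind (X i) (extend G E η) = ind (X i) (extend G E η') := by
        by_cases hm : extend G E η' ∈ X i
        · rw [ind, Set.indicator_of_mem hm, Set.indicator_of_mem (hiff.2 hm)]
        · rw [ind, Set.indicator_of_notMem hm, Set.indicator_of_notMem fun h => hm (hiff.1 h)]
      rw [this]
      exact le_add_of_nonneg_right (Finset.sum_nonneg fun e _ => by positivity)
  refine (Finset.sum_le_sum h1).trans ?_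
  rw [Finset.sum_add_distrib, Finset.sum_comm]
  refine add_le_add_right ?_ _
  refine (Finset.sum_le_card_nsmul d _ (C : ℝ) fun e _ => ?_).trans ?_
  · rw [← Finset.sum_filter, Finset.sum_const, nsmul_eq_mul, mul_one, ← Set.ncard_coe_finset]
    have := hC e
    simp only [Finset.coe_filter]
    exact_mod_cast this
  · rw [nsmul_eq_mul, mul_comm, openDiff]

lemma DeterminedBy.pull {A : Set (Config G)} {S : Set G.edgeSet} (h : DeterminedBy A S)
    (σ : G ≃g G) : DeterminedBy {ω | pull σ ω ∈ A} (σ.mapEdgeSet '' S) :=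
  fun _ _ hω => h _ _ fun _ he => hω _ (Set.mem_image_of_mem _ he)

/-- At `δ = 0` the inequality is strict and says `p < p'`; continuity does the rest. -/
lemma exists_exp_mul_le {p p' : ℝ} (hpp' : p < p') (C : ℕ) :
    ∃ δ : ℝ, 0 < δ ∧ p * Real.exp (δ * C) * (1 - p') ≤ (1 - p) * p' := by
  have hlt : p * Real.exp (0 * C) * (1 - p') < (1 - p) * p' := by
    rw [zero_mul, Real.exp_zero]; nlinarith
  have hcont : Continuous fun δ : ℝ => p * Real.exp (δ * C) * (1 - p') := by fun_prop
  have hev : ∀ᶠ δ in nhds (0 : ℝ), p * Real.exp (δ * C) * (1 - p') < (1 - p) * p' :=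
    hcont.continuousAt.eventually_lt continuousAt_const hlt
  obtain ⟨δ, h1, h2⟩ := ((hev.filter_mono nhdsWithin_le_nhds).and
    (self_mem_nhdsWithin (a := (0 : ℝ)) (s := Set.Ioi 0))).exists
  exact ⟨δ, h2, h1.le⟩

lemma mem_edgesIn_mapEdgeSet (σ : G ≃g G) (S : Set V) (e : G.edgeSet) :
    σ.mapEdgeSet e ∈ edgesIn G S ↔ e ∈ edgesIn G (σ ⁻¹' S) := by
  constructor
  · intro h x hx
    exact h _ ((mem_mapEdgeSet_iff σ x e).2 hx)
  · intro h x hx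
    obtain ⟨x, rfl⟩ := σ.surjective x
    exact h x ((mem_mapEdgeSet_iff σ x e).1 hx)

/-- Dividing by `n ^ 2` removes the surface terms as `n` grows. -/
lemma le_of_forall_sq_mul_le {a b c d : ℝ}
    (h : ∀ n : ℕ, (n : ℝ) ^ 2 * a ≤ (n : ℝ) ^ 2 * b + (c * n + d)) : a ≤ b := by
  by_contra hlt
  push Not at hlt
  obtain ⟨n, hn⟩ := exists_nat_gt (max 1 ((|c| + |d|) / (a - b)))
  have h1 : (1 : ℝ) < n := (le_max_left _ _).trans_lt hn
  have h2 : |c| + |d| < n * (a - b) := by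
    rw [← div_lt_iff₀ (by linarith)]
    exact (le_max_right _ _).trans_lt hn
  have h3 := h n
  have h4 : c * n ≤ |c| * n := mul_le_mul_of_nonneg_right (le_abs_self c) (by linarith)
  have h5 : d ≤ |d| * n := (le_abs_self d).trans (le_mul_of_one_le_right (abs_nonneg d) h1.le)
  nlinarith

open Classical in
/-- An infinite-volume measure at `p` is dominated by the free measures at any larger `p'`. -/
theorem IsInfiniteVolume.measureReal_le_of_ev_bot_le (hG : IsPlanarLattice G pos) {p p' q : ℝ}
    (hp0 : 0 ≤ p) (hpp' : p < p') (hp'1 : p' < 1) (hq : 1 ≤ q) {φ : Measure (Config G)}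
    (hφ : IsInfiniteVolume G p q φ) {A : Set (Config G)} (hAu : IsUpperSet A)
    {S : Finset G.edgeSet} (hS : DeterminedBy A (S : Set G.edgeSet)) {b : ℝ}
    (hb : ∀ E : Finset G.edgeSet, ev G p' q E ⊥ (ind A) ≤ b) : φ.real A ≤ b := by
  have hcount := hG.countable
  have hp1 := hpp'.trans hp'1
  obtain ⟨δ, hδ0, hδ⟩ := exists_exp_mul_le hpp' (verts G S).ncard
  obtain ⟨ℓ, hℓ1, hℓ⟩ := exists_edge_bound hG
  obtain ⟨r, hr⟩ := ((finite_verts S).image fun x => max |(pos x).re| |(pos x).im|).bddAbove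
  -- The margin `s` exceeds both the extent `r` of the support of `A` and the edge length `ℓ`:
  -- translates by vectors of `N` stay in the box, and vertices whose cell lies in `N` are not
  -- boundary vertices.
  obtain ⟨s, hs⟩ := exists_nat_ge (max r ℓ + 1)
  have hsr : r + 1 ≤ s := (add_le_add_left (le_max_left _ _) _).trans hs
  have hsℓ : (ℓ : ℝ) + 1 ≤ s := (add_le_add_left (le_max_right _ _) _).trans hs
  set D := {x | unitCell pos x = 0}.ncard with hD
  refine le_of_forall_sq_mul_le (c := Real.log q / δ * D * (4 * s))
    (d := Real.log q / δ * D * (4 * s ^ 2)) fun n => ?_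
  set B : Set V := {x | (0 ≤ (pos x).re ∧ (pos x).re < (n + 2 * s : ℕ)) ∧
    0 ≤ (pos x).im ∧ (pos x).im < (n + 2 * s : ℕ)} with hB
  have hBfin : B.Finite := hG.finite_of_box 0 (n + 2 * s : ℕ) 0 (n + 2 * s : ℕ)
    fun x hx => ⟨⟨hx.1.1, hx.1.2.le⟩, hx.2.1, hx.2.2.le⟩
  set E : Finset G.edgeSet := (finite_edgesIn (G := G) hBfin).toFinset with hE
  have hmemE : ∀ e, e ∈ E ↔ e ∈ edgesIn G B := fun e => by simp [hE]
  set N : Finset (ℤ × ℤ) := Finset.Ico (s : ℤ) (n + s) ×ˢ Finset.Ico (s : ℤ) (n + s) with hN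
  have hNcard : N.card = n ^ 2 := by
    rw [hN, Finset.card_product, Int.card_Ico, add_sub_cancel_right, Int.toNat_natCast, sq]
  set T := hG.translate with hT
  set X : ℤ × ℤ → Set (Config G) := fun v => {ω | pull (T v) ω ∈ A} with hX
  have hXu : ∀ v, IsUpperSet (X v) := fun v ω ω' h hω => hAu (pull_mono _ h) hω
  have hXdet : ∀ v ∈ N, DeterminedBy (X v) ((T v).mapEdgeSet '' S) := fun v _ => hS.pull _
  -- If the edge lies in the `v`-translate of the support, its end-point `a` translated back by `v`
  -- is a vertex of the support, and this vertex determines `v`.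
  have hC : ∀ e, {v | v ∈ N ∧ e ∈ (T v).mapEdgeSet '' S}.ncard ≤ (verts G S).ncard := by
    rintro ⟨e, he⟩
    induction e with
    | _ a c =>
    refine Set.ncard_le_ncard_of_injOn (fun v => (T v).symm a) ?_ ?_ (finite_verts S)
    · rintro v ⟨-, e, heS, hev⟩
      refine ⟨e, heS, ?_⟩
      rw [← mem_mapEdgeSet_iff (T v), hev, RelIso.apply_symm_apply]
      simp
    · intro v _ v' _ h
      simp only at h
      have h1 : ∀ w, pos ((T w).symm a) = pos a - (w.1 + w.2 * Complex.I) := fun w => by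
        have := hG.pos_translate w ((T w).symm a)
        rw [← hT, RelIso.apply_symm_apply] at this
        rw [this]; ring
      have h2 := h1 v
      rw [h, h1 v', sub_right_inj, Complex.ext_iff] at h2
      simp only [Complex.add_re, Complex.add_im, Complex.mul_re, Complex.mul_im,
        Complex.intCast_re, Complex.intCast_im, Complex.I_re, Complex.I_im, mul_zero, mul_one,
        sub_zero, add_zero, zero_add] at h2
      exact Prod.ext (by exact_mod_cast h2.1.symm) (by exact_mod_cast h2.2.symm)
  set f : Config G → ℝ := fun ω => ∑ v ∈ N, ind (X v) ω with hf
  have hf0 : ∀ ω, 0 ≤ f ω := fun ω => Finset.sum_nonneg fun v _ => ind_nonneg _ _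
  have hfm : Monotone f := fun ω ω' h => Finset.sum_le_sum fun v _ => ind_mono (hXu v) h
  -- Each translate is compared with `A` itself under `φ` through a translated wired volume, so
  -- invariance of `φ` is not needed.
  have hlow : (n : ℝ) ^ 2 * φ.real A ≤ ev G p q E ⊤ f := by
    rw [hf, ev_sum]
    refine le_trans (le_of_eq ?_) (Finset.card_nsmul_le_sum N _ (φ.real A) fun v hv => ?_)
    · rw [hNcard, nsmul_eq_mul]; push_cast; ring
    have h1 := ev_top_pull p q (T v) E (ind A)
    refine le_of_le_of_eq ?_ h1.symm
    refine hφ.measureReal_le_ev_top hp0 hp1 hq hAu (hS.mono fun e heS => ?_)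
    rw [Finset.mem_coe, ← mapEdgeSet_mem_mapEdges (T v), mapEdges_symm, hmemE,
      mem_edgesIn_mapEdgeSet]
    intro x hx
    have hxr := hr (Set.mem_image_of_mem (fun x => max |(pos x).re| |(pos x).im|)
      (show x ∈ verts G S from ⟨e, heS, hx⟩))
    simp only [hN, Finset.mem_product, Finset.mem_Ico] at hv
    obtain ⟨⟨a1, a2⟩, a3, a4⟩ := hv
    have a1' : (s : ℝ) ≤ v.1 := by exact_mod_cast a1
    have a2' : (v.1 : ℝ) < n + s := by exact_mod_cast a2
    have a3' : (s : ℝ) ≤ v.2 := by exact_mod_cast a3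
    have a4' : (v.2 : ℝ) < n + s := by exact_mod_cast a4
    have b1 := abs_le.1 ((le_max_left _ _).trans hxr)
    have b2 := abs_le.1 ((le_max_right _ _).trans hxr)
    simp only [hB, Set.mem_preimage, Set.mem_ofPred_eq, hT, hG.re_translate, hG.im_translate]
    push_cast
    refine ⟨⟨?_, ?_⟩, ?_, ?_⟩ <;> linarith
  have hup : ev G p' q E ⊥ f ≤ (n : ℝ) ^ 2 * b := by
    rw [hf, ev_sum]
    refine le_trans (Finset.sum_le_card_nsmul N _ b fun v _ => ?_) (le_of_eq ?_)
    · exact (ev_bot_pull p' q (T v) E (ind A)).le.trans (hb _)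
    · rw [hNcard, nsmul_eq_mul]; push_cast; ring
  -- Boundary vertices lie in the shell of unit cells of width `s`, whose cardinality is linear in
  -- `n`.
  have hbd : (boundary G E).ncard ≤ ((n + 2 * s) ^ 2 - n ^ 2) * D := by
    set M : Finset (ℤ × ℤ) := Finset.Ico (0 : ℤ) (n + 2 * s) ×ˢ Finset.Ico (0 : ℤ) (n + 2 * s)
      with hM
    have hNM : N ⊆ M := by
      intro v hv
      simp only [hN, hM, Finset.mem_product, Finset.mem_Ico] at hv ⊢
      omega
    have hcard : (M \ N).card = (n + 2 * s) ^ 2 - n ^ 2 := by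
      have hMc : ((n : ℤ) + 2 * s - 0).toNat = n + 2 * s := by omega
      rw [Finset.card_sdiff_of_subset hNM, hNcard, hM, Finset.card_product, Int.card_Ico,
        hMc, ← sq]
    rw [← hcard]
    refine le_trans (Set.ncard_le_ncard ?_ ?_) (ncard_unitCell_mem_le hG (M \ N))
    · rintro x ⟨⟨e, heE, hxe⟩, e', he', hx'⟩
      have hxB : x ∈ B := (hmemE e).1 heE x hxe
      obtain ⟨⟨c1, c2⟩, c3, c4⟩ := hxB
      push_cast at c2 c4
      rw [hmemE] at he'
      have hexy : ∃ y, G.Adj x y ∧ y ∉ B := by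
        obtain ⟨y, hy⟩ := Sym2.mem_iff_exists.1 hx'
        refine ⟨y, by have := e'.2; rwa [hy, SimpleGraph.mem_edgeSet] at this, fun hyB => he' ?_⟩
        intro z hz
        rw [hy, Sym2.mem_iff] at hz
        rcases hz with rfl | rfl
        · exact (hmemE e).1 heE _ hxe
        · exact hyB
      obtain ⟨y, hxy, hy⟩ := hexy
      obtain ⟨d1, d2⟩ := hℓ x y hxy
      rw [abs_le] at d1 d2
      simp only [Set.mem_ofPred_eq, Finset.mem_sdiff]
      refine ⟨?_, fun hxN => hy ?_⟩
      · simp only [hM, unitCell, Finset.mem_product, Finset.mem_Ico, Int.le_floor, Int.floor_lt]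
        push_cast
        exact ⟨⟨c1, c2⟩, c3, c4⟩
      · simp only [hN, unitCell, Finset.mem_product, Finset.mem_Ico, Int.le_floor,
          Int.floor_lt] at hxN
        push_cast at hxN
        obtain ⟨⟨e1, e2⟩, e3, e4⟩ := hxN
        simp only [hB, Set.mem_ofPred_eq]
        push_cast
        refine ⟨⟨?_, ?_⟩, ?_, ?_⟩ <;> linarith
    · have : {x | unitCell pos x ∈ M \ N} = ⋃ v ∈ M \ N, {x | unitCell pos x = v} := by
        ext; simp
      rw [this]
      exact (M \ N).finite_toSet.biUnion fun v _ => finite_unitCell hG v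
  have hbd' : ((boundary G E).ncard : ℝ) ≤ D * (4 * s * n + 4 * s ^ 2) := by
    have h1 : (n + 2 * s) ^ 2 - n ^ 2 = 4 * s * n + 4 * s ^ 2 := by
      rw [Nat.sub_eq_iff_eq_add (Nat.pow_le_pow_left (by omega) 2)]; ring
    rw [h1] at hbd
    calc ((boundary G E).ncard : ℝ) ≤ ((4 * s * n + 4 * s ^ 2) * D : ℕ) := by exact_mod_cast hbd
      _ = _ := by push_cast; ring
  -- Jensen, then wired to free at the cost of the boundary, then the exponential moment bound from
  -- `p` to `p'`.
  have hmain : Real.exp (δ * ((n : ℝ) ^ 2 * φ.real A)) ≤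
      Real.exp ((boundary G E).ncard * Real.log q + δ * ((n : ℝ) ^ 2 * b)) := by
    calc Real.exp (δ * ((n : ℝ) ^ 2 * φ.real A))
        ≤ Real.exp (ev G p q E ⊤ fun ω => δ * f ω) := by
          rw [ev_const_mul]
          exact Real.exp_le_exp.2 (mul_le_mul_of_nonneg_left hlow hδ0.le)
      _ ≤ ev G p q E ⊤ (fun ω => Real.exp (δ * f ω)) := exp_ev_le hp0 hp1 hq _ _
      _ ≤ q ^ (boundary G E).ncard * ev G p q E ⊥ (fun ω => Real.exp (δ * f ω)) :=
          ev_top_le_mul_ev_bot hp0 hp1 hq fun ω => (Real.exp_pos _).le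
      _ ≤ q ^ (boundary G E).ncard * Real.exp (δ * ev G p' q E ⊥ f) := by
          refine mul_le_mul_of_nonneg_left ?_ (by positivity)
          exact ev_exp_le hp0 hp1 (hp0.trans hpp'.le) hp'1 hq ⊥ hδ0.le hδ hf0 hfm
            fun η η' h => sum_ind_extend_le N hXdet hC h
      _ ≤ q ^ (boundary G E).ncard * Real.exp (δ * ((n : ℝ) ^ 2 * b)) := by
          refine mul_le_mul_of_nonneg_left ?_ (by positivity)
          exact Real.exp_le_exp.2 (mul_le_mul_of_nonneg_left hup hδ0.le)
      _ = _ := by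
          rw [Real.exp_add, Real.exp_nat_mul, Real.exp_log (by linarith)]
  have h1 := Real.exp_le_exp.1 hmain
  have h2 : ((boundary G E).ncard : ℝ) * Real.log q ≤
      D * (4 * s * n + 4 * s ^ 2) * Real.log q :=
    mul_le_mul_of_nonneg_right hbd' (Real.log_nonneg hq)
  have h3 : δ * ((n : ℝ) ^ 2 * φ.real A) ≤ δ * ((n : ℝ) ^ 2 * b +
      (Real.log q / δ * D * (4 * s) * n + Real.log q / δ * D * (4 * s ^ 2))) := by
    refine (h1.trans (add_le_add_left h2 _)).trans (le_of_eq ?_)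
    field_simp
    ring
  exact le_of_mul_le_mul_left h3 hδ0

/-! ### Connections inside a region. -/

section Within

/-- The edges of `H` with both end-points in `S`. -/
def within (H : SimpleGraph V) (S : Set V) : SimpleGraph V where
  Adj x y := H.Adj x y ∧ x ∈ S ∧ y ∈ S
  symm := ⟨fun _ _ h => ⟨h.1.symm, h.2.2, h.2.1⟩⟩
  loopless := ⟨fun x h => H.loopless.irrefl x h.1⟩

lemma within_le (H : SimpleGraph V) (S : Set V) : within H S ≤ H := fun _ _ h => h.1

lemma within_mono {H H' : SimpleGraph V} {S S' : Set V} (h : H ≤ H') (hS : S ⊆ S') :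
    within H S ≤ within H' S' :=
  fun _ _ hxy => ⟨h hxy.1, hS hxy.2.1, hS hxy.2.2⟩

lemma forall_reachable_of_closed {H : SimpleGraph V} {P : V → Prop} {x y : V}
    (hstep : ∀ a b, H.Adj a b → P a → P b) (hxy : H.Reachable x y) (hx : P x) : P y := by
  obtain ⟨w⟩ := hxy
  induction w with
  | nil => exact hx
  | cons h _ ih => exact ih (hstep _ _ h hx)

lemma reachable_within_of_forall {H : SimpleGraph V} {S : Set V} {x y : V}
    (hS : ∀ z, H.Reachable x z → z ∈ S) (hxy : H.Reachable x y) :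
    (within H S).Reachable x y := by
  refine (forall_reachable_of_closed (P := fun z => H.Reachable x z ∧ (within H S).Reachable x z)
    ?_ hxy ⟨.refl _, .refl _⟩).2
  rintro a b hab ⟨h1, h2⟩
  have hb := h1.trans hab.reachable
  exact ⟨hb, h2.trans (SimpleGraph.Adj.reachable ⟨hab, hS a h1, hS b hb⟩)⟩

/-- A path across a strip contains a path inside the strip that starts next to one side and ends
next to the other. -/
lemma exists_reachable_within_strip {H : SimpleGraph V} (h : V → ℝ) {α β : ℝ} {x y : V}
    (hjump : ∀ a b, H.Adj a b → h a ≤ α → h b < β) (hxy : H.Reachable x y) (hαβ : α < β)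
    (hx : h x ≤ α) (hy : β ≤ h y) :
    ∃ z x' y' z', H.Adj z x' ∧ h z ≤ α ∧ H.Adj y' z' ∧ β ≤ h z' ∧
      (α < h x' ∧ h x' < β) ∧ (α < h y' ∧ h y' < β) ∧
      (within H {w | α < h w ∧ h w < β}).Reachable x' y' := by
  by_contra hno
  -- Along the path, a vertex is either below the strip or joined inside the strip to a point of
  -- entry from below. Without the desired piece this property can never pass level `β`.
  have key : h y ≤ α ∨ (α < h y ∧ h y < β) ∧ ∃ z x', H.Adj z x' ∧ h z ≤ α ∧
      (α < h x' ∧ h x' < β) ∧ (within H {w | α < h w ∧ h w < β}).Reachable x' y := by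
    refine forall_reachable_of_closed (P := fun y => h y ≤ α ∨ (α < h y ∧ h y < β) ∧
      ∃ z x', H.Adj z x' ∧ h z ≤ α ∧ (α < h x' ∧ h x' < β) ∧
        (within H {w | α < h w ∧ h w < β}).Reachable x' y) ?_ hxy (Or.inl hx)
    intro a b hab ha
    rcases le_or_gt (h b) α with hb | hb
    · exact Or.inl hb
    rcases ha with ha | ⟨ha, z, x', hz, hzα, hx', hr⟩
    · have hb' := hjump a b hab ha
      exact Or.inr ⟨⟨hb, hb'⟩, a, b, hab, ha, ⟨hb, hb'⟩, .refl _⟩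
    · rcases lt_or_ge (h b) β with hb' | hb'
      · exact Or.inr ⟨⟨hb, hb'⟩, z, x', hz, hzα, hx',
          hr.trans (SimpleGraph.Adj.reachable ⟨hab, ha, hb, hb'⟩)⟩
      · exact absurd ⟨z, x', a, b, hz, hzα, hab, hb', hx', ha, hr⟩ hno
  rcases key with h1 | ⟨h1, -⟩ <;> linarith [h1]

/-- A path that leaves `S` contains a path inside `S` to a neighbour of the complement. -/
lemma exists_exit {H : SimpleGraph V} {S : Set V} {x y : V} (hxy : H.Reachable x y) (hx : x ∈ S)
    (hy : y ∉ S) : ∃ z z', (within H S).Reachable x z ∧ z ∈ S ∧ H.Adj z z' ∧ z' ∉ S := by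
  by_contra hno
  refine hy (forall_reachable_of_closed (P := fun y => y ∈ S ∧ (within H S).Reachable x y)
    ?_ hxy ⟨hx, .refl _⟩).1
  rintro a b hab ⟨ha, hr⟩
  by_cases hb : b ∈ S
  · exact ⟨hb, hr.trans (SimpleGraph.Adj.reachable ⟨hab, ha, hb⟩)⟩
  · exact absurd ⟨a, b, hr, ha, hab, hb⟩ hno

lemma within_openGraph_congr {S : Set V} {ω ω' : Config G}
    (h : ∀ e ∈ edgesIn G S, ω e = ω' e) :
    within (openGraph G ω) S ≤ within (openGraph G ω') S := by
  rintro x y ⟨⟨hG, ho⟩, hx, hy⟩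
  refine ⟨⟨hG, ?_⟩, hx, hy⟩
  rw [← h _ ?_, ho]
  intro z hz
  simp only [Sym2.mem_iff] at hz
  rcases hz with rfl | rfl
  · exact hx
  · exact hy

/-- The event that some pair of vertices satisfying `P` is connected inside `S`. -/
def connectedWithin (G : SimpleGraph V) (S : Set V) (P : V → V → Prop) : Set (Config G) :=
  {ω | ∃ x y, P x y ∧ (within (openGraph G ω) S).Reachable x y}

lemma isUpperSet_connectedWithin (S : Set V) (P : V → V → Prop) :
    IsUpperSet (connectedWithin G S P) := by
  rintro ω ω' h ⟨x, y, hP, hr⟩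
  exact ⟨x, y, hP, hr.mono (within_mono (openGraph_mono h) le_rfl)⟩

lemma determinedBy_connectedWithin (S : Set V) (P : V → V → Prop) :
    DeterminedBy (connectedWithin G S P) (edgesIn G S) := by
  rintro ω ω' h ⟨x, y, hP, hr⟩
  exact ⟨x, y, hP, hr.mono (within_openGraph_congr h)⟩

lemma pull_mem_connectedWithin (σ : G ≃g G) {S S' : Set V} {P P' : V → V → Prop} {ω : Config G}
    (hS : ∀ x, σ x ∈ S' → x ∈ S) (hP : ∀ x y, P' (σ x) (σ y) → P x y)
    (h : ω ∈ connectedWithin G S' P') : pull σ ω ∈ connectedWithin G S P := by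
  obtain ⟨x, y, hxy, hr⟩ := h
  obtain ⟨x, rfl⟩ := σ.surjective x
  obtain ⟨y, rfl⟩ := σ.surjective y
  refine ⟨x, y, hP x y hxy, ?_⟩
  have key := forall_reachable_of_closed
    (P := fun z => (within (openGraph G (pull σ ω)) S).Reachable x (σ.symm z)) ?_ hr ?_
  · simpa using key
  · rintro a b ⟨hab, ha, hb⟩ h1
    obtain ⟨a, rfl⟩ := σ.surjective a
    obtain ⟨b, rfl⟩ := σ.surjective b
    simp only [RelIso.symm_apply_apply] at h1 ⊢
    exact h1.trans (SimpleGraph.Adj.reachable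
      ⟨(openGraph_pull_adj σ ω a b).2 hab, hS a ha, hS b hb⟩)
  · simp

end Within

/-! ### From a long connection to a crossing of a 2 by 1 rectangle. -/

section WeakCrossing

/-- The rectangle of width `2L` in the coordinate `t` and height `L` in the coordinate `h`, with
lower left corner `(γ, α)`. -/
def rect (t h : V → ℝ) (γ α L : ℝ) : Set V :=
  {z | (γ ≤ t z ∧ t z ≤ γ + 2 * L) ∧ α ≤ h z ∧ h z ≤ α + L}

/-- The event that a rectangle is crossed in its short direction, up to a margin `j`. -/
def weakCross (G : SimpleGraph V) (t h : V → ℝ) (γ α L j : ℝ) : Set (Config G) :=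
  connectedWithin G (rect t h γ α L) fun x y => h x ≤ α + j ∧ α + L - j ≤ h y

/-- The path crosses a strip of height `L` in a window of width `3L`. If its cluster inside the
strip stays in the left or in the right two thirds, it crosses that rectangle vertically. Otherwise
it goes beyond both sides of the middle third, which it crosses horizontally, inside a rectangle of
width `L` that is extended to height `2L`. The margin `2ℓ` is the trimming of the strip by `ℓ` plus
the length of one edge. -/
lemma weakCross_of_strip {ω : Config G} {H : SimpleGraph V} (hH : H ≤ openGraph G ω)
    {t h : V → ℝ} {L ℓ a β : ℝ} (hL : 4 * ℓ < L) (hℓ : 0 < ℓ)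
    (ht : ∀ x y, G.Adj x y → |t x - t y| ≤ ℓ) (hh : ∀ x y, G.Adj x y → |h x - h y| ≤ ℓ)
    (hHt : ∀ x y, H.Adj x y → (a - L ≤ t x ∧ t x ≤ a + 2 * L))
    {x y : V} (hxy : H.Reachable x y) (hx : h x ≤ β + ℓ) (hy : β + L - ℓ ≤ h y) :
    ω ∈ weakCross G t h (a - L) β L (2 * ℓ) ∨ ω ∈ weakCross G t h a β L (2 * ℓ) ∨
      ω ∈ weakCross G h t β a L (2 * ℓ) := by
  have hHG : ∀ x y, H.Adj x y → G.Adj x y := fun x y hxy => openGraph_le ω (hH hxy)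
  obtain ⟨z, x', y', z', hz, hzα, hz', hzβ, hx', hy', hr⟩ :=
    exists_reachable_within_strip h (α := β + ℓ) (β := β + L - ℓ)
      (fun u v huv hu => by have := abs_le.1 (hh u v (hHG u v huv)); linarith) hxy
      (by linarith) hx hy
  set K := within H {w | β + ℓ < h w ∧ h w < β + L - ℓ} with hK
  have e1 := abs_le.1 (hh _ _ (hHG _ _ hz))
  have e2 := abs_le.1 (hh _ _ (hHG _ _ hz'))
  have hKh : ∀ u v, K.Adj u v → (β + ℓ < h u ∧ h u < β + L - ℓ) ∧ a - L ≤ t u ∧ t u ≤ a + 2 * L :=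
    fun u v huv => ⟨huv.2.1, hHt u v huv.1⟩
  by_cases hright : ∀ w, K.Reachable x' w → t w ≤ a + L
  · left
    refine ⟨x', y', ⟨by linarith, by linarith⟩, ?_⟩
    refine (reachable_within_of_forall hright hr).mono ?_
    rintro u v ⟨huv, hu, hv⟩
    have h1 := hKh u v huv
    have h2 := hKh v u huv.symm
    change t u ≤ a + L at hu
    change t v ≤ a + L at hv
    refine ⟨hH huv.1, ⟨⟨?_, ?_⟩, ?_, ?_⟩, ⟨?_, ?_⟩, ?_, ?_⟩ <;> linarith
  push Not at hright
  obtain ⟨w₁, hw₁, hw₁'⟩ := hright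
  by_cases hleft : ∀ w, K.Reachable x' w → a ≤ t w
  · right; left
    refine ⟨x', y', ⟨by linarith, by linarith⟩, ?_⟩
    refine (reachable_within_of_forall hleft hr).mono ?_
    rintro u v ⟨huv, hu, hv⟩
    have h1 := hKh u v huv
    have h2 := hKh v u huv.symm
    change a ≤ t u at hu
    change a ≤ t v at hv
    refine ⟨hH huv.1, ⟨⟨?_, ?_⟩, ?_, ?_⟩, ⟨?_, ?_⟩, ?_, ?_⟩ <;> linarith
  push Not at hleft
  obtain ⟨w₂, hw₂, hw₂'⟩ := hleft
  right; right
  obtain ⟨z₁, x₁, y₁, z₂, hz₁, hz₁α, hz₂, hz₂β, hx₁, hy₁, hr₁⟩ :=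
    exists_reachable_within_strip t (α := a) (β := a + L)
      (fun u v huv hu => by have := abs_le.1 (ht u v (hHG u v huv.1)); linarith)
      (hw₂.symm.trans hw₁) (by linarith) hw₂'.le hw₁'.le
  have e3 := abs_le.1 (ht _ _ (hHG _ _ hz₁.1))
  have e4 := abs_le.1 (ht _ _ (hHG _ _ hz₂.1))
  refine ⟨x₁, y₁, ⟨by linarith, by linarith⟩, hr₁.mono ?_⟩
  rintro u v ⟨huv, hu, hv⟩
  have h1 := hKh u v huv
  have h2 := hKh v u huv.symm
  change a < t u ∧ t u < a + L at hu
  change a < t v ∧ t v < a + L at hv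
  refine ⟨hH huv.1, ⟨⟨?_, ?_⟩, ?_, ?_⟩, ⟨?_, ?_⟩, ?_, ?_⟩ <;> linarith

/-- An open path from a cell of side `L` to the outside of the block of its neighbouring cells
crosses a rectangle in its short direction. -/
lemma exists_weakCross {ω : Config G} {H : SimpleGraph V} (hH : H ≤ openGraph G ω)
    {t h : V → ℝ} {L ℓ : ℝ} (hL : 4 * ℓ < L) (hℓ : 0 < ℓ)
    (ht : ∀ x y, G.Adj x y → |t x - t y| ≤ ℓ) (hh : ∀ x y, G.Adj x y → |h x - h y| ≤ ℓ)
    {a b : ℤ} {u v : V} (huv : H.Reachable u v) (hut : a * L ≤ t u ∧ t u ≤ (a + 1) * L)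
    (huh : b * L ≤ h u ∧ h u ≤ (b + 1) * L)
    (hv : ¬ (((a - 1) * L ≤ t v ∧ t v ≤ (a + 2) * L) ∧ (b - 1) * L ≤ h v ∧ h v ≤ (b + 2) * L)) :
    ∃ m n : ℤ, |m - a| ≤ 1 ∧ |n - b| ≤ 1 ∧
      (ω ∈ weakCross G t h (m * L) (n * L) L (2 * ℓ) ∨
        ω ∈ weakCross G h t (n * L) (m * L) L (2 * ℓ)) := by
  set Q : Set V := {w | ((a - 1) * L ≤ t w ∧ t w ≤ (a + 2) * L) ∧
    (b - 1) * L ≤ h w ∧ h w ≤ (b + 2) * L} with hQ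
  obtain ⟨z, z', hr, hzQ, hzz', hz'⟩ := exists_exit huv
    (show u ∈ Q from ⟨⟨by linarith, by linarith⟩, by linarith, by linarith⟩) hv
  have hle : within H Q ≤ openGraph G ω := (within_le H Q).trans hH
  have hQt : ∀ x y, (within H Q).Adj x y → a * L - L ≤ t x ∧ t x ≤ a * L + 2 * L :=
    fun x y hxy => by
      have := hxy.2.1.1
      constructor <;> linarith
  have hQh : ∀ x y, (within H Q).Adj x y → b * L - L ≤ h x ∧ h x ≤ b * L + 2 * L :=
    fun x y hxy => by
      have := hxy.2.1.2
      constructor <;> linarith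
  have e1 := abs_le.1 (ht _ _ (openGraph_le ω (hH hzz')))
  have e2 := abs_le.1 (hh _ _ (openGraph_le ω (hH hzz')))
  -- The exit from the 3 by 3 block takes place within one edge length of one of its four sides; the
  -- path has then crossed the strip of cells along that side.
  have hcases : (b + 2) * L - ℓ ≤ h z ∨ h z ≤ (b - 1) * L + ℓ ∨ (a + 2) * L - ℓ ≤ t z ∨
      t z ≤ (a - 1) * L + ℓ := by
    by_contra hno
    push Not at hno
    exact hz' ⟨⟨by linarith, by linarith⟩, by linarith, by linarith⟩
  have cast1 : ∀ k : ℤ, ((k + 1 : ℤ) : ℝ) * L = k * L + L := fun k => by push_cast; ring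
  have cast2 : ∀ k : ℤ, ((k - 1 : ℤ) : ℝ) * L = k * L - L := fun k => by push_cast; ring
  rcases hcases with hc | hc | hc | hc
  · rcases weakCross_of_strip (β := b * L + L) hle hL hℓ ht hh hQt hr (by linarith)
      (by linarith) with h1 | h1 | h1
    · exact ⟨a - 1, b + 1, by simp, by simp, Or.inl (by rwa [cast1, cast2])⟩
    · exact ⟨a, b + 1, by simp, by simp, Or.inl (by rwa [cast1])⟩
    · exact ⟨a, b + 1, by simp, by simp, Or.inr (by rwa [cast1])⟩
  · rcases weakCross_of_strip (β := b * L - L) hle hL hℓ ht hh hQt hr.symm (by linarith)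
      (by linarith) with h1 | h1 | h1
    · exact ⟨a - 1, b - 1, by simp, by simp, Or.inl (by rwa [cast2, cast2])⟩
    · exact ⟨a, b - 1, by simp, by simp, Or.inl (by rwa [cast2])⟩
    · exact ⟨a, b - 1, by simp, by simp, Or.inr (by rwa [cast2])⟩
  · rcases weakCross_of_strip (β := a * L + L) hle hL hℓ hh ht hQh hr (by linarith)
      (by linarith) with h1 | h1 | h1
    · exact ⟨a + 1, b - 1, by simp, by simp, Or.inr (by rwa [cast1, cast2])⟩
    · exact ⟨a + 1, b, by simp, by simp, Or.inr (by rwa [cast1])⟩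
    · exact ⟨a + 1, b, by simp, by simp, Or.inl (by rwa [cast1])⟩
  · rcases weakCross_of_strip (β := a * L - L) hle hL hℓ hh ht hQh hr.symm (by linarith)
      (by linarith) with h1 | h1 | h1
    · exact ⟨a - 1, b - 1, by simp, by simp, Or.inr (by rwa [cast2, cast2])⟩
    · exact ⟨a - 1, b, by simp, by simp, Or.inr (by rwa [cast2])⟩
    · exact ⟨a - 1, b, by simp, by simp, Or.inl (by rwa [cast2])⟩

end WeakCrossing

end FK

/-! ### Folding the lattice along its symmetry axes. -/

namespace IsPlanarLattice

variable {V : Type*} {G : SimpleGraph V} {pos : V → ℂ}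

/-- Reflection in the vertical axis followed by a rotation by `π` is complex conjugation. -/
lemma exists_conj (hG : IsPlanarLattice G pos) (n : ℤ) :
    ∃ φ : G ≃g G, ∀ x, (pos (φ x)).re = (pos x).re ∧ (pos (φ x)).im = n - (pos x).im := by
  obtain ⟨ρ, hρ⟩ := hG.rotate
  obtain ⟨r, hr⟩ := hG.reflect
  refine ⟨((r.trans ρ).trans ρ).trans (hG.translate (0, n)), fun x => ?_⟩
  simp only [RelIso.trans_apply, hG.pos_translate, hρ, hr]
  constructor <;> simp
  ring

/-- Three quarter turns after the reflection give `z ↦ i * conj z`, which exchanges the coordinates.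
-/
lemma exists_swap (hG : IsPlanarLattice G pos) :
    ∃ φ : G ≃g G, ∀ x, (pos (φ x)).re = (pos x).im ∧ (pos (φ x)).im = (pos x).re := by
  obtain ⟨ρ, hρ⟩ := hG.rotate
  obtain ⟨r, hr⟩ := hG.reflect
  refine ⟨((r.trans ρ).trans ρ).trans ρ, fun x => ?_⟩
  simp only [RelIso.trans_apply, hρ, hr]
  constructor <;> simp

lemma eq_of_re_im (hG : IsPlanarLattice G pos) {x y : V} (h1 : (pos x).re = (pos y).re)
    (h2 : (pos x).im = (pos y).im) : x = y :=
  hG.pos_injective (Complex.ext h1 h2)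

/-- An edge that crosses a horizontal symmetry axis away from its end-points is orthogonal to it. -/
lemma reflect_of_separated (hG : IsPlanarLattice G pos) {ρ : G ≃g G} {c : ℝ}
    (hρ : ∀ x, (pos (ρ x)).re = (pos x).re ∧ (pos (ρ x)).im = 2 * c - (pos x).im) {a b : V}
    (hab : G.Adj a b) (ha : (pos a).im < c) (hb : c < (pos b).im) : b = ρ a := by
  by_cases hs : s(a, b) = s(ρ a, ρ b)
  · rcases Sym2.eq_iff.1 hs with ⟨h1, -⟩ | ⟨-, h2⟩
    · have := (hρ a).2
      rw [← h1] at this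
      linarith
    · exact h2
  · exfalso
    -- The point where the edge meets the axis also lies on the mirror image of the edge. For
    -- distinct edges planarity would make it an end-point, but neither end-point is on the axis.
    set θ : ℝ := (c - (pos a).im) / ((pos b).im - (pos a).im) with hθ
    have hd : 0 < (pos b).im - (pos a).im := by linarith
    have h0 : 0 ≤ θ := div_nonneg (by linarith) hd.le
    have h1 : θ ≤ 1 := (div_le_one hd).2 (by linarith)
    have hθc : (1 - θ) * (pos a).im + θ * (pos b).im = c := by
      have : θ * ((pos b).im - (pos a).im) = c - (pos a).im := div_mul_cancel₀ _ hd.ne'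
      linarith
    set z : ℂ := (1 - θ) • pos a + θ • pos b with hz
    have hzim : z.im = c := by
      simp only [hz, Complex.add_im, Complex.smul_im, smul_eq_mul]
      exact hθc
    have hz1 : z ∈ segment ℝ (pos a) (pos b) := ⟨1 - θ, θ, by linarith, h0, by ring, rfl⟩
    have hz2 : z ∈ segment ℝ (pos (ρ a)) (pos (ρ b)) := by
      refine ⟨1 - θ, θ, by linarith, h0, by ring, ?_⟩
      refine Complex.ext ?_ ?_
      · simp [hz, (hρ a).1, (hρ b).1]
      · rw [hzim]
        simp only [Complex.add_im, Complex.smul_im, smul_eq_mul, (hρ a).2, (hρ b).2]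
        linear_combination (-1 : ℝ) * hθc
    rcases (hG.planar a b (ρ a) (ρ b) hab (ρ.map_adj_iff.2 hab) hs ⟨hz1, hz2⟩).1 with h | h
    · rw [h] at hzim; linarith
    · rw [Set.mem_singleton_iff.1 h] at hzim; linarith

/-- Folding the lattice into a horizontal strip. -/
lemma exists_fold_im (hG : IsPlanarLattice G pos) (B : ℤ) {j : ℕ} (hj : 1 ≤ j) :
    ∃ Φ : V → V, (∀ x, (pos (Φ x)).re = (pos x).re) ∧
      (∀ x, B ≤ (pos (Φ x)).im ∧ (pos (Φ x)).im ≤ B + j) ∧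
      (∀ x, B ≤ (pos x).im → (pos x).im ≤ B + j → Φ x = x) ∧
      ∀ a b, G.Adj a b → Φ a = Φ b ∨ G.Adj (Φ a) (Φ b) := by
  have hj0 : (0 : ℝ) < j := by exact_mod_cast hj
  -- The slab `k` of height `j` is brought to the strip by a translation when `k` is even and by a
  -- reflection when `k` is odd.
  have hg : ∀ k : ℤ, ∃ g : G ≃g G, ∀ x, (pos (g x)).re = (pos x).re ∧
      (Even k → (pos (g x)).im = (pos x).im - j * k) ∧
      (¬ Even k → (pos (g x)).im = 2 * B + j * (k + 1) - (pos x).im) := by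
    intro k
    by_cases hk : Even k
    · refine ⟨hG.translate (0, -(j * k)), fun x => ⟨by simp [hG.re_translate], fun _ => ?_,
        fun h => absurd hk h⟩⟩
      rw [hG.im_translate]; push_cast; ring
    · obtain ⟨g, h⟩ := hG.exists_conj (2 * B + j * (k + 1))
      refine ⟨g, fun x => ⟨(h x).1, fun h' => absurd h' hk, fun _ => ?_⟩⟩
      rw [(h x).2]; push_cast; ring
  choose g hg using hg
  set fl : V → ℤ := fun x => ⌊((pos x).im - B) / j⌋ with hfl
  have hfl1 : ∀ x, B + j * (fl x : ℝ) ≤ (pos x).im := fun x => by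
    have h := Int.floor_le (((pos x).im - B) / j)
    rw [le_div_iff₀ hj0] at h
    simp only [hfl]; linarith
  have hfl2 : ∀ x, (pos x).im < B + j * ((fl x : ℝ) + 1) := fun x => by
    have h := Int.lt_floor_add_one (((pos x).im - B) / j)
    rw [div_lt_iff₀ hj0] at h
    simp only [hfl]; linarith
  -- On the line between two slabs the two maps agree, so the floor may be replaced by either
  -- neighbouring index there.
  have hslab : ∀ (k : ℤ) x, B + j * (k : ℝ) ≤ (pos x).im → (pos x).im ≤ B + j * ((k : ℝ) + 1) →
      g (fl x) x = g k x := by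
    intro k x h1 h2
    have hk1 : k ≤ fl x := by
      rw [hfl, Int.le_floor, le_div_iff₀ hj0]; linarith
    have hk2 : fl x ≤ k + 1 := by
      have h3 := (hfl1 x).trans h2
      have h4 : (fl x : ℝ) ≤ k + 1 := le_of_mul_le_mul_left (by linarith) hj0
      exact_mod_cast h4
    rcases (by omega : fl x = k ∨ fl x = k + 1) with h | h
    · rw [h]
    · have him : (pos x).im = B + j * ((k : ℝ) + 1) := by
        have := hfl1 x
        rw [h] at this
        push_cast at this
        linarith
      rw [h]
      refine hG.eq_of_re_im (by rw [(hg _ x).1, (hg _ x).1]) ?_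
      by_cases hk : Even k
      · have hk' : ¬ Even (k + 1) := by simpa [Int.even_add_one] using hk
        rw [(hg _ x).2.1 hk, (hg _ x).2.2 hk', him]
        push_cast; ring
      · have hk' : Even (k + 1) := by simpa [Int.even_add_one] using hk
        rw [(hg _ x).2.2 hk, (hg _ x).2.1 hk', him]
        push_cast; ring
  refine ⟨fun x => g (fl x) x, fun x => (hg _ x).1, fun x => ?_, fun x h1 h2 => ?_, ?_⟩
  · have h1 := hfl1 x
    have h2 := hfl2 x
    by_cases hk : Even (fl x)
    · rw [(hg _ x).2.1 hk]; constructor <;> linarith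
    · rw [(hg _ x).2.2 hk]; constructor <;> linarith
  · simp only
    rw [hslab 0 x (by simpa using h1) (by simpa using h2)]
    refine hG.eq_of_re_im (hg _ x).1 ?_
    rw [(hg _ x).2.1 Even.zero]; simp
  · have key : ∀ a b, G.Adj a b → (pos a).im ≤ (pos b).im →
        g (fl a) a = g (fl b) b ∨ G.Adj (g (fl a) a) (g (fl b) b) := by
      intro a b hab hle
      have ha1 := hfl1 a
      have ha2 := hfl2 a
      rcases le_or_gt (pos b).im (B + j * ((fl a : ℝ) + 1)) with hb | hb
      · right
        rw [hslab (fl a) b (by linarith) hb]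
        exact (g (fl a)).map_adj_iff.2 hab
      · left
        obtain ⟨ρ, hρ⟩ := hG.exists_conj (2 * B + 2 * (j * (fl a + 1)))
        have hbρ : b = ρ a := hG.reflect_of_separated (ρ := ρ) (c := B + j * ((fl a : ℝ) + 1))
          (fun x => ⟨(hρ x).1, by rw [(hρ x).2]; push_cast; ring⟩) hab ha2 hb
        have hbre : (pos b).re = (pos a).re := by rw [hbρ, (hρ a).1]
        have hbim : (pos b).im = 2 * B + 2 * (j * ((fl a : ℝ) + 1)) - (pos a).im := by
          rw [hbρ, (hρ a).2]; push_cast; ring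
        rw [hslab (fl a + 1) b (by push_cast; linarith) (by push_cast; linarith)]
        refine hG.eq_of_re_im (by rw [(hg _ a).1, (hg _ b).1, hbre]) ?_
        by_cases hk : Even (fl a)
        · have hk' : ¬ Even (fl a + 1) := by simpa [Int.even_add_one] using hk
          rw [(hg _ a).2.1 hk, (hg _ b).2.2 hk', hbim]
          push_cast; ring
        · have hk' : Even (fl a + 1) := by simpa [Int.even_add_one] using hk
          rw [(hg _ a).2.2 hk, (hg _ b).2.1 hk', hbim]
          push_cast; ring
    intro a b hab
    rcases le_total (pos a).im (pos b).im with h | h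
    · exact key a b hab h
    · rcases key b a hab.symm h with h | h
      · exact Or.inl h.symm
      · exact Or.inr h.symm

/-- Folding the lattice into a rectangle. -/
lemma exists_fold (hG : IsPlanarLattice G pos) (B : ℤ) {j m : ℕ} (hj : 1 ≤ j) (hm : 1 ≤ m) :
    ∃ Φ : V → V, (∀ x, (0 ≤ (pos (Φ x)).re ∧ (pos (Φ x)).re ≤ m) ∧
        B ≤ (pos (Φ x)).im ∧ (pos (Φ x)).im ≤ B + j) ∧
      (∀ x, 0 ≤ (pos x).re → (pos x).re ≤ m → B ≤ (pos x).im → (pos x).im ≤ B + j → Φ x = x) ∧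
      (∀ x, B ≤ (pos x).im → (pos x).im ≤ B + j → (pos (Φ x)).im = (pos x).im) ∧
      ∀ a b, G.Adj a b → Φ a = Φ b ∨ G.Adj (Φ a) (Φ b) := by
  -- The horizontal fold is the vertical one conjugated by the exchange of coordinates.
  obtain ⟨Φ, h1, h2, h3, h4⟩ := hG.exists_fold_im B hj
  obtain ⟨Ψ, k1, k2, k3, k4⟩ := hG.exists_fold_im 0 hm
  obtain ⟨σ, hσ⟩ := hG.exists_swap
  have im_mid : ∀ x, (pos (σ (Ψ (σ x)))).im = (pos x).im := fun x => by
    rw [(hσ _).2, k1, (hσ _).1]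
  refine ⟨fun x => Φ (σ (Ψ (σ x))), fun x => ⟨?_, h2 _⟩, fun x a1 a2 a3 a4 => ?_,
    fun x a3 a4 => ?_, fun a b hab => ?_⟩
  · rw [h1, (hσ _).1]
    simpa using k2 (σ x)
  · have e1 : Ψ (σ x) = σ x := k3 _ (by rw [(hσ x).2]; simpa using a1)
      (by rw [(hσ x).2]; simpa using a2)
    have e2 : σ (σ x) = x := hG.eq_of_re_im (by rw [(hσ _).1, (hσ _).2])
      (by rw [(hσ _).2, (hσ _).1])
    simp only [e1, e2]
    exact h3 x a3 a4
  · simp only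
    rw [h3 _ (by rwa [im_mid]) (by rwa [im_mid]), im_mid]
  · rcases k4 _ _ (σ.map_adj_iff.2 hab) with h | h
    · left; simp only [h]
    · exact h4 _ _ (σ.map_adj_iff.2 h)

/-- Vertices of a horizontal strip are at bounded distance from its sides. -/
lemma exists_walk_to_side (hG : IsPlanarLattice G pos) (haxis : ∃ x, (pos x).im = 0) (j : ℕ) :
    ∃ D : ℕ, ∀ (B T : ℤ) (z : V), (T = B ∨ T = B + j) → B ≤ (pos z).im → (pos z).im ≤ B + j →
      ∃ x, (pos x).im = T ∧ ∃ w : G.Walk z x, w.length ≤ D := by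
  obtain ⟨x₀, hx₀⟩ := haxis
  have hfin : {z | (0 ≤ (pos z).re ∧ (pos z).re ≤ 1) ∧ 0 ≤ (pos z).im ∧ (pos z).im ≤ j}.Finite :=
    hG.finite_of_box 0 1 0 j fun x hx => hx
  -- After an integer translation only finitely many `z` remain, with two fixed targets: a vertex at
  -- height 0 and its translate at height `j`.
  obtain ⟨D, hD⟩ := (hfin.image fun z =>
    max (G.dist z x₀) (G.dist z (hG.translate (0, (j : ℤ)) x₀))).bddAbove
  refine ⟨D, fun B T z hT h1 h2 => ?_⟩
  set σ := hG.translate (-⌊(pos z).re⌋, -B) with hσ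
  have hσre : (pos (σ z)).re = (pos z).re - ⌊(pos z).re⌋ := by
    rw [hσ, hG.re_translate]; push_cast; ring
  have hσim : ∀ x, (pos (σ x)).im = (pos x).im - B := fun x => by
    rw [hσ, hG.im_translate]; push_cast; ring
  have hmem : σ z ∈ {z | (0 ≤ (pos z).re ∧ (pos z).re ≤ 1) ∧ 0 ≤ (pos z).im ∧ (pos z).im ≤ j} := by
    refine ⟨⟨?_, ?_⟩, ?_, ?_⟩
    · rw [hσre]; linarith [Int.floor_le (pos z).re]
    · rw [hσre]; linarith [Int.lt_floor_add_one (pos z).re]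
    · rw [hσim]; linarith
    · rw [hσim]; linarith
  have hmax := hD (Set.mem_image_of_mem _ hmem)
  have key : ∀ y : V, (pos y).im = T - B → G.dist (σ z) y ≤ D →
      ∃ x, (pos x).im = T ∧ ∃ w : G.Walk z x, w.length ≤ D := by
    intro y hy hdist
    obtain ⟨w, hw⟩ := hG.connected.exists_walk_length_eq_dist (σ z) y
    obtain ⟨x, rfl⟩ := σ.surjective y
    refine ⟨x, by rw [hσim] at hy; linarith, ?_⟩
    refine ⟨(w.map σ.symm.toHom).copy (σ.symm_apply_apply z) (σ.symm_apply_apply x), ?_⟩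
    rw [SimpleGraph.Walk.length_copy, SimpleGraph.Walk.length_map, hw]
    exact hdist
  rcases hT with rfl | rfl
  · exact key x₀ (by rw [hx₀]; ring) ((le_max_left _ _).trans hmax)
  · refine key (hG.translate (0, (j : ℤ)) x₀) ?_ ((le_max_right _ _).trans hmax)
    rw [hG.im_translate, hx₀]; push_cast; ring

end IsPlanarLattice

/-! ### Extending crossings up to a margin to full crossings. -/

namespace FK

variable {V : Type*} {G : SimpleGraph V} {pos : V → ℂ}

/-- A walk folded into `S` gives a small set of edges of `S` that joins its end-points. -/
lemma exists_edges_of_walk {S : Set V} {Φ : V → V} (hS : ∀ x, Φ x ∈ S)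
    (hΦ : ∀ a b, G.Adj a b → Φ a = Φ b ∨ G.Adj (Φ a) (Φ b)) {x y : V} (w : G.Walk x y) :
    ∃ F : Finset G.edgeSet, F.card ≤ w.length ∧ (∀ e ∈ F, e ∈ edgesIn G S) ∧
      ∀ ω : Config G, (∀ e ∈ F, ω e = true) →
        (within (openGraph G ω) S).Reachable (Φ x) (Φ y) := by
  classical
  induction w with
  | nil => exact ⟨∅, by simp, by simp, fun _ _ => .refl _⟩
  | @cons a b c hab w ih =>
    obtain ⟨F, h1, h2, h3⟩ := ih
    rcases hΦ a b hab with h | h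
    · exact ⟨F, h1.trans (by simp), h2, fun ω hω => by rw [h]; exact h3 ω hω⟩
    · refine ⟨insert ⟨s(Φ a, Φ b), h⟩ F, ?_, ?_, fun ω hω => ?_⟩
      · exact (Finset.card_insert_le _ _).trans (by simpa using h1)
      · intro e he
        rcases Finset.mem_insert.1 he with rfl | he
        · intro z hz
          simp only [Sym2.mem_iff] at hz
          rcases hz with rfl | rfl <;> exact hS _
        · exact h2 e he
      · have hadj : (within (openGraph G ω) S).Adj (Φ a) (Φ b) :=
          ⟨⟨h, hω _ (Finset.mem_insert_self _ _)⟩, hS a, hS b⟩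
        exact hadj.reachable.trans (h3 ω fun e he => hω e (Finset.mem_insert_of_mem he))

/-- The part of a horizontal strip of height `j` above `B` with first coordinate in `[0,m]`. -/
def corridorBox (pos : V → ℂ) (m B j : ℝ) : Set V :=
  {x | (0 ≤ (pos x).re ∧ (pos x).re ≤ m) ∧ B ≤ (pos x).im ∧ (pos x).im ≤ B + j}

/-- A short walk to the side is folded into the box. Folding does not lengthen it, fixes its
starting point and keeps the height of its end. The point is that `D` depends neither on the width
`m` nor on `B`. -/
lemma exists_corridor (hG : IsPlanarLattice G pos) (haxis : ∃ x, (pos x).im = 0) {j : ℕ}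
    (hj : 1 ≤ j) : ∃ D : ℕ, ∀ (m : ℕ) (B T : ℤ), 1 ≤ m → (T = B ∨ T = B + j) →
      ∀ z ∈ corridorBox pos m B j, ∃ F : Finset G.edgeSet, F.card ≤ D ∧
        (∀ e ∈ F, e ∈ edgesIn G (corridorBox pos m B j)) ∧
        ∃ x ∈ corridorBox pos m B j, (pos x).im = T ∧ ∀ ω : Config G, (∀ e ∈ F, ω e = true) →
          (within (openGraph G ω) (corridorBox pos m B j)).Reachable z x := by
  obtain ⟨D, hD⟩ := hG.exists_walk_to_side haxis j
  refine ⟨D, fun m B T hm hT z hz => ?_⟩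
  obtain ⟨Φ, h1, h2, h3, h4⟩ := hG.exists_fold B hj hm
  obtain ⟨x, hx, w, hw⟩ := hD B T z hT hz.2.1 hz.2.2
  obtain ⟨F, f1, f2, f3⟩ := exists_edges_of_walk (S := corridorBox pos m B j) (Φ := Φ) h1 h4 w
  have hz' : Φ z = z := h2 z hz.1.1 hz.1.2 hz.2.1 hz.2.2
  have hxB : B ≤ (pos x).im ∧ (pos x).im ≤ B + j := by
    have : (0 : ℝ) ≤ j := Nat.cast_nonneg j
    rcases hT with rfl | rfl <;> rw [hx] <;> push_cast <;> constructor <;> linarith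
  refine ⟨F, f1.trans hw, f2, Φ x, h1 x, by rw [h3 x hxB.1 hxB.2, hx], fun ω hω => ?_⟩
  have := f3 ω hω
  rwa [hz'] at this

/-- The abscissa of a vertex. -/
def reC (pos : V → ℂ) (x : V) : ℝ := (pos x).re

/-- The ordinate of a vertex. -/
def imC (pos : V → ℂ) (x : V) : ℝ := (pos x).im

lemma exists_walk_of_reachable_within {H : SimpleGraph V} {S : Set V} {x y : V} (hx : x ∈ S)
    (h : (within H S).Reachable x y) : ∃ w : H.Walk x y, ∀ z ∈ w.support, z ∈ S := by
  obtain ⟨w⟩ := h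
  induction w with
  | nil => exact ⟨.nil, by simpa using hx⟩
  | cons h _ ih =>
    obtain ⟨w', hw'⟩ := ih h.2.2
    refine ⟨.cons h.1 w', fun z hz => ?_⟩
    rcases List.mem_cons.1 (by simpa using hz) with rfl | hz
    · exact hx
    · exact hw' z hz

/-- Membership of `x` is imposed separately because a trivial walk in `within` does not force its
vertex to lie in the region. -/
lemma connectedWithin_subset_crossV (L : ℝ) :
    connectedWithin G (rect (reC pos) (imC pos) 0 0 L) (fun x y =>
      x ∈ rect (reC pos) (imC pos) 0 0 L ∧ (pos x).im = 0 ∧ (pos y).im = L) ⊆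
      crossV G pos (2 * L) L := by
  rintro ω ⟨x, y, ⟨hxR, hx, hy⟩, hr⟩
  obtain ⟨w, hw⟩ := exists_walk_of_reachable_within hxR hr
  refine ⟨x, y, hx, hy, w, fun z hz => ?_⟩
  obtain ⟨⟨h1, h2⟩, h3, h4⟩ := hw z hz
  exact ⟨⟨h1, h2.trans_eq (zero_add _)⟩, h3, h4.trans_eq (zero_add _)⟩

open Classical in
/-- Up to a constant, a crossing up to a margin has the same probability as a crossing. -/
theorem exists_weakCross_le (hG : IsPlanarLattice G pos) (haxis : ∃ x, (pos x).im = 0)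
    {p q : ℝ} (hp0 : 0 < p) (hp1 : p < 1) (hq : 1 ≤ q) {j : ℕ} (hj : 1 ≤ j) :
    ∃ C : ℝ, 0 < C ∧ ∃ L₀ : ℕ, ∀ L : ℕ, L₀ ≤ L → ∀ φ : Measure (Config G),
      IsInfiniteVolume G p q φ →
      φ.real (weakCross G (reC pos) (imC pos) 0 0 L j) ≤ C * φ.real (crossV G pos (2 * L) L) := by
  have hcount := hG.countable
  obtain ⟨ℓ, hℓ1, hℓ⟩ := exists_edge_bound hG
  obtain ⟨D, hD⟩ := exists_corridor hG haxis hj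
  have hq0 : 0 < q := by linarith
  -- At most `D` edges are opened in each corridor, and two more join the corridors to the band
  -- between them. The threshold on `L` makes the band wider than any edge.
  refine ⟨(2 * (q ^ 2 / p)) ^ (2 * D + 2), by positivity, 2 * j + ℓ + 1, fun L hL φ hφ => ?_⟩
  have hprob := hφ.isProbabilityMeasure
  have hLr : (2 * j + ℓ + 1 : ℝ) ≤ L := by exact_mod_cast hL
  have hj0 : (0 : ℝ) ≤ j := Nat.cast_nonneg j
  have hℓ0 : (0 : ℝ) ≤ ℓ := Nat.cast_nonneg ℓ
  set R := rect (reC pos) (imC pos) 0 0 (L : ℝ) with hR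
  set bot := corridorBox pos (2 * L : ℕ) (0 : ℤ) j with hbot
  set top := corridorBox pos (2 * L : ℕ) ((L : ℤ) - j : ℤ) j with htop
  have hbotR : bot ⊆ R := by
    rintro z ⟨⟨h1, h2⟩, h3, h4⟩
    push_cast at h2 h3 h4
    refine ⟨⟨h1, ?_⟩, h3, ?_⟩ <;> simp only [reC, imC] <;> linarith
  have htopR : top ⊆ R := by
    rintro z ⟨⟨h1, h2⟩, h3, h4⟩
    push_cast at h2 h3 h4
    refine ⟨⟨h1, ?_⟩, ?_, ?_⟩ <;> simp only [reC, imC] <;> linarith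
  have hRbot : ∀ z ∈ R, (pos z).im ≤ j → z ∈ bot := by
    rintro z ⟨⟨h1, h2⟩, h3, h4⟩ hz
    simp only [reC, imC] at h1 h2 h3 h4
    refine ⟨⟨h1, ?_⟩, ?_, ?_⟩ <;> push_cast <;> linarith
  have hRtop : ∀ z ∈ R, (L : ℝ) - j ≤ (pos z).im → z ∈ top := by
    rintro z ⟨⟨h1, h2⟩, h3, h4⟩ hz
    simp only [reC, imC] at h1 h2 h3 h4
    refine ⟨⟨h1, ?_⟩, ?_, ?_⟩ <;> push_cast <;> linarith
  have hRfin : R.Finite := hG.finite_of_box 0 (2 * L) 0 L fun x hx => by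
    obtain ⟨⟨h1, h2⟩, h3, h4⟩ := hx
    simp only [reC, imC] at h1 h2 h3 h4
    refine ⟨⟨h1, ?_⟩, h3, ?_⟩ <;> linarith
  set E : Finset G.edgeSet := (finite_edgesIn (G := G) hRfin).toFinset with hE
  have hEcoe : (E : Set G.edgeSet) = edgesIn G R := by simp [hE]
  have hmemE : ∀ e, e ∈ E ↔ e ∈ edgesIn G R := fun e => by simp [hE]
  set A := connectedWithin G R (fun x y => x ∈ R ∧ (pos x).im = 0 ∧ (pos y).im = L) with hA
  set band : Set V := {w | w ∈ R ∧ (j : ℝ) < (pos w).im ∧ (pos w).im < L - j} with hband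
  -- The edges leading from `z` to the side are chosen once and for all, with the empty set as
  -- default off the corridor; they do not depend on the configuration.
  have hcorB : ∀ z, ∃ F : Finset G.edgeSet, z ∈ bot → F.card ≤ D ∧ (∀ e ∈ F, e ∈ edgesIn G bot) ∧
      ∃ x ∈ bot, (pos x).im = 0 ∧ ∀ ω : Config G, (∀ e ∈ F, ω e = true) →
        (within (openGraph G ω) bot).Reachable z x := by
    intro z
    by_cases hz : z ∈ bot
    · obtain ⟨F, f1, f2, x, hx, hx0, f3⟩ := hD (2 * L) 0 0 (by omega) (Or.inl rfl) z hz
      exact ⟨F, fun _ => ⟨f1, f2, x, hx, by simpa using hx0, f3⟩⟩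
    · exact ⟨∅, fun h => absurd h hz⟩
  have hcorT : ∀ z, ∃ F : Finset G.edgeSet, z ∈ top → F.card ≤ D ∧ (∀ e ∈ F, e ∈ edgesIn G top) ∧
      ∃ x ∈ top, (pos x).im = L ∧ ∀ ω : Config G, (∀ e ∈ F, ω e = true) →
        (within (openGraph G ω) top).Reachable z x := by
    intro z
    by_cases hz : z ∈ top
    · obtain ⟨F, f1, f2, x, hx, hxL, f3⟩ :=
        hD (2 * L) ((L : ℤ) - j) L (by omega) (Or.inr (by ring)) z hz
      exact ⟨F, fun _ => ⟨f1, f2, x, hx, by simpa using hxL, f3⟩⟩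
    · exact ⟨∅, fun h => absurd h hz⟩
  choose Fb hFb using hcorB
  choose Ft hFt using hcorT
  -- the data of a crossing of the band, with edges leading to the two corridors
  let good : V × V × V × V → Config G → Prop := fun t ω =>
    G.Adj t.1 t.2.1 ∧ t.1 ∈ R ∧ (pos t.1).im ≤ j ∧ t.2.1 ∈ R ∧ G.Adj t.2.2.1 t.2.2.2 ∧
      t.2.2.2 ∈ R ∧ (L : ℝ) - j ≤ (pos t.2.2.2).im ∧ t.2.2.1 ∈ R ∧
      (within (openGraph G ω) band).Reachable t.2.1 t.2.2.1
  let edges : V × V × V × V → Finset E := fun t => Finset.univ.filter fun e : E =>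
    (e : Sym2 V) = s(t.1, t.2.1) ∨ (e : Sym2 V) = s(t.2.2.1, t.2.2.2) ∨
      (e : G.edgeSet) ∈ Fb t.1 ∨ (e : G.edgeSet) ∈ Ft t.2.2.2
  -- The opened set depends on the configuration only through the predicate `good`, that is, through
  -- the open edges inside the band.
  let pick : (V × V × V × V → Prop) → Finset E := fun P =>
    if h : ∃ t, P t then edges h.choose else ∅
  let F : (E → Bool) → Finset E := fun η => pick fun t => good t (extend G E η)
  have hgoodb : ∀ t ω, good t ω → t.1 ∈ bot := fun t ω h => hRbot _ h.2.1 h.2.2.1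
  have hgoodt : ∀ t ω, good t ω → t.2.2.2 ∈ top := fun t ω h =>
    hRtop _ h.2.2.2.2.2.1 h.2.2.2.2.2.2.1
  have hedges_card : ∀ t ω, good t ω → (edges t).card ≤ 2 * D + 2 := by
    intro t ω ht
    have h1 : ((edges t).map (Function.Embedding.subtype _)).map (Function.Embedding.subtype _) ⊆
        ({s(t.1, t.2.1), s(t.2.2.1, t.2.2.2)} : Finset (Sym2 V)) ∪
          ((Fb t.1).map (Function.Embedding.subtype _) ∪
            (Ft t.2.2.2).map (Function.Embedding.subtype _)) := by
      intro e he
      simp only [Finset.mem_map, Function.Embedding.subtype_apply] at he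
      obtain ⟨e', ⟨e'', he'', rfl⟩, rfl⟩ := he
      have := (Finset.mem_filter.1 he'').2
      simp only [Finset.mem_union, Finset.mem_insert, Finset.mem_singleton, Finset.mem_map,
        Function.Embedding.subtype_apply]
      rcases this with h | h | h | h
      · exact Or.inl (Or.inl h)
      · exact Or.inl (Or.inr h)
      · exact Or.inr (Or.inl ⟨_, h, rfl⟩)
      · exact Or.inr (Or.inr ⟨_, h, rfl⟩)
    have h2 := Finset.card_le_card h1
    rw [Finset.card_map, Finset.card_map] at h2
    have h3 := Finset.card_union_le ({s(t.1, t.2.1), s(t.2.2.1, t.2.2.2)} : Finset (Sym2 V))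
      ((Fb t.1).map (Function.Embedding.subtype _) ∪
            (Ft t.2.2.2).map (Function.Embedding.subtype _))
    have h4 := Finset.card_union_le ((Fb t.1).map (Function.Embedding.subtype _))
            ((Ft t.2.2.2).map (Function.Embedding.subtype _))
    rw [Finset.card_map, Finset.card_map] at h4
    have h5 := Finset.card_le_two (a := s(t.1, t.2.1)) (b := s(t.2.2.1, t.2.2.2))
    have h6 := (hFb t.1 (hgoodb t ω ht)).1
    have h7 := (hFt t.2.2.2 (hgoodt t ω ht)).1
    omega
  -- Every opened edge has an end-point outside the band, so opening does not change `good` and the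
  -- set can be read off the result.
  have hedges_band : ∀ t ω, good t ω → ∀ e ∈ edges t, (e : G.edgeSet) ∉ edgesIn G band := by
    intro t ω ht e he hb
    have hne : ∃ x, x ∈ (e : Sym2 V) ∧ x ∉ band := by
      rcases (Finset.mem_filter.1 he).2 with h | h | h | h
      · exact ⟨t.1, by rw [h]; simp, fun hx => not_lt.2 ht.2.2.1 hx.2.1⟩
      · exact ⟨t.2.2.2, by rw [h]; simp, fun hx => not_lt.2 ht.2.2.2.2.2.2.1 hx.2.2⟩
      · have h1 := (hFb t.1 (hgoodb t ω ht)).2.1 _ h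
        refine ⟨_, Sym2.out_fst_mem _, fun hx => ?_⟩
        have h2 := (h1 _ (Sym2.out_fst_mem _)).2.2
        push_cast at h2
        linarith [hx.2.1]
      · have h1 := (hFt t.2.2.2 (hgoodt t ω ht)).2.1 _ h
        refine ⟨_, Sym2.out_fst_mem _, fun hx => ?_⟩
        have h2 := (h1 _ (Sym2.out_fst_mem _)).2.1
        push_cast at h2
        linarith [hx.2.2]
    obtain ⟨x, hx, hxb⟩ := hne
    exact hxb (hb x hx)
  set U := weakCross G (reC pos) (imC pos) 0 0 (L : ℝ) j with hU
  have hUgood : ∀ ω ∈ U, ∃ t, good t ω := by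
    rintro ω ⟨x, y, ⟨hx, hy⟩, hr⟩
    obtain ⟨z, x', y', z', hz, hzα, hz', hzβ, hx', hy', hr'⟩ :=
      exists_reachable_within_strip (imC pos) (α := j) (β := L - j) (fun a b hab ha => by
        have := abs_le.1 (hℓ a b (openGraph_le ω hab.1)).2
        simp only [imC] at ha ⊢
        linarith) hr (by linarith) (by linarith) (by linarith)
    refine ⟨(z, x', y', z'), openGraph_le ω hz.1, hz.2.1, hzα, hz.2.2, openGraph_le ω hz'.1,
      hz'.2.2, hzβ, hz'.2.1, hr'.mono ?_⟩
    rintro a b ⟨⟨hab, ha, hb⟩, ha', hb'⟩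
    exact ⟨hab, ⟨ha, ha'⟩, ⟨hb, hb'⟩⟩
  have hFη : ∀ η, extend G E η ∈ U → ∃ t, good t (extend G E η) ∧ F η = edges t := by
    intro η hη
    have h := hUgood _ hη
    exact ⟨h.choose, h.choose_spec, dif_pos h⟩
  have hmain := hφ.measureReal_le_mul hp0.le hp1 hq (U := U) (A := A) (E := E)
    (by rw [hEcoe]; exact determinedBy_connectedWithin _ _)
    (by rw [hEcoe]; exact determinedBy_connectedWithin _ _)
    (C := (2 * (q ^ 2 / p)) ^ (2 * D + 2)) (fun ξ =>
      ev_ind_le_of_openOn hp0 hp1 hq ξ (2 * D + 2) F ?_ ?_ ?_)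
  · refine hmain.trans (mul_le_mul_of_nonneg_left ?_ (by positivity))
    exact measureReal_mono (connectedWithin_subset_crossV _)
  · intro η hη
    obtain ⟨t, ht, hF⟩ := hFη η hη
    rw [hF]
    exact hedges_card t _ ht
  · intro η hη
    obtain ⟨t, ht, hF⟩ := hFη η hη
    rw [hF]
    set ω' := extend G E (openOn (edges t) η) with hω'
    have hle : extend G E η ≤ ω' := extend_mono E fun e => by
      by_cases he : e ∈ edges t <;> simp [openOn, he]
    have hopen : ∀ e : G.edgeSet, (hE' : e ∈ E) → (⟨e, hE'⟩ : E) ∈ edges t → ω' e = true := by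
      intro e hE' he
      rw [hω', extend_of_mem _ hE', openOn, if_pos he]
    obtain ⟨-, b2, x, hxb, hx0, b3⟩ := hFb t.1 (hgoodb t _ ht)
    obtain ⟨-, t2, y, hyt, hyL, t3⟩ := hFt t.2.2.2 (hgoodt t _ ht)
    obtain ⟨g1, g2, g3, g4, g5, g6, g7, g8, g9⟩ := ht
    refine ⟨x, y, ⟨hbotR hxb, hx0, hyL⟩, ?_⟩
    have r1 : (within (openGraph G ω') R).Reachable t.1 x := by
      refine (b3 ω' fun e he => ?_).mono (within_mono le_rfl hbotR)
      have heE : e ∈ E := (hmemE e).2 fun z hz => hbotR (b2 e he z hz)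
      exact hopen e heE (Finset.mem_filter.2 ⟨Finset.mem_univ _, Or.inr (Or.inr (Or.inl he))⟩)
    have r5 : (within (openGraph G ω') R).Reachable t.2.2.2 y := by
      refine (t3 ω' fun e he => ?_).mono (within_mono le_rfl htopR)
      have heE : e ∈ E := (hmemE e).2 fun z hz => htopR (t2 e he z hz)
      exact hopen e heE (Finset.mem_filter.2 ⟨Finset.mem_univ _, Or.inr (Or.inr (Or.inr he))⟩)
    have hpair : ∀ (a b : V) (hab : G.Adj a b), a ∈ R → b ∈ R →
        (⟨s(a, b), hab⟩ : G.edgeSet) ∈ E := by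
      intro a b hab ha hb
      rw [hmemE]
      intro z hz
      simp only [Sym2.mem_iff] at hz
      rcases hz with rfl | rfl
      · exact ha
      · exact hb
    have r2 : (within (openGraph G ω') R).Adj t.1 t.2.1 :=
      ⟨⟨g1, hopen _ (hpair _ _ g1 g2 g4)
        (Finset.mem_filter.2 ⟨Finset.mem_univ _, Or.inl rfl⟩)⟩, g2, g4⟩
    have r4 : (within (openGraph G ω') R).Adj t.2.2.1 t.2.2.2 :=
      ⟨⟨g5, hopen _ (hpair _ _ g5 g8 g6)
        (Finset.mem_filter.2 ⟨Finset.mem_univ _, Or.inr (Or.inl rfl)⟩)⟩, g8, g6⟩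
    have r3 : (within (openGraph G ω') R).Reachable t.2.1 t.2.2.1 :=
      g9.mono (within_mono (openGraph_mono hle) fun z hz => hz.1)
    exact r1.symm.trans (r2.reachable.trans (r3.trans (r4.reachable.trans r5)))
  · intro η hη
    obtain ⟨t, ht, hF⟩ := hFη η hη
    rw [hF]
    have hagree : ∀ e ∈ edgesIn G band,
        extend G E (openOn (edges t) η) e = extend G E η e := by
      intro e he
      by_cases heE : e ∈ E
      · rw [extend_of_mem _ heE, extend_of_mem _ heE, openOn, if_neg]
        exact fun h => hedges_band t _ ht _ h he
      · rw [extend_of_notMem _ heE, extend_of_notMem _ heE]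
    have hpred : (fun t' => good t' (extend G E (openOn (edges t) η))) =
        fun t' => good t' (extend G E η) := by
      funext t'
      have e1 := within_openGraph_congr hagree
      have e2 := within_openGraph_congr fun e he => (hagree e he).symm
      simp only [good, le_antisymm e1 e2]
    rw [← hF]
    change pick _ = pick _
    rw [hF, hpred]

/-! ### Concentric annuli around cells. -/

section Annuli

/-- The signed sup-distance of a vertex to the cell of side `R` with index `c`. -/
noncomputable def cellDist (pos : V → ℂ) (R : ℝ) (c : ℤ × ℤ) (z : V) : ℝ :=
  max (max (c.1 * R - (pos z).re) ((pos z).re - (c.1 + 1) * R))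
    (max (c.2 * R - (pos z).im) ((pos z).im - (c.2 + 1) * R))

lemma cellDist_le_iff {R : ℝ} {c : ℤ × ℤ} {z : V} {r : ℝ} : cellDist pos R c z ≤ r ↔
    (c.1 * R - r ≤ (pos z).re ∧ (pos z).re ≤ (c.1 + 1) * R + r) ∧
      c.2 * R - r ≤ (pos z).im ∧ (pos z).im ≤ (c.2 + 1) * R + r := by
  simp only [cellDist, max_le_iff]
  constructor
  · rintro ⟨⟨h1, h2⟩, h3, h4⟩
    refine ⟨⟨?_, ?_⟩, ?_, ?_⟩ <;> linarith
  · rintro ⟨⟨h1, h2⟩, h3, h4⟩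
    refine ⟨⟨?_, ?_⟩, ?_, ?_⟩ <;> linarith

lemma cellDist_le_add {R r : ℝ} {c : ℤ × ℤ} {x y : V} (h1 : |(pos x).re - (pos y).re| ≤ r)
    (h2 : |(pos x).im - (pos y).im| ≤ r) : cellDist pos R c y ≤ cellDist pos R c x + r := by
  rw [abs_le] at h1 h2
  have := cellDist_le_iff.1 (le_refl (cellDist pos R c x))
  refine cellDist_le_iff.2 ⟨⟨?_, ?_⟩, ?_, ?_⟩ <;> linarith [this.1.1, this.1.2, this.2.1, this.2.2]

/-- The index of the cell of side `R` that contains a vertex. -/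
noncomputable def cell (pos : V → ℂ) (R : ℝ) (z : V) : ℤ × ℤ :=
  (⌊(pos z).re / R⌋, ⌊(pos z).im / R⌋)

lemma floor_div_mul_le {R : ℝ} (hR : 0 < R) (t : ℝ) : ⌊t / R⌋ * R ≤ t := by
  have := Int.floor_le (t / R)
  rwa [le_div_iff₀ hR] at this

lemma lt_floor_div_add_one_mul {R : ℝ} (hR : 0 < R) (t : ℝ) : t < (⌊t / R⌋ + 1) * R := by
  have := Int.lt_floor_add_one (t / R)
  rwa [div_lt_iff₀ hR] at this

lemma abs_sub_floor_div_le {R t : ℝ} (hR : 0 < R) {k : ℤ} (h1 : k * R - R < t)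
    (h2 : t < (k + 1) * R + R) : |k - ⌊t / R⌋| ≤ 1 := by
  have h3 := floor_div_mul_le hR t
  have h4 := lt_floor_div_add_one_mul hR t
  have h5 : (k : ℝ) < ⌊t / R⌋ + 2 := lt_of_mul_lt_mul_right (by linarith) hR.le
  have h6 : (⌊t / R⌋ : ℝ) < k + 2 := lt_of_mul_lt_mul_right (by linarith) hR.le
  have h5' : k < ⌊t / R⌋ + 2 := by exact_mod_cast h5
  have h6' : ⌊t / R⌋ < k + 2 := by exact_mod_cast h6
  rw [abs_le]
  omega

lemma cellDist_cell_nonpos {R : ℝ} (hR : 0 < R) (z : V) : cellDist pos R (cell pos R z) z ≤ 0 := by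
  rw [cellDist_le_iff]
  simp only [cell, sub_zero, add_zero]
  exact ⟨⟨floor_div_mul_le hR _, (lt_floor_div_add_one_mul hR _).le⟩, floor_div_mul_le hR _,
    (lt_floor_div_add_one_mul hR _).le⟩

lemma abs_sub_cell_le {R : ℝ} (hR : 0 < R) {c : ℤ × ℤ} {z : V} (h : cellDist pos R c z < R) :
    |c.1 - (cell pos R z).1| ≤ 1 ∧ |c.2 - (cell pos R z).2| ≤ 1 := by
  simp only [cellDist, max_lt_iff] at h
  obtain ⟨⟨h1, h2⟩, h3, h4⟩ := h
  exact ⟨abs_sub_floor_div_le hR (by linarith) (by linarith),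
    abs_sub_floor_div_le hR (by linarith) (by linarith)⟩

/-- The `i`-th annulus of width `W` around the cell `c`. -/
def annulus (pos : V → ℂ) (R W : ℝ) (c : ℤ × ℤ) (i : ℕ) : Set V :=
  {z | i * W < cellDist pos R c z ∧ cellDist pos R c z < (i + 1) * W}

/-- The event that an annulus is crossed, up to a margin `ℓ`. -/
def annulusCross (G : SimpleGraph V) (pos : V → ℂ) (R W ℓ : ℝ) (c : ℤ × ℤ) (i : ℕ) :
    Set (Config G) :=
  connectedWithin G (annulus pos R W c i) fun x y =>
    cellDist pos R c x ≤ i * W + ℓ ∧ (i + 1) * W - ℓ ≤ cellDist pos R c y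

lemma annulusCross_of_reachable {ω : Config G} {R W ℓ : ℝ} (hℓ : 0 ≤ ℓ) (hW : ℓ < W)
    (hedge : ∀ x y, G.Adj x y → |(pos x).re - (pos y).re| ≤ ℓ ∧ |(pos x).im - (pos y).im| ≤ ℓ)
    {c : ℤ × ℤ} {i : ℕ} {x y : V} (hxy : (openGraph G ω).Reachable x y)
    (hx : cellDist pos R c x ≤ 0) (hy : (i + 1) * W ≤ cellDist pos R c y) :
    ω ∈ annulusCross G pos R W ℓ c i := by
  have hlip : ∀ a b, (openGraph G ω).Adj a b → cellDist pos R c b ≤ cellDist pos R c a + ℓ :=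
    fun a b hab => cellDist_le_add (hedge a b hab.1).1 (hedge a b hab.1).2
  have hi : (0 : ℝ) ≤ i * W := mul_nonneg (Nat.cast_nonneg i) (by linarith)
  obtain ⟨z, x', y', z', hz, hzα, hz', hzβ, -, -, hr⟩ :=
    exists_reachable_within_strip (cellDist pos R c) (α := i * W) (β := (i + 1) * W)
      (fun a b hab ha => by linarith [hlip a b hab]) hxy (by linarith) (by linarith) hy
  exact ⟨x', y', ⟨by linarith [hlip _ _ hz], by linarith [hlip _ _ hz']⟩, hr⟩

lemma finite_annulus (hG : IsPlanarLattice G pos) (R W : ℝ) (c : ℤ × ℤ) (i : ℕ) :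
    (annulus pos R W c i).Finite :=
  hG.finite_of_box _ _ _ _ fun _ hz => cellDist_le_iff.1 hz.2.le

/-- Since `K * W ≤ R`, an annulus that contains an end-point of `e` surrounds one of the 9 cells at
or next to the cell of that end-point, and annuli around the same cell are disjoint. The bound 9
does not depend on `K`. -/
lemma ncard_annuli_le {R W : ℝ} (hR : 0 < R) (hW : 0 < W) {K : ℕ} (hK : K * W ≤ R)
    (Γ : Finset (ℤ × ℤ)) (e : G.edgeSet) :
    {t | t ∈ Γ ×ˢ Finset.range K ∧ e ∈ edgesIn G (annulus pos R W t.1 t.2)}.ncard ≤ 9 := by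
  set x := (e : Sym2 V).out.1
  set c₀ := cell pos R x with hc₀
  have hx : ∀ t : (ℤ × ℤ) × ℕ, e ∈ edgesIn G (annulus pos R W t.1 t.2) →
      x ∈ annulus pos R W t.1 t.2 := fun t ht => ht x (Sym2.out_fst_mem _)
  set S : Finset (ℤ × ℤ) := Finset.Icc (c₀.1 - 1) (c₀.1 + 1) ×ˢ Finset.Icc (c₀.2 - 1) (c₀.2 + 1)
    with hS
  have hcard : (S : Set (ℤ × ℤ)).ncard = 9 := by
    rw [Set.ncard_coe_finset, hS, Finset.card_product, Int.card_Icc, Int.card_Icc]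
    have h1 : (c₀.1 + 1 + 1 - (c₀.1 - 1)).toNat = 3 := by omega
    have h2 : (c₀.2 + 1 + 1 - (c₀.2 - 1)).toNat = 3 := by omega
    rw [h1, h2]
  rw [← hcard]
  refine Set.ncard_le_ncard_of_injOn Prod.fst ?_ ?_ S.finite_toSet
  · rintro ⟨c, i⟩ ⟨hmem, he⟩
    have hxi := hx _ he
    rw [Finset.mem_product, Finset.mem_range] at hmem
    have hi : ((i : ℝ) + 1) * W ≤ K * W :=
      mul_le_mul_of_nonneg_right (by exact_mod_cast hmem.2) hW.le
    obtain ⟨h1, h2⟩ := abs_sub_cell_le hR (hxi.2.trans_le (hi.trans hK))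
    rw [abs_le] at h1 h2
    simp only [hS, Finset.coe_product, Set.mem_prod, Finset.mem_coe, Finset.mem_Icc, hc₀]
    simp only at h1 h2
    omega
  · rintro ⟨c, i⟩ ⟨-, he⟩ ⟨c', i'⟩ ⟨-, he'⟩ h
    simp only at h
    subst h
    have h1 := hx _ he
    have h2 := hx _ he'
    have a1 : (i : ℝ) < i' + 1 := lt_of_mul_lt_mul_right (h1.1.trans h2.2) hW.le
    have a2 : (i' : ℝ) < i + 1 := lt_of_mul_lt_mul_right (h2.1.trans h1.2) hW.le
    have a1' : i < i' + 1 := by exact_mod_cast a1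
    have a2' : i' < i + 1 := by exact_mod_cast a2
    have : i = i' := by omega
    rw [this]

/-- The event that all the annuli around the cells of `Γ` are crossed. -/
def chainCross (G : SimpleGraph V) (pos : V → ℂ) (R W ℓ : ℝ) (K : ℕ) (Γ : Finset (ℤ × ℤ)) :
    Set (Config G) :=
  {ω | ∀ c ∈ Γ, ∀ i < K, ω ∈ annulusCross G pos R W ℓ c i}

lemma isUpperSet_chainCross (R W ℓ : ℝ) (K : ℕ) (Γ : Finset (ℤ × ℤ)) :
    IsUpperSet (chainCross G pos R W ℓ K Γ) :=
  fun _ _ h hω c hc i hi => isUpperSet_connectedWithin _ _ h (hω c hc i hi)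

lemma exists_determinedBy_chainCross (hG : IsPlanarLattice G pos) (R W ℓ : ℝ) (K : ℕ)
    (Γ : Finset (ℤ × ℤ)) : ∃ S : Finset G.edgeSet,
      DeterminedBy (chainCross G pos R W ℓ K Γ) (S : Set G.edgeSet) := by
  have hfin : (⋃ t ∈ Γ ×ˢ Finset.range K, edgesIn G (annulus pos R W t.1 t.2)).Finite :=
    (Γ ×ˢ Finset.range K).finite_toSet.biUnion fun t _ =>
      finite_edgesIn (finite_annulus hG R W t.1 t.2)
  refine ⟨hfin.toFinset, fun ω ω' h hω c hc i hi =>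
    determinedBy_connectedWithin _ _ ω ω' (fun e he => h e ?_) (hω c hc i hi)⟩
  rw [Set.Finite.coe_toFinset]
  exact Set.mem_biUnion (x := (c, i))
    (Finset.mem_coe.2 (Finset.mem_product.2 ⟨hc, Finset.mem_range.2 hi⟩)) he

/-- Exponential decay, in the number of cells, of the probability that all annuli are crossed. -/
theorem ev_chainCross_le {p p' q δ : ℝ} (hp0 : 0 ≤ p) (hp1 : p < 1) (hp'0 : 0 ≤ p')
    (hp'1 : p' < 1) (hq : 1 ≤ q) (hδ0 : 0 ≤ δ)
    (hδ : p * Real.exp (δ * (9 : ℕ)) * (1 - p') ≤ (1 - p) * p') {R W ℓ : ℝ} (hR : 0 < R)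
    (hW : 0 < W) {K : ℕ} (hK : K * W ≤ R) (Γ : Finset (ℤ × ℤ)) (E : Finset G.edgeSet)
    (hE : ∀ c, ∀ i < K, ev G p' q E ⊥ (ind (annulusCross G pos R W ℓ c i)) ≤ 1 / 2) :
    ev G p q E ⊥ (ind (chainCross G pos R W ℓ K Γ)) ≤ Real.exp (-(δ * K / 2 * Γ.card)) := by
  set T := Γ ×ˢ Finset.range K with hT
  have hTcard : (T.card : ℝ) = Γ.card * K := by
    rw [hT, Finset.card_product, Finset.card_range]; push_cast; ring
  set X : (ℤ × ℤ) × ℕ → Set (Config G) := fun t => annulusCross G pos R W ℓ t.1 t.2 with hX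
  set f : Config G → ℝ := fun ω => ∑ t ∈ T, ind (X t) ω with hf
  have hf0 : ∀ ω, 0 ≤ f ω := fun ω => Finset.sum_nonneg fun v _ => ind_nonneg _ _
  have hfm : Monotone f := fun ω ω' h => Finset.sum_le_sum fun t _ =>
    ind_mono (isUpperSet_connectedWithin _ _) h
  have h1 := ev_exp_le (E := E) hp0 hp1 hp'0 hp'1 hq ⊥ hδ0 hδ hf0 hfm fun η η' h =>
    sum_ind_extend_le T (X := X) (S := fun t => edgesIn G (annulus pos R W t.1 t.2))
      (fun t _ => determinedBy_connectedWithin _ _) (ncard_annuli_le hR hW hK Γ) h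
  have h2 : ev G p' q E ⊥ f ≤ Γ.card * K * (1 / 2) := by
    rw [hf, ev_sum, ← hTcard, ← nsmul_eq_mul]
    refine Finset.sum_le_card_nsmul _ _ _ fun t ht => hE _ _ ?_
    exact Finset.mem_range.1 (Finset.mem_product.1 ht).2
  -- Markov's inequality: on the event, the number of crossed annuli is maximal, twice the bound on
  -- its mean.
  have h3 : ∀ ω, Real.exp (δ * (Γ.card * K)) * ind (chainCross G pos R W ℓ K Γ) ω ≤
      Real.exp (δ * f ω) := by
    intro ω
    by_cases hω : ω ∈ chainCross G pos R W ℓ K Γ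
    · have : f ω = Γ.card * K := by
        rw [← hTcard, hf]
        simp only
        rw [Finset.sum_congr rfl (g := fun _ => (1 : ℝ)), Finset.sum_const, nsmul_eq_mul, mul_one]
        intro t ht
        obtain ⟨hc, hi⟩ := Finset.mem_product.1 ht
        exact Set.indicator_of_mem (hω t.1 hc t.2 (Finset.mem_range.1 hi)) _
      rw [this, ind, Set.indicator_of_mem hω, mul_one]
    · rw [ind, Set.indicator_of_notMem hω, mul_zero]
      exact (Real.exp_pos _).le
  have h4 := ev_mono (E := E) hp0 hp1 hq ⊥ h3
  rw [ev_const_mul] at h4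
  have h5 : Real.exp (δ * (Γ.card * K)) * ev G p q E ⊥ (ind (chainCross G pos R W ℓ K Γ)) ≤
      Real.exp (δ * (Γ.card * K * (1 / 2))) :=
    h4.trans (h1.trans (Real.exp_le_exp.2 (mul_le_mul_of_nonneg_left h2 hδ0)))
  rw [← le_div_iff₀' (Real.exp_pos _), ← Real.exp_sub] at h5
  refine h5.trans (le_of_eq ?_)
  congr 1
  ring

end Annuli

/-! ### Annulus crossings are unlikely under free measures. -/

section CrossingProbability

/-- The rectangle is moved to the reference one by a translation, after an exchange of coordinates
if needed. Symmetry is applied to the free measure, with its volume moved along; `φ` itself need not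
be invariant. -/
lemma ev_bot_weakCross_le (hG : IsPlanarLattice G pos) {p q : ℝ} (hp0 : 0 ≤ p) (hp1 : p < 1)
    (hq : 1 ≤ q) {φ : Measure (Config G)} (hφ : IsInfiniteVolume G p q φ) (E : Finset G.edgeSet)
    (L : ℕ) (j : ℝ) (m n : ℤ) :
    ev G p q E ⊥ (ind (weakCross G (reC pos) (imC pos) (m * L) (n * L) L j)) ≤
        φ.real (weakCross G (reC pos) (imC pos) 0 0 L j) ∧
      ev G p q E ⊥ (ind (weakCross G (imC pos) (reC pos) (n * L) (m * L) L j)) ≤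
        φ.real (weakCross G (reC pos) (imC pos) 0 0 L j) := by
  have hcount := hG.countable
  set A := weakCross G (reC pos) (imC pos) 0 0 (L : ℝ) j with hA
  have key : ∀ (σ : G ≃g G) (A' : Set (Config G)), (∀ ω ∈ A', pull σ ω ∈ A) →
      ev G p q E ⊥ (ind A') ≤ φ.real A := by
    intro σ A' h
    calc ev G p q E ⊥ (ind A') ≤ ev G p q E ⊥ (fun ω => ind A (pull σ ω)) := by
          refine ev_mono hp0 hp1 hq ⊥ fun ω => ?_
          by_cases hω : ω ∈ A'
          · rw [ind, Set.indicator_of_mem hω, ind, Set.indicator_of_mem (h ω hω)]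
          · rw [ind, Set.indicator_of_notMem hω]
            exact ind_nonneg _ _
      _ = ev G p q (mapEdges σ.symm E) ⊥ (ind A) := ev_bot_pull p q σ E _
      _ ≤ φ.real A := hφ.ev_bot_le_measureReal hp0 hp1 hq (isUpperSet_connectedWithin _ _)
  set τ := hG.translate (m * L, n * L) with hτ
  have hre : ∀ x, (pos (τ x)).re = (pos x).re + m * L := fun x => by
    rw [hτ, hG.re_translate]; push_cast; ring
  have him : ∀ x, (pos (τ x)).im = (pos x).im + n * L := fun x => by
    rw [hτ, hG.im_translate]; push_cast; ring
  constructor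
  · refine key τ _ fun ω hω => pull_mem_connectedWithin τ ?_ ?_ hω
    · rintro x ⟨⟨h1, h2⟩, h3, h4⟩
      simp only [reC, imC, hre, him] at h1 h2 h3 h4
      refine ⟨⟨?_, ?_⟩, ?_, ?_⟩ <;> simp only [reC, imC] <;> linarith
    · rintro x y ⟨h1, h2⟩
      simp only [imC, him] at h1 h2
      constructor <;> simp only [imC] <;> linarith
  · obtain ⟨s, hs⟩ := hG.exists_swap
    refine key (s.trans τ) _ fun ω hω => pull_mem_connectedWithin (s.trans τ) ?_ ?_ hω
    · rintro x ⟨⟨h1, h2⟩, h3, h4⟩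
      simp only [reC, imC, RelIso.trans_apply, hre, him, (hs x).1, (hs x).2] at h1 h2 h3 h4
      refine ⟨⟨?_, ?_⟩, ?_, ?_⟩ <;> simp only [reC, imC] <;> linarith
    · rintro x y ⟨h1, h2⟩
      simp only [reC, RelIso.trans_apply, hre, (hs x).1, (hs y).1] at h1 h2
      constructor <;> simp only [imC] <;> linarith

/-- A union bound. Crossing an annulus of width `4L` requires a displacement of at least `4L - 2ℓ >
2L`, so the path leaves the block around its starting cell of side `L` and crosses one of the nearby
rectangles. -/
lemma ev_bot_annulusCross_le (hG : IsPlanarLattice G pos) {p q : ℝ} (hp0 : 0 ≤ p) (hp1 : p < 1)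
    (hq : 1 ≤ q) {φ : Measure (Config G)} (hφ : IsInfiniteVolume G p q φ) (E : Finset G.edgeSet)
    {L K : ℕ} {ℓ : ℝ} (hℓ0 : 0 < ℓ) (hL : 4 * ℓ < L)
    (hedge : ∀ x y, G.Adj x y → |(pos x).re - (pos y).re| ≤ ℓ ∧ |(pos x).im - (pos y).im| ≤ ℓ)
    (c : ℤ × ℤ) {i : ℕ} (hi : i < K) :
    ev G p q E ⊥ (ind (annulusCross G pos (4 * K * L) (4 * L) ℓ c i)) ≤
      2 * (12 * K + 3) ^ 2 * φ.real (weakCross G (reC pos) (imC pos) 0 0 L (2 * ℓ)) := by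
  have hL0 : (0 : ℝ) < L := by linarith
  set R : ℝ := 4 * K * L with hR
  set b := φ.real (weakCross G (reC pos) (imC pos) 0 0 L (2 * ℓ)) with hb
  -- Indices of cells of side `L` within distance `R = 4KL` of the cell `k`, with one more on either
  -- side: `12K + 3` of them.
  set I : ℤ → Finset ℤ := fun k => Finset.Icc (4 * K * (k - 1) - 1) (4 * K * (k + 2) + 1) with hI
  have hIcard : ∀ k, (I k).card = 12 * K + 3 := fun k => by
    have : 4 * (K : ℤ) * (k + 2) + 1 + 1 - (4 * K * (k - 1) - 1) = (12 * K + 3 : ℕ) := by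
      push_cast; ring
    simp only [hI]
    rw [Int.card_Icc, this, Int.toNat_natCast]
  set X : ℤ × ℤ → Set (Config G) := fun t =>
    weakCross G (reC pos) (imC pos) (t.1 * L) (t.2 * L) L (2 * ℓ)
  set Y : ℤ × ℤ → Set (Config G) := fun t =>
    weakCross G (imC pos) (reC pos) (t.2 * L) (t.1 * L) L (2 * ℓ)
  have hmemI : ∀ (t : ℝ) (k m : ℤ), k * R - R ≤ t → t ≤ (k + 1) * R + R → |m - ⌊t / L⌋| ≤ 1 →
      m ∈ I k := by
    intro t k m h1 h2 h3
    have h4 := floor_div_mul_le hL0 t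
    have h5 := lt_floor_div_add_one_mul hL0 t
    have h6 : (4 * K * (k - 1) : ℝ) < ⌊t / L⌋ + 1 := by
      refine lt_of_mul_lt_mul_right ?_ hL0.le
      calc (4 * K * (k - 1) : ℝ) * L = k * R - R := by rw [hR]; ring
        _ < _ := by linarith
    have h7 : (⌊t / L⌋ : ℝ) ≤ 4 * K * (k + 2) := by
      refine le_of_mul_le_mul_right ?_ hL0
      calc (⌊t / L⌋ : ℝ) * L ≤ (k + 1) * R + R := by linarith
        _ = _ := by rw [hR]; ring
    have h6' : 4 * K * (k - 1) < ⌊t / L⌋ + 1 := by exact_mod_cast h6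
    have h7' : ⌊t / L⌋ ≤ 4 * K * (k + 2) := by exact_mod_cast h7
    rw [abs_le] at h3
    simp only [hI, Finset.mem_Icc]
    constructor <;> linarith [h3.1, h3.2]
  have hcover : ∀ ω ∈ annulusCross G pos R (4 * L) ℓ c i,
      ∃ t ∈ I c.1 ×ˢ I c.2, ω ∈ X t ∨ ω ∈ Y t := by
    rintro ω ⟨x, y, ⟨hx, hy⟩, hr⟩
    have hiR : ((i : ℝ) + 1) * (4 * L) ≤ R := by
      have : ((i : ℝ) + 1) ≤ K := by exact_mod_cast hi
      calc ((i : ℝ) + 1) * (4 * L) ≤ K * (4 * L) := mul_le_mul_of_nonneg_right this (by linarith)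
        _ = R := by rw [hR]; ring
    have hxR := cellDist_le_iff.1 (show cellDist pos R c x ≤ R by linarith)
    obtain ⟨m, n, hm, hn, hmn⟩ := exists_weakCross (within_le (openGraph G ω) _) hL hℓ0
      (t := reC pos) (h := imC pos) (fun a b hab => (hedge a b hab).1)
      (fun a b hab => (hedge a b hab).2) (a := ⌊(pos x).re / L⌋) (b := ⌊(pos x).im / L⌋) hr
      ⟨floor_div_mul_le hL0 _, (lt_floor_div_add_one_mul hL0 _).le⟩
      ⟨floor_div_mul_le hL0 _, (lt_floor_div_add_one_mul hL0 _).le⟩ (by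
        rintro ⟨⟨h1, h2⟩, h3, h4⟩
        simp only [reC, imC] at h1 h2 h3 h4
        have a1 := floor_div_mul_le hL0 (pos x).re
        have a2 := lt_floor_div_add_one_mul hL0 (pos x).re
        have a3 := floor_div_mul_le hL0 (pos x).im
        have a4 := lt_floor_div_add_one_mul hL0 (pos x).im
        have := cellDist_le_add (pos := pos) (R := R) (c := c) (x := x) (y := y) (r := 2 * L)
          (abs_le.2 ⟨by linarith, by linarith⟩) (abs_le.2 ⟨by linarith, by linarith⟩)
        linarith)
    exact ⟨(m, n), Finset.mem_product.2 ⟨hmemI _ _ _ hxR.1.1 hxR.1.2 hm,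
      hmemI _ _ _ hxR.2.1 hxR.2.2 hn⟩, hmn⟩
  calc ev G p q E ⊥ (ind (annulusCross G pos R (4 * L) ℓ c i))
      ≤ ev G p q E ⊥ (fun ω => ∑ t ∈ I c.1 ×ˢ I c.2, ∑ k ∈ Finset.range 2,
          if k = 0 then ind (X t) ω else ind (Y t) ω) := by
        refine ev_mono hp0 hp1 hq ⊥ fun ω => ?_
        by_cases hω : ω ∈ annulusCross G pos R (4 * L) ℓ c i
        · obtain ⟨t, ht, h⟩ := hcover ω hω
          rw [ind, Set.indicator_of_mem hω]
          refine le_trans ?_ (Finset.single_le_sum (f := fun t => ∑ k ∈ Finset.range 2,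
            if k = 0 then ind (X t) ω else ind (Y t) ω) (fun t _ => ?_) ht)
          · simp only [Finset.sum_range_succ, Finset.sum_range_zero, zero_add, if_true,
              one_ne_zero, if_false]
            rcases h with h | h
            · rw [ind, Set.indicator_of_mem h]
              linarith [ind_nonneg (Y t) ω]
            · have : ind (Y t) ω = 1 := Set.indicator_of_mem h _
              linarith [ind_nonneg (X t) ω]
          · exact Finset.sum_nonneg fun k _ => by split_ifs <;> exact ind_nonneg _ _
        · rw [ind, Set.indicator_of_notMem hω]
          exact Finset.sum_nonneg fun t _ => Finset.sum_nonneg fun k _ => by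
            split_ifs <;> exact ind_nonneg _ _
    _ = ∑ t ∈ I c.1 ×ˢ I c.2, ∑ k ∈ Finset.range 2, ev G p q E ⊥ (fun ω =>
          if k = 0 then ind (X t) ω else ind (Y t) ω) := by
        rw [ev_sum]
        exact Finset.sum_congr rfl fun t _ => ev_sum _ _ _
    _ ≤ ∑ t ∈ I c.1 ×ˢ I c.2, ∑ k ∈ Finset.range 2, b := by
        refine Finset.sum_le_sum fun t _ => Finset.sum_le_sum fun k _ => ?_
        have := ev_bot_weakCross_le hG hp0 hp1 hq hφ E L (2 * ℓ) t.1 t.2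
        by_cases hk : k = 0
        · simp only [hk, if_true]; exact this.1
        · simp only [hk, if_false]; exact this.2
    _ = _ := by
        simp only [Finset.sum_const, Finset.card_product, hIcard, nsmul_eq_mul, Finset.card_range]
        push_cast
        ring

end CrossingProbability

/-! ### Chains of distinct cells along an open path. -/

section Chains

/-- Two cells are adjacent if they share a side or a corner. -/
def kingGraph : SimpleGraph (ℤ × ℤ) where
  Adj c c' := c ≠ c' ∧ |c.1 - c'.1| ≤ 1 ∧ |c.2 - c'.2| ≤ 1
  symm := ⟨fun _ _ h => ⟨h.1.symm, by rw [abs_sub_comm]; exact h.2.1,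
    by rw [abs_sub_comm]; exact h.2.2⟩⟩
  loopless := ⟨fun _ h => h.1 rfl⟩

lemma abs_sub_le_length {H : SimpleGraph (ℤ × ℤ)} (hH : H ≤ kingGraph) {c c' : ℤ × ℤ}
    (w : H.Walk c c') : |c.1 - c'.1| ≤ w.length ∧ |c.2 - c'.2| ≤ w.length := by
  induction w with
  | nil => simp
  | cons h w ih =>
    obtain ⟨-, h1, h2⟩ := hH h
    simp only [abs_le] at *
    rw [SimpleGraph.Walk.length_cons]
    push_cast
    omega

/-- The displacement after `i` steps. -/
def partialSum {k : ℕ} (s : Fin k → ℤ × ℤ) (i : ℕ) : ℤ × ℤ :=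
  ∑ m ∈ Finset.range i, if h : m < k then s ⟨m, h⟩ else 0

/-- The first `k` cells visited from `c` with the steps `s`. -/
noncomputable def chainCells {k : ℕ} (c : ℤ × ℤ) (s : Fin k → ℤ × ℤ) : Finset (ℤ × ℤ) :=
  (Finset.range k).image fun i => c + partialSum s i

/-- The possible steps between adjacent cells. -/
noncomputable def kingSteps : Finset (ℤ × ℤ) := Finset.Icc (-1) 1 ×ˢ Finset.Icc (-1) 1

/-- The sequences of `k` steps whose cells are distinct. -/
noncomputable def chainSteps (c : ℤ × ℤ) (k : ℕ) : Finset (Fin k → ℤ × ℤ) :=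
  (Fintype.piFinset fun _ => kingSteps).filter fun s => (chainCells c s).card = k

lemma card_chainSteps_le (c : ℤ × ℤ) (k : ℕ) : (chainSteps c k).card ≤ 9 ^ k := by
  refine (Finset.card_filter_le _ _).trans ?_
  rw [Fintype.card_piFinset]
  simp [kingSteps]

/-- A connected set of cells that contains two cells at distance at least `k` contains a chain
of `k` distinct cells. -/
lemma exists_chainSteps {S : Set (ℤ × ℤ)} {c c' : ℤ × ℤ}
    (h : (within kingGraph S).Reachable c c') {k : ℕ}
    (hk : (k : ℤ) ≤ |c.1 - c'.1| ∨ (k : ℤ) ≤ |c.2 - c'.2|) :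
    ∃ s ∈ chainSteps c k, ∀ d ∈ chainCells c s, d ∈ S := by
  classical
  -- A self-avoiding path makes the first `k` cells distinct; its length is at least `k` since each
  -- step changes a coordinate by at most 1.
  obtain ⟨w, hw⟩ := h.exists_isPath
  have hlen : k ≤ w.length := by
    obtain ⟨h1, h2⟩ := abs_sub_le_length (within_le kingGraph S) w
    rcases hk with h | h <;> omega
  set γ : ℕ → ℤ × ℤ := w.getVert with hγ
  set s : Fin k → ℤ × ℤ := fun i => γ (i + 1) - γ i with hs
  have hadj : ∀ i < k, (within kingGraph S).Adj (γ i) (γ (i + 1)) := fun i hi =>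
    w.adj_getVert_succ (hi.trans_le hlen)
  have hsum : ∀ i ≤ k, c + partialSum s i = γ i := by
    intro i hi
    have h0 : γ 0 = c := w.getVert_zero
    have h1 : partialSum s i = ∑ m ∈ Finset.range i, (γ (m + 1) - γ m) := by
      refine Finset.sum_congr rfl fun m hm => ?_
      rw [dif_pos ((Finset.mem_range.1 hm).trans_le hi)]
    rw [h1, Finset.sum_range_sub, h0, add_sub_cancel]
  have hcells : chainCells c s = (Finset.range k).image γ :=
    Finset.image_congr fun i hi => hsum i (Finset.mem_range.1 (Finset.mem_coe.1 hi)).le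
  refine ⟨s, Finset.mem_filter.2 ⟨Fintype.mem_piFinset.2 fun i => ?_, ?_⟩, fun d hd => ?_⟩
  · obtain ⟨-, h1, h2⟩ := (hadj i i.2).1
    rw [abs_le] at h1 h2
    simp only [kingSteps, Finset.mem_product, Finset.mem_Icc, hs, Prod.fst_sub, Prod.snd_sub]
    omega
  · rw [hcells, Finset.card_image_of_injOn, Finset.card_range]
    intro i hi j hj hij
    have hi' := Finset.mem_range.1 (Finset.mem_coe.1 hi)
    have hj' := Finset.mem_range.1 (Finset.mem_coe.1 hj)
    exact hw.getVert_injOn (show i ≤ w.length by omega) (show j ≤ w.length by omega) hij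
  · rw [hcells] at hd
    obtain ⟨i, hi, rfl⟩ := Finset.mem_image.1 hd
    exact (hadj i (Finset.mem_range.1 hi)).2.1

lemma reachable_cells {ω : Config G} {R ℓ : ℝ} (hR : 0 < R) (hℓR : ℓ < R)
    (hedge : ∀ x y, G.Adj x y → |(pos x).re - (pos y).re| ≤ ℓ ∧ |(pos x).im - (pos y).im| ≤ ℓ)
    {x y : V} (hxy : (openGraph G ω).Reachable x y) :
    (within kingGraph {c | ∃ z, (openGraph G ω).Reachable x z ∧ cell pos R z = c}).Reachable
      (cell pos R x) (cell pos R y) := by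
  refine (forall_reachable_of_closed (P := fun z => (openGraph G ω).Reachable x z ∧
    (within kingGraph {c | ∃ z, (openGraph G ω).Reachable x z ∧ cell pos R z = c}).Reachable
      (cell pos R x) (cell pos R z)) ?_ hxy ⟨.refl _, .refl _⟩).2
  rintro a b hab ⟨h1, h2⟩
  have hb := h1.trans hab.reachable
  refine ⟨hb, ?_⟩
  by_cases hcell : cell pos R a = cell pos R b
  · rwa [← hcell]
  · have hlip := cellDist_le_add (R := R) (c := cell pos R a) (hedge a b hab.1).1 (hedge a b hab.1).2
    have := abs_sub_cell_le hR (hlip.trans_lt (by linarith [cellDist_cell_nonpos (pos := pos) hR a]))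
    exact h2.trans (SimpleGraph.Adj.reachable ⟨⟨hcell, this⟩, ⟨a, h1, rfl⟩, ⟨b, hb, rfl⟩⟩)

/-- A connection between distant cells crosses all the annuli of a chain of distinct cells. -/
lemma exists_chainCross {ω : Config G} {W ℓ : ℝ} {K : ℕ} (hK : 1 ≤ K) (hℓ0 : 0 ≤ ℓ) (hW : ℓ < W)
    (hedge : ∀ x y, G.Adj x y → |(pos x).re - (pos y).re| ≤ ℓ ∧ |(pos x).im - (pos y).im| ≤ ℓ)
    {R : ℝ} (hKW : K * W = R) {x y : V} (hxy : (openGraph G ω).Reachable x y) {k : ℕ} (hk3 : 3 ≤ k)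
    (hk : (k : ℤ) ≤ |(cell pos R x).1 - (cell pos R y).1| ∨
      (k : ℤ) ≤ |(cell pos R x).2 - (cell pos R y).2|) :
    ∃ s ∈ chainSteps (cell pos R x) k,
      ω ∈ chainCross G pos R W ℓ K (chainCells (cell pos R x) s) := by
  have hK1 : (1 : ℝ) ≤ K := by exact_mod_cast hK
  have hWR : W ≤ R := by nlinarith
  have hR : 0 < R := by linarith
  obtain ⟨s, hs, hsS⟩ := exists_chainSteps
    (reachable_cells hR (by linarith) hedge hxy) hk
  refine ⟨s, hs, fun c hc i hi => ?_⟩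
  obtain ⟨z, hxz, rfl⟩ := hsS c hc
  -- The cells of `x` and `y` differ by at least 3 in some coordinate, so they cannot both be at or
  -- next to the cell of `z`. The path therefore leaves the `R`-neighbourhood of that cell.
  have hfar : ∃ w, (openGraph G ω).Reachable z w ∧ R ≤ cellDist pos R (cell pos R z) w := by
    by_contra hno
    push Not at hno
    obtain ⟨h1, h2⟩ := abs_sub_cell_le hR (hno x hxz.symm)
    obtain ⟨h3, h4⟩ := abs_sub_cell_le hR (hno y (hxz.symm.trans hxy))
    simp only [abs_le, le_abs] at h1 h2 h3 h4 hk
    omega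
  obtain ⟨w, hzw, hw⟩ := hfar
  refine annulusCross_of_reachable hℓ0 hW hedge hzw (cellDist_cell_nonpos hR z) (le_trans ?_ hw)
  rw [← hKW]
  exact mul_le_mul_of_nonneg_right (by exact_mod_cast hi) (by linarith)

end Chains

/-! ### Bounded distances. -/

section ShortDistances

/-- All the edges at `x` are closed with probability at least `(1 - p) ^ D` under any boundary
condition, which isolates `x`. -/
lemma measureReal_connected_le {D : ℕ} [Countable V] {p q : ℝ} (hp0 : 0 ≤ p) (hp1 : p < 1)
    (hq : 1 ≤ q) {φ : Measure (Config G)} (hφ : IsInfiniteVolume G p q φ) {x y : V} (hxy : x ≠ y)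
    (hfin : (G.neighborSet x).Finite) (hD : (G.neighborSet x).ncard ≤ D) :
    φ.real (connected G x y) ≤ 1 - (1 - p) ^ D := by
  classical
  have := hφ.isProbabilityMeasure
  have := hfin.fintype
  set E : Finset G.edgeSet := Finset.univ.image fun z : G.neighborSet x =>
    (⟨s(x, z), z.2⟩ : G.edgeSet) with hE
  have hEcard : E.card ≤ D := by
    refine (Finset.card_image_le.trans ?_).trans hD
    rw [Finset.card_univ, Set.ncard_eq_toFinset_card', Set.toFinset_card]
  set A : Set (Config G) := {ω | E.restrict ω = fun _ => false} with hA
  have hAdet : DeterminedBy A (E : Set G.edgeSet) := by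
    intro ω ω' h hω
    have : E.restrict ω = E.restrict ω' := funext fun e => h e e.2
    exact this.symm.trans hω
  have hlow : (1 - p) ^ D ≤ φ.real A := by
    refine hφ.le_measureReal hp0 hp1 hq hAdet fun ξ => ?_
    refine ((pow_le_pow_of_le_one (by linarith) (by linarith) hEcard).trans
      (le_prob_false hp0 hp1 hq ξ)).trans ?_
    rw [ev_eq_sum_prob]
    have hmem : extend G E (fun _ => false) ∈ A := by
      funext e
      exact extend_of_mem _ e.2
    refine le_trans (le_of_eq ?_) (Finset.single_le_sum
      (f := fun η => prob G p q E ξ η * ind A (extend G E η)) (fun η _ => ?_)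
      (Finset.mem_univ fun _ => false))
    · simp only [ind, Set.indicator_of_mem hmem, mul_one]
    · exact mul_nonneg (div_nonneg (weight_nonneg hp0 hp1 hq ξ η)
        (sum_weight_pos hp0 hp1 hq ξ).le) (ind_nonneg _ _)
  have hsub : connected G x y ⊆ Aᶜ := by
    rintro ω ⟨w⟩ hω
    cases w with
    | nil => exact hxy rfl
    | @cons _ b _ h _ =>
      obtain ⟨hG, ho⟩ := h
      have he : (⟨s(x, b), hG⟩ : G.edgeSet) ∈ E :=
        Finset.mem_image.2 ⟨⟨b, hG⟩, Finset.mem_univ _, rfl⟩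
      have := congrFun hω ⟨_, he⟩
      simp only [Finset.restrict] at this
      rw [ho] at this
      exact Bool.noConfusion this
  calc φ.real (connected G x y) ≤ φ.real Aᶜ := measureReal_mono hsub
    _ = 1 - φ.real A := probReal_compl_eq_one_sub (measurableSet_restrict_eq E _)
    _ ≤ _ := by linarith

end ShortDistances

lemma norm_sub_le_of_cell {R : ℝ} (hR : 0 < R) {x y : V} {k : ℕ}
    (h1 : |(cell pos R x).1 - (cell pos R y).1| ≤ k)
    (h2 : |(cell pos R x).2 - (cell pos R y).2| ≤ k) : ‖pos x - pos y‖ ≤ 2 * (k + 1) * R := by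
  have key : ∀ a b : ℝ, |⌊a / R⌋ - ⌊b / R⌋| ≤ (k : ℤ) → |a - b| ≤ (k + 1) * R := by
    intro a b h
    have a1 := floor_div_mul_le hR a
    have a2 := lt_floor_div_add_one_mul hR a
    have b1 := floor_div_mul_le hR b
    have b2 := lt_floor_div_add_one_mul hR b
    rw [abs_le] at h
    have h1 : (-k : ℝ) ≤ ⌊a / R⌋ - ⌊b / R⌋ := by exact_mod_cast h.1
    have h2 : (⌊a / R⌋ - ⌊b / R⌋ : ℝ) ≤ k := by exact_mod_cast h.2
    have h3 := mul_le_mul_of_nonneg_right h1 hR.le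
    have h4 := mul_le_mul_of_nonneg_right h2 hR.le
    rw [abs_le]
    constructor <;> linarith
  have := Complex.norm_le_abs_re_add_abs_im (pos x - pos y)
  rw [Complex.sub_re, Complex.sub_im] at this
  linarith [key _ _ h1, key _ _ h2]

end FK

/-! ### The main theorem. -/

open FK in
theorem proposition3p1 {V : Type*} (G : SimpleGraph V) (pos : V → ℂ)
    (hG : IsPlanarLattice G pos) (haxis : ∃ x, (pos x).im = 0)
    (q : ℝ) (hq : 1 ≤ q) (p₀ : ℝ) (hp₀ : p₀ ∈ Set.Ioo (0 : ℝ) 1)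
    (φ₀ : MeasureTheory.Measure (FK.Config G)) (hφ₀ : FK.IsInfiniteVolume G p₀ q φ₀)
    (hcross : Filter.liminf (fun n : ℕ => φ₀ (FK.crossV G pos (2 * n) n)) Filter.atTop = 0)
    (p : ℝ) (hp : 0 ≤ p) (hpp₀ : p < p₀) :
    ∃ c : ℝ, 0 < c ∧
      ∀ φ : MeasureTheory.Measure (FK.Config G), FK.IsInfiniteVolume G p q φ →
        ∀ x y : V, φ.real (FK.connected G x y) ≤ Real.exp (-c * ‖pos x - pos y‖) := by
  classical
  have hcount := hG.countable
  have hprob₀ := hφ₀.isProbabilityMeasure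
  obtain ⟨hp₀0, hp₀1⟩ := hp₀
  obtain ⟨p', hpp', hp'p₀⟩ := exists_between hpp₀
  have hp'0 : 0 ≤ p' := hp.trans hpp'.le
  have hp'1 : p' < 1 := hp'p₀.trans hp₀1
  have hp1 : p < 1 := hpp'.trans hp'1
  obtain ⟨δ, hδ0, hδ⟩ := exists_exp_mul_le hp'p₀ 9
  obtain ⟨ℓ, hℓ1, hedge⟩ := exists_edge_bound hG
  have hℓ0 : (0 : ℝ) < ℓ := by exact_mod_cast hℓ1
  -- This makes `δ * K / 2 ≥ 1 + log 9`: the term `log 9` pays for the number of chains and 1 is the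
  -- remaining rate.
  obtain ⟨K, hK⟩ := exists_nat_ge (max 1 ((1 + Real.log 9) * 2 / δ))
  have hK1 : 1 ≤ K := by exact_mod_cast (le_max_left _ _).trans hK
  have hKδ : 1 + Real.log 9 ≤ δ * K / 2 := by
    have := (le_max_right _ _).trans hK
    rw [div_le_iff₀ hδ0] at this
    linarith
  obtain ⟨C, hC0, L₀, hC⟩ := exists_weakCross_le hG haxis hp₀0 hp₀1 hq (j := 2 * ℓ) (by omega)
  -- The total factor between the crossing probability of the rectangle and that of an annulus. It
  -- is fixed before the scale `L`.
  set N : ℝ := 2 * (12 * K + 3) ^ 2 * C with hN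
  have hN0 : 0 < N := by positivity
  -- a scale at which crossings are unlikely
  obtain ⟨L, hLcross, hL⟩ : ∃ L : ℕ, φ₀ (crossV G pos (2 * L) L) < ENNReal.ofReal (1 / (2 * N)) ∧
      max L₀ (4 * ℓ + 1) ≤ L := by
    have hfreq : ∃ᶠ n : ℕ in Filter.atTop,
        φ₀ (crossV G pos (2 * n) n) < ENNReal.ofReal (1 / (2 * N)) := by
      refine Filter.frequently_lt_of_liminf_lt (by isBoundedDefault) ?_
      rw [hcross]
      exact ENNReal.ofReal_pos.2 (by positivity)
    exact (hfreq.and_eventually (Filter.eventually_ge_atTop _)).exists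
  have hLL₀ : L₀ ≤ L := (le_max_left _ _).trans hL
  have hL4 : 4 * (ℓ : ℝ) < L := by
    have : 4 * ℓ + 1 ≤ L := (le_max_right _ _).trans hL
    have : 4 * ℓ < L := by omega
    exact_mod_cast this
  have hL0 : (0 : ℝ) < L := by linarith
  have hcr : φ₀.real (crossV G pos (2 * L) L) ≤ 1 / (2 * N) := by
    rw [measureReal_def]
    exact ENNReal.toReal_le_of_le_ofReal (by positivity) hLcross.le
  set R : ℝ := 4 * K * L with hR
  have hR0 : 0 < R := by positivity
  have hann : ∀ (E : Finset G.edgeSet) c, ∀ i < K,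
      ev G p₀ q E ⊥ (ind (annulusCross G pos R (4 * L) ℓ c i)) ≤ 1 / 2 := by
    intro E c i hi
    have h1 := ev_bot_annulusCross_le hG hp₀0.le hp₀1 hq hφ₀ E hℓ0 hL4 hedge c hi
    have h2 := hC L hLL₀ φ₀ hφ₀
    push_cast at h2
    calc _ ≤ 2 * (12 * K + 3) ^ 2 * (C * φ₀.real (crossV G pos (2 * L) L)) :=
          h1.trans (mul_le_mul_of_nonneg_left h2 (by positivity))
      _ = N * φ₀.real (crossV G pos (2 * L) L) := by rw [hN]; ring
      _ ≤ N * (1 / (2 * N)) := mul_le_mul_of_nonneg_left hcr hN0.le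
      _ = 1 / 2 := by field_simp
  have hKR : (K : ℝ) * (4 * L) = R := by rw [hR]; ring
  have hdecay : ∀ φ : MeasureTheory.Measure (Config G), IsInfiniteVolume G p q φ →
      ∀ x y : V, ∀ k : ℕ, 3 ≤ k → ((k : ℤ) ≤ |(cell pos R x).1 - (cell pos R y).1| ∨
        (k : ℤ) ≤ |(cell pos R x).2 - (cell pos R y).2|) →
      φ.real (connected G x y) ≤ Real.exp (-k) := by
    intro φ hφ x y k hk3 hk
    have := hφ.isProbabilityMeasure
    have hsub : connected G x y ⊆ ⋃ s ∈ chainSteps (cell pos R x) k,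
        chainCross G pos R (4 * L) ℓ K (chainCells (cell pos R x) s) := by
      intro ω hω
      obtain ⟨s, hs, h⟩ := exists_chainCross hK1 hℓ0.le (by linarith) hedge hKR hω hk3 hk
      exact Set.mem_biUnion (Finset.mem_coe.2 hs) h
    have hterm : ∀ s ∈ chainSteps (cell pos R x) k,
        φ.real (chainCross G pos R (4 * L) ℓ K (chainCells (cell pos R x) s)) ≤
          Real.exp (-(δ * K / 2 * k)) := by
      intro s hs
      obtain ⟨S, hS⟩ := exists_determinedBy_chainCross hG R (4 * L) ℓ K
        (chainCells (cell pos R x) s)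
      refine hφ.measureReal_le_of_ev_bot_le hG hp hpp' hp'1 hq (isUpperSet_chainCross _ _ _ _ _)
        hS fun E => ?_
      have h1 := ev_chainCross_le hp'0 hp'1 hp₀0.le hp₀1 hq hδ0.le hδ hR0 (by linarith)
        hKR.le (chainCells (cell pos R x) s) E (hann E)
      rwa [(Finset.mem_filter.1 hs).2] at h1
    calc φ.real (connected G x y)
        ≤ φ.real (⋃ s ∈ chainSteps (cell pos R x) k,
            chainCross G pos R (4 * L) ℓ K (chainCells (cell pos R x) s)) :=
          measureReal_mono hsub (measure_ne_top _ _)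
      _ ≤ ∑ s ∈ chainSteps (cell pos R x) k,
            φ.real (chainCross G pos R (4 * L) ℓ K (chainCells (cell pos R x) s)) :=
          measureReal_biUnion_finset_le _ _
      _ ≤ (chainSteps (cell pos R x) k).card • Real.exp (-(δ * K / 2 * k)) :=
          Finset.sum_le_card_nsmul _ _ _ hterm
      _ ≤ 9 ^ k * Real.exp (-(δ * K / 2 * k)) := by
          rw [nsmul_eq_mul]
          exact mul_le_mul_of_nonneg_right (by exact_mod_cast card_chainSteps_le _ _)
            (Real.exp_pos _).le
      _ = Real.exp (k * Real.log 9 + -(δ * K / 2 * k)) := by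
          rw [Real.exp_add, Real.exp_nat_mul, Real.exp_log (by norm_num)]
      _ ≤ Real.exp (-k) := by
          refine Real.exp_le_exp.2 ?_
          have := mul_le_mul_of_nonneg_right hKδ (Nat.cast_nonneg (α := ℝ) k)
          linarith
  obtain ⟨D, hD⟩ := exists_degree_bound hG
  set κ : ℝ := (1 - p) ^ D with hκ
  have hκ0 : 0 < κ := pow_pos (by linarith) D
  -- The first term serves cell distances `k ≥ 3`, where `|x - y| ≤ 2 (k + 1) R ≤ 4kR`. The second
  -- serves `k ≤ 2`, where `|x - y| ≤ 6R` and `1 - κ ≤ exp (-κ)`.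
  refine ⟨min (1 / (4 * R)) (κ / (6 * R)), lt_min (by positivity) (by positivity),
    fun φ hφ x y => ?_⟩
  have := hφ.isProbabilityMeasure
  by_cases hxy : x = y
  · simp [hxy, measureReal_le_one]
  set c := min (1 / (4 * R)) (κ / (6 * R)) with hc
  set k : ℕ := max |(cell pos R x).1 - (cell pos R y).1|.toNat
    |(cell pos R x).2 - (cell pos R y).2|.toNat with hk
  have hk1 : |(cell pos R x).1 - (cell pos R y).1| ≤ k := by
    have : |(cell pos R x).1 - (cell pos R y).1|.toNat ≤ k := le_max_left _ _
    omega
  have hk2 : |(cell pos R x).2 - (cell pos R y).2| ≤ k := by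
    have : |(cell pos R x).2 - (cell pos R y).2|.toNat ≤ k := le_max_right _ _
    omega
  have hnorm := norm_sub_le_of_cell hR0 hk1 hk2
  rcases lt_or_ge k 3 with hk3 | hk3
  · have h1 := measureReal_connected_le hp hp1 hq hφ hxy (hG.finite_neighbors x) (hD x)
    have hk2' : (k : ℝ) ≤ 2 := by exact_mod_cast (by omega : k ≤ 2)
    have hnorm6 : ‖pos x - pos y‖ ≤ 6 * R := hnorm.trans (by nlinarith)
    have h2 : c * ‖pos x - pos y‖ ≤ κ := by
      calc c * ‖pos x - pos y‖ ≤ κ / (6 * R) * (6 * R) :=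
            mul_le_mul (min_le_right _ _) hnorm6 (norm_nonneg _) (by positivity)
        _ = κ := div_mul_cancel₀ _ (by positivity)
    have h3 := Real.add_one_le_exp (-c * ‖pos x - pos y‖)
    linarith
  · have hcases : (k : ℤ) ≤ |(cell pos R x).1 - (cell pos R y).1| ∨
        (k : ℤ) ≤ |(cell pos R x).2 - (cell pos R y).2| := by
      have n1 := abs_nonneg ((cell pos R x).1 - (cell pos R y).1)
      have n2 := abs_nonneg ((cell pos R x).2 - (cell pos R y).2)
      omega
    refine (hdecay φ hφ x y k hk3 hcases).trans (Real.exp_le_exp.2 ?_)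
    have hk3' : (3 : ℝ) ≤ k := by exact_mod_cast hk3
    have h2 : c * ‖pos x - pos y‖ ≤ k := by
      calc c * ‖pos x - pos y‖ ≤ 1 / (4 * R) * (4 * k * R) :=
            mul_le_mul (min_le_left _ _) (hnorm.trans (by nlinarith)) (norm_nonneg _)
              (by positivity)
        _ = k := by field_simp
    linarith
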